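/- Let $d\ge 1$, $0<\alpha<2$, $0<\mu_-\le\mu_+<\infty$, and let $\mu\in L_\infty(\mathbb R^d\times\mathbb R^d)$ be real-valued with $\mu_-\le\mu(x,y)\le\mu_+$, $\mu(x,y)=\mu(y,x)$ and $\mu(x+m,y+n)=\mu(x,y)$ for (almost) all $x,y\in\mathbb R^d$ and all $m,n\in\mathbb Z^d$. Put $\Omega=[0,1)^d$ and $\widetilde\Omega=[-\pi,\pi)^d$. Let $\widetilde H^{\alpha/2}(\Omega)$ be the space of functions in $H^{\alpha/2}(\Omega)$ whose $\mathbb Z^d$-periodic extension is in $H^{\alpha/2}_{\mathrm{loc}}(\mathbb R^d)$; such functions are identified with their periodic extensions. For $\xi\in\widetilde\Omega$ let $\mathbb A(\xi)$ be the self-adjoint operator in $L_2(\Omega)$ that corresponds to the closed quadratic form $$a(\xi)[u,u]=\frac12\int_{\mathbb R^d}dy\int_\Omega dx\,\mu(x,y)\,\frac{|e^{i\langle\xi,x\rangle}u(x)-e^{i\langle\xi,y\rangle}u(y)|^2}{|x-y|^{d+\alpha}},\qquad u\in\widetilde H^{\alpha/2}(\Omega),$$ and let $\mathbb A^0(\xi)=\mu^0c_0(d,\alpha)\,|D+\xi|^\alpha$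 with periodic boundary conditions and $D=-i\nabla$, that is, the operator in $L_2(\Omega)$ that multiplies the $n$-th Fourier coefficient $\int_\Omega u(x)e^{-2\pi i\langle n,x\rangle}dx$ by $\mu^0c_0(d,\alpha)|2\pi n+\xi|^\alpha$, $n\in\mathbb Z^d$, on its maximal domain; here $$\mu^0=\int_\Omega\int_\Omega\mu(x,y)\,dx\,dy,\qquad c_0(d,\alpha)=\int_{\mathbb R^d}\frac{1-\cos z_1}{|z|^{d+\alpha}}\,dz.$$ Then there is a constant $C$ that depends only on $d,\alpha,\mu_-,\mu_+$ such that for all $\varepsilon>0$ and all $\xi\in\widetilde\Omega$ the bounded inverses below exist and $$\left\|(\mathbb A(\xi)+\varepsilon^\alpha I)^{-1}-(\mathbb A^0(\xi)+\varepsilon^\alpha I)^{-1}\right\|_{L_2(\Omega)\to L_2(\Omega)}\le C\begin{cases}1,&0<\alpha<1,\\(1+|\ln\varepsilon|)^2,&\alpha=1,\\\varepsilon^{2-2\alpha},&1<\alpha<2.\end{cases}$$ -/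

import Mathlib

open MeasureTheory Set
open scoped ENNReal

namespace Levy

/-- The space `ℝ^d` with its Euclidean norm. -/
abbrev E (d : ℕ) : Type := EuclideanSpace ℝ (Fin d)

/-- The point of the lattice `ℤ^d ⊆ ℝ^d` with integer coordinates `n`. -/
noncomputable def latticePt {d : ℕ} (n : Fin d → ℤ) : E d :=
  WithLp.toLp 2 fun i => (n i : ℝ)

/-- The unit cell `Ω = [0,1)^d`. -/
def cell (d : ℕ) : Set (E d) := {x | ∀ i, x i ∈ Ico (0 : ℝ) 1}

/-- The dual cell (Brillouin zone) `[-π,π)^d`. -/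
def dualCell (d : ℕ) : Set (E d) := {ξ | ∀ i, ξ i ∈ Ico (-Real.pi) Real.pi}

/-- The complex Hilbert space `L_2(Ω)`. -/
abbrev L2Cell (d : ℕ) : Type := Lp ℂ 2 ((volume : Measure (E d)).restrict (cell d))

/-- The representative of `x ∈ ℝ^d` modulo `ℤ^d` in the cell `[0,1)^d`. -/
noncomputable def toCell {d : ℕ} (x : E d) : E d :=
  WithLp.toLp 2 fun i => Int.fract (x i)

/-- The `ℤ^d`-periodic extension to `ℝ^d` of a function on the cell. -/
noncomputable def perExt {d : ℕ} (u : E d → ℂ) : E d → ℂ := fun x => u (toCell x)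

/-- Membership in the Sobolev space `H^s(D)`, for `0 < s < 1`, in the Gagliardo–Slobodeckij form:
`u ∈ L_2(D)` and `∫_D ∫_D |u(x) - u(y)|² / |x - y|^{d + 2s} dx dy < ∞`. -/
def MemSobolev {d : ℕ} (s : ℝ) (D : Set (E d)) (u : E d → ℂ) : Prop :=
  MemLp u 2 (volume.restrict D) ∧
    ∫⁻ x in D, ∫⁻ y in D,
      ENNReal.ofReal (‖u x - u y‖ ^ 2 / ‖x - y‖ ^ ((d : ℝ) + 2 * s)) < ∞

/-- Membership in `H^s_loc(ℝ^d)`, for `0 < s < 1`. -/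
def MemSobolevLoc {d : ℕ} (s : ℝ) (u : E d → ℂ) : Prop :=
  ∀ r : ℝ, MemSobolev s (Metric.ball (0 : E d) r) u

/-- The periodic Sobolev space on the cell, for `0 < s < 1`: the functions in `H^s(Ω)` whose
`ℤ^d`-periodic extension belongs to `H^s_loc(ℝ^d)`. -/
def perSobolev (d : ℕ) (s : ℝ) : Set (L2Cell d) :=
  {u | MemSobolev s (cell d) u ∧ MemSobolevLoc s (perExt u)}

/-- The quasi-periodic function `x ↦ e^{i⟨ξ,x⟩} u(x)`, `u` being extended periodically. -/
noncomputable def bloch {d : ℕ} (ξ : E d) (u : E d → ℂ) (x : E d) : ℂ :=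
  Complex.exp (Complex.I * ((inner ℝ ξ x : ℝ) : ℂ)) * perExt u x

/-- The sesquilinear form `a(ξ; α, μ)[u, v]` (linear in `u`, antilinear in `v`)
of the quadratic form
`½ ∫_{ℝ^d} dy ∫_Ω dx μ(x,y) |e^{i⟨ξ,x⟩}u(x) - e^{i⟨ξ,y⟩}u(y)|² / |x - y|^{d+α}`. -/
noncomputable def blochForm {d : ℕ} (α : ℝ) (μ : E d → E d → ℝ) (ξ : E d) (u v : L2Cell d) : ℂ :=
  (1 / 2 : ℂ) * ∫ p : E d × E d,
    ((μ p.1 p.2 / ‖p.1 - p.2‖ ^ ((d : ℝ) + α) : ℝ) : ℂ) *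
      ((bloch ξ u p.1 - bloch ξ u p.2) * (starRingEnd ℂ) (bloch ξ v p.1 - bloch ξ v p.2))
    ∂((volume.restrict (cell d)).prod volume)

/-- The graph `{(u, 𝔸(ξ)u)}` of the self-adjoint operator `𝔸(ξ) = 𝔸(ξ; α, μ)` in `L_2(Ω)` that
corresponds to the form `a(ξ; α, μ)` with the periodic Sobolev space of order `α/2` as its domain:
`u ∈ Dom 𝔸(ξ)` and `𝔸(ξ)u = f` mean that `u` lies in the form domain and that
`a(ξ)[u, v] = (f, v)` for every `v` in the form domain. -/
def opGraph {d : ℕ} (α : ℝ) (μ : E d → E d → ℝ) (ξ : E d) : Set (L2Cell d × L2Cell d) :=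
  {p | p.1 ∈ perSobolev d (α / 2) ∧
    ∀ v ∈ perSobolev d (α / 2), blochForm α μ ξ p.1 v = inner ℂ v p.2}

/-- The Fourier coefficient `∫_Ω u(x) e^{-2πi⟨n,x⟩} dx`. -/
noncomputable def fourierCoef {d : ℕ} (u : L2Cell d) (n : Fin d → ℤ) : ℂ :=
  ∫ x in cell d, u x * Complex.exp (-(2 * Real.pi * Complex.I *
    ((inner ℝ (latticePt n) x : ℝ) : ℂ)))

/-- The constant `c₀(d, α) = ∫_{ℝ^d} (1 - cos z₁) / |z|^{d+α} dz`. -/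
noncomputable def c0 (d : ℕ) [NeZero d] (α : ℝ) : ℝ :=
  ∫ z : E d, (1 - Real.cos (z 0)) / ‖z‖ ^ ((d : ℝ) + α)

/-- The mean value `μ⁰ = ∫_Ω ∫_Ω μ(x,y) dx dy`. -/
noncomputable def meanCoef {d : ℕ} (μ : E d → E d → ℝ) : ℝ :=
  ∫ p : E d × E d, μ p.1 p.2 ∂((volume.restrict (cell d)).prod (volume.restrict (cell d)))

/-- The graph of the self-adjoint operator `κ |D + ξ|^α`, `D = -i∇`, in `L_2(Ω)` with periodic
boundary conditions, i.e. of the Fourier multiplier `κ |2πn + ξ|^α` on its maximal domain: `u` is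
in the domain exactly when the sequence `κ |2πn + ξ|^α û_n` is square-summable, i.e. is the sequence
of Fourier coefficients of some `f ∈ L_2(Ω)`, and `f` is then the image of `u`. -/
def multGraph {d : ℕ} (α κ : ℝ) (ξ : E d) : Set (L2Cell d × L2Cell d) :=
  {p | ∀ n : Fin d → ℤ, fourierCoef p.2 n =
    ((κ * ‖(2 * Real.pi) • latticePt n + ξ‖ ^ α : ℝ) : ℂ) * fourierCoef p.1 n}

/-- The graph of the effective operator `𝔸⁰(ξ) = μ⁰ c₀(d,α) |D + ξ|^α`. -/
noncomputable def effGraph {d : ℕ} [NeZero d] (α : ℝ) (μ : E d → E d → ℝ) (ξ : E d) :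
    Set (L2Cell d × L2Cell d) :=
  multGraph α (meanCoef μ * c0 d α) ξ

/-- The bounded operator `R` on `H` is `(A + t I)⁻¹`, where `A` is the (unbounded) operator with
graph `G`: one has `R f = u` if and only if `u ∈ Dom A` and `A u + t u = f`. -/
def IsShiftedInverse {H : Type*} [NormedAddCommGroup H] [InnerProductSpace ℂ H]
    (G : Set (H × H)) (t : ℝ) (R : H →L[ℂ] H) : Prop :=
  ∀ f u : H, R f = u ↔ ∃ g : H, (u, g) ∈ G ∧ g + (t : ℂ) • u = f

/-- The conditions on the coefficient `μ ∈ L_∞(ℝ^d × ℝ^d)` (relations between `L_∞`-functions, so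
up to null sets): the bounds `μ₋ ≤ μ ≤ μ₊`, symmetry, and `ℤ^d`-periodicity in each variable. -/
structure IsCoefficient {d : ℕ} (μm μp : ℝ) (μ : E d → E d → ℝ) : Prop where
  aemeasurable : AEMeasurable (fun p : E d × E d => μ p.1 p.2) volume
  bounds : ∀ᵐ p : E d × E d, μm ≤ μ p.1 p.2 ∧ μ p.1 p.2 ≤ μp
  symm : ∀ᵐ p : E d × E d, μ p.1 p.2 = μ p.2 p.1
  periodic : ∀ m n : Fin d → ℤ,
    ∀ᵐ p : E d × E d, μ (p.1 + latticePt m) (p.2 + latticePt n) = μ p.1 p.2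

/-- The rate `1`, `(1 + |ln ε|)²`, `ε^{2-2α}` for `0 < α < 1`, `α = 1`, `1 < α < 2`. -/
noncomputable def rate (α ε : ℝ) : ℝ :=
  if α < 1 then 1
  else if α = 1 then (1 + |Real.log ε|) ^ 2
  else ε ^ (2 - 2 * α)

end Levy

/-!
Write `L_2(Ω)` as the sum of the constants and the functions of mean value zero. For `μ = 1` the
form is diagonal in the Fourier basis `e^{2πi⟨n,x⟩}` with symbol `c₀ |2πn + ξ|^α`
(`energy_eq_tsum`). Hence the form domain is the space of all `u` with
`∑ |2πn + ξ|^α |û_n|² < ∞` (`mem_perSobolev_iff`), the form is bounded below there by `c₀ μ₋` times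
this sum, and the resolvent exists by the Lax–Milgram argument
(`IsPeriodicCoefficient.exists_resolvent`). Since `|2πn + ξ| ≥ π` for `n ≠ 0`, the form controls the
`L_2`-norm on functions of mean value zero, uniformly in `ξ`; small denominators occur only for
constants.

Put `s = |ξ|`, let `τ` be the integral of `min(s|z|, 1) |z|^{-d-α}` over `|z| > 1` (`tail`), and let
`β = s + τ`. Two estimates carry the proof, `e` being the constant function `1`.

* The coupling: `|a(ξ)[e, v]| ≲ β a(ξ)[v, v]^{1/2}` for `v` of mean value zero, by the
  Cauchy–Schwarz inequality for short increments `z = y - x` and by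
  `|e^{i⟨ξ,z⟩} - 1| ≤ 2 min(s|z|, 1)` for long ones (`exists_norm_blochForm_constOne_le`).
* The averaging: `|a(ξ)[e, e] - μ⁰ c₀ s^α| ≲ s² + s τ ≤ β²` (`exists_norm_blochForm_sub_le`). Here
  `a(ξ)[e, e]` is the integral of `μ(x, x + z)` against the kernel `(1 - cos⟨ξ,z⟩) |z|^{-d-α}`, whose
  full integral is `c₀ s^α`. A periodic function may be replaced by its mean value up to the
  `L_1`-modulus of continuity of the kernel (`abs_integral_mul_sub_mean_le`).

Let `t = ε^α`, `T = s^α + t`, and let `u = c e + v` solve `𝔸(ξ)u + tu = f`. Testing the equation with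
`u`, with `v` and with `e` gives three real inequalities. They imply that `v`, and the difference
between `c` and its counterpart `f̂₀ / (μ⁰ c₀ s^α + t)` for the effective operator, are
`O((1 + β/T)² ‖f‖)` (`exists_coupled_estimate`, `exists_norm_resolvent_sub_le`). The remaining part
of the effective resolvent is bounded. Finally `(1 + β/T)²` is bounded by the rate for `ε ≤ 1`
(`exists_coupling_le_rate`): `τ ≲ s^α` for `α < 1`, `τ ≲ s` for `α > 1`, and for `α = 1` one has
`τ ≲ (1 - γ)⁻¹ s^γ` for every `γ < 1`, where `γ = 1 - (1 + |ln ε|)⁻¹`. For `ε > 1` the bound `ε^{-α}`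
of both resolvents suffices.
-/

namespace Levy

/-! ### The cell as a model of the torus -/

/-- The projection of `ℝ^d` onto the torus `(ℝ/ℤ)^d`. -/
def torusMk {d : ℕ} (x : E d) : Fin d → UnitAddCircle := fun i => (x i : UnitAddCircle)

/-- The section of `torusMk` with values in the cell `[0,1)^d`. -/
noncomputable def torusSec {d : ℕ} (t : Fin d → UnitAddCircle) : E d :=
  WithLp.toLp 2 fun i => ((AddCircle.equivIco 1 0 (t i) : Ico (0 : ℝ) (0 + 1)) : ℝ)

/-- The normalised Haar measure of the torus. -/
noncomputable def torusVol (d : ℕ) : Measure (Fin d → UnitAddCircle) :=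
  Measure.pi fun _ => AddCircle.haarAddCircle

instance (d : ℕ) : Measure.IsAddRightInvariant (torusVol d) := by
  unfold torusVol; infer_instance

lemma torusSec_torusMk {d : ℕ} (x : E d) : torusSec (torusMk x) = toCell x := by
  ext i
  simp [torusSec, torusMk, toCell, AddCircle.coe_equivIco_mk_apply]

lemma torusMk_torusSec {d : ℕ} (t : Fin d → UnitAddCircle) : torusMk (torusSec t) = t := by
  funext i
  simp only [torusMk, torusSec]
  exact (AddCircle.equivIco 1 0).symm_apply_apply (t i)

lemma torusMk_add {d : ℕ} (x y : E d) : torusMk (x + y) = torusMk x + torusMk y := by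
  funext i; simp [torusMk]

lemma measurable_torusMk {d : ℕ} : Measurable (torusMk (d := d)) :=
  measurable_pi_lambda _ fun i =>
    AddCircle.measurable_mk'.comp (by fun_prop : Measurable fun x : E d => x i)

lemma measurable_torusSec {d : ℕ} : Measurable (torusSec (d := d)) := by
  refine (WithLp.measurable_toLp 2 (Fin d → ℝ)).comp (measurable_pi_lambda _ fun i => ?_)
  exact measurable_subtype_coe.comp
    ((AddCircle.measurableEquivIco 1 0).measurable.comp (measurable_pi_apply i))

lemma measurable_toCell {d : ℕ} : Measurable (toCell (d := d)) := by
  refine (WithLp.measurable_toLp 2 (Fin d → ℝ)).comp (measurable_pi_lambda _ fun i => ?_)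
  exact measurable_fract.comp (by fun_prop : Measurable fun x : E d => x i)

lemma cell_eq_preimage (d : ℕ) :
    cell d = WithLp.ofLp (p := 2) ⁻¹' (univ.pi fun _ : Fin d => Ico (0 : ℝ) 1) := by
  ext x; simp [cell]

lemma measurableSet_cell (d : ℕ) : MeasurableSet (cell d) := by
  rw [cell_eq_preimage]
  exact (WithLp.measurable_ofLp 2 (Fin d → ℝ)) (MeasurableSet.univ_pi fun _ => measurableSet_Ico)

lemma toCell_mem {d : ℕ} (x : E d) : toCell x ∈ cell d := fun i =>
  ⟨Int.fract_nonneg (x i), Int.fract_lt_one (x i)⟩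

lemma toCell_of_mem {d : ℕ} {x : E d} (hx : x ∈ cell d) : toCell x = x := by
  ext i
  exact Int.fract_eq_self.2 (hx i)

lemma toCell_toCell {d : ℕ} (x : E d) : toCell (toCell x) = toCell x :=
  toCell_of_mem (toCell_mem x)

lemma toCell_add_latticePt {d : ℕ} (x : E d) (n : Fin d → ℤ) :
    toCell (x + latticePt n) = toCell x := by
  ext i
  simp [toCell, latticePt]

/-- Every point is a lattice translate of its representative in the cell. -/
lemma toCell_add_floor {d : ℕ} (x : E d) : toCell x + latticePt (fun i => ⌊x i⌋) = x := by
  ext i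
  simp [toCell, latticePt, Int.fract_add_floor]

lemma add_neg_floor_eq_toCell {d : ℕ} (x : E d) :
    x + latticePt (fun i => -⌊x i⌋) = toCell x := by
  ext i
  simp [toCell, latticePt, Int.fract, sub_eq_add_neg]

lemma measurePreserving_ofLp_cell (d : ℕ) :
    MeasurePreserving (WithLp.ofLp (p := 2)) ((volume : Measure (E d)).restrict (cell d))
      (Measure.pi fun _ : Fin d => (volume : Measure ℝ).restrict (Ico 0 1)) := by
  have h := (PiLp.volume_preserving_ofLp (Fin d)).restrict_preimage
    (MeasurableSet.univ_pi fun _ : Fin d => measurableSet_Ico (a := (0 : ℝ)) (b := 1))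
  rw [← cell_eq_preimage, volume_pi, Measure.restrict_pi_pi] at h
  exact h

lemma measurePreserving_torusMk (d : ℕ) :
    MeasurePreserving (torusMk (d := d)) (volume.restrict (cell d)) (torusVol d) := by
  have h1 : MeasurePreserving (fun x : ℝ => (x : UnitAddCircle)) (volume.restrict (Ico 0 1))
      AddCircle.haarAddCircle := by
    have h := AddCircle.measurePreserving_mk 1 0
    rw [zero_add, ← Measure.restrict_congr_set Ico_ae_eq_Ioc, AddCircle.volume_eq_smul_haarAddCircle] at h
    simpa using h
  exact (measurePreserving_pi _ _ fun _ : Fin d => h1).comp (measurePreserving_ofLp_cell d)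

lemma measurePreserving_torusSec (d : ℕ) :
    MeasurePreserving (torusSec (d := d)) (torusVol d) (volume.restrict (cell d)) := by
  refine ⟨measurable_torusSec, ?_⟩
  rw [← (measurePreserving_torusMk d).map_eq, Measure.map_map measurable_torusSec measurable_torusMk]
  have : (torusSec ∘ torusMk : E d → E d) =ᵐ[volume.restrict (cell d)] id := by
    filter_upwards [ae_restrict_mem (measurableSet_cell d)] with x hx
    simp [torusSec_torusMk, toCell_of_mem hx]
  rw [Measure.map_congr this, Measure.map_id]

instance (d : ℕ) : IsProbabilityMeasure (torusVol d) := by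
  unfold torusVol; infer_instance

instance (d : ℕ) : IsProbabilityMeasure ((volume : Measure (E d)).restrict (cell d)) :=
  (measurePreserving_torusSec d).map_eq ▸
    Measure.isProbabilityMeasure_map measurable_torusSec.aemeasurable

/-! ### Periodic functions -/

/-- A function on `ℝ^d` is periodic: its values are determined by those on the cell. -/
def IsPeriodic {d : ℕ} {β : Type*} (f : E d → β) : Prop := ∀ x, f (toCell x) = f x

lemma IsPeriodic.add_latticePt {d : ℕ} {β : Type*} {f : E d → β} (hf : IsPeriodic f) (x : E d)
    (n : Fin d → ℤ) : f (x + latticePt n) = f x := by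
  rw [← hf, toCell_add_latticePt, hf]

lemma isPeriodic_of_add_latticePt {d : ℕ} {β : Type*} {f : E d → β}
    (hf : ∀ x (n : Fin d → ℤ), f (x + latticePt n) = f x) : IsPeriodic f := fun x => by
  conv_rhs => rw [← toCell_add_floor x, hf]

lemma IsPeriodic.comp {d : ℕ} {β γ : Type*} {f : E d → β} (hf : IsPeriodic f) (g : β → γ) :
    IsPeriodic fun x => g (f x) := fun x => congrArg g (hf x)

lemma IsPeriodic.comp_add {d : ℕ} {β : Type*} {f : E d → β} (hf : IsPeriodic f) (z : E d) :
    IsPeriodic fun x => f (x + z) :=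
  isPeriodic_of_add_latticePt fun x n => by rw [add_right_comm, hf.add_latticePt]

lemma isPeriodic_perExt {d : ℕ} (u : E d → ℂ) : IsPeriodic (perExt u) := fun x => by
  simp only [perExt, toCell_toCell]

lemma IsPeriodic.eq_torus {d : ℕ} {β : Type*} {f : E d → β} (hf : IsPeriodic f) (x z : E d) :
    f (x + z) = f (torusSec (torusMk x + torusMk z)) := by
  rw [← torusMk_add, torusSec_torusMk, hf]

lemma IsPeriodic.lintegral_add {d : ℕ} {f : E d → ℝ≥0∞} (hp : IsPeriodic f) (hf : Measurable f)
    (z : E d) : ∫⁻ x in cell d, f (x + z) = ∫⁻ x in cell d, f x := by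
  simp_rw [hp.eq_torus]
  rw [(measurePreserving_torusMk d).lintegral_comp
    (f := fun t => f (torusSec (t + torusMk z)))
    (hf.comp (measurable_torusSec.comp (measurable_id.add_const _))),
    lintegral_add_right_eq_self (fun t => f (torusSec t)),
    (measurePreserving_torusSec d).lintegral_comp hf]

lemma IsPeriodic.integral_add {d : ℕ} {F : Type*} [NormedAddCommGroup F] [NormedSpace ℝ F]
    {f : E d → F} (hp : IsPeriodic f) (hf : StronglyMeasurable f)
    (z : E d) : ∫ x in cell d, f (x + z) = ∫ x in cell d, f x := by
  simp_rw [hp.eq_torus]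
  have h1 : StronglyMeasurable fun t => f (torusSec t) := hf.comp_measurable measurable_torusSec
  have h2 : StronglyMeasurable fun t => f (torusSec (t + torusMk z)) :=
    h1.comp_measurable (measurable_id.add_const _)
  rw [← integral_map (φ := torusMk) measurable_torusMk.aemeasurable
    (f := fun t => f (torusSec (t + torusMk z))) h2.aestronglyMeasurable,
    (measurePreserving_torusMk d).map_eq,
    integral_add_right_eq_self (fun t => f (torusSec t)),
    ← integral_map measurable_torusSec.aemeasurable hf.aestronglyMeasurable,
    (measurePreserving_torusSec d).map_eq]

/-- Null sets of the cell extend periodically to null sets of `ℝ^d`. -/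
lemma ae_toCell {d : ℕ} {p : E d → Prop} (h : ∀ᵐ x ∂(volume.restrict (cell d)), p x) :
    ∀ᵐ x : E d, p (toCell x) := by
  rw [ae_restrict_iff' (measurableSet_cell d)] at h
  have h2 : ∀ᵐ x : E d, ∀ n : Fin d → ℤ, x + latticePt n ∈ cell d → p (x + latticePt n) := by
    rw [ae_all_iff]
    intro n
    exact (measurePreserving_add_right volume (latticePt n)).quasiMeasurePreserving.ae h
  filter_upwards [h2] with x hx
  have := hx (fun i => -⌊x i⌋)
  rw [add_neg_floor_eq_toCell] at this
  exact this (toCell_mem x)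

/-- A periodic function which is integrable over the cell is locally integrable. -/
lemma IsPeriodic.lintegral_ball_lt_top {d : ℕ} {f : E d → ℝ≥0∞} (hp : IsPeriodic f)
    (hfin : ∫⁻ x in cell d, f x < ∞) (r : ℝ) :
    ∫⁻ x in Metric.ball 0 r, f x < ∞ := by
  set N : ℤ := ⌈r⌉ + 1
  set F : Finset (Fin d → ℤ) := Finset.Icc (fun _ => -N) (fun _ => N)
  have hsub : Metric.ball (0 : E d) r ⊆ ⋃ n ∈ F, (fun x => x + latticePt n) ⁻¹' cell d := by
    intro x hx
    have hx' : ‖x‖ < r := by simpa using hx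
    simp only [mem_iUnion, mem_preimage]
    refine ⟨fun i => -⌊x i⌋, ?_, ?_⟩
    · rw [Finset.mem_Icc, Pi.le_def, Pi.le_def]
      have key : ∀ i, |(⌊x i⌋ : ℝ)| ≤ N := by
        intro i
        have h1 : |x i| ≤ ‖x‖ := by simpa using PiLp.norm_apply_le x i
        have h2 := Int.floor_le (x i)
        have h3 := Int.lt_floor_add_one (x i)
        have h4 := Int.le_ceil r
        have h5 := abs_le.1 h1
        have : (N : ℝ) = ⌈r⌉ + 1 := by simp [N]
        rw [this, abs_le]; constructor <;> linarith [h5.1, h5.2]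
      constructor <;> intro i <;> have := abs_le.1 (key i) <;> norm_cast at this <;>
        simp only <;> omega
    · rw [add_neg_floor_eq_toCell]
      exact toCell_mem x
  have hone : ∀ n, ∫⁻ x in (fun x => x + latticePt n) ⁻¹' cell d, f x = ∫⁻ x in cell d, f x := by
    intro n
    rw [← (measurePreserving_add_right volume (latticePt n)).setLIntegral_comp_preimage_emb
      (measurableEmbedding_addRight _) f (cell d)]
    simp_rw [hp.add_latticePt]
  calc ∫⁻ x in Metric.ball 0 r, f x
      ≤ ∫⁻ x in ⋃ n ∈ F, (fun x => x + latticePt n) ⁻¹' cell d, f x := lintegral_mono_set hsub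
    _ = ∫⁻ x in ⋃ n : F, (fun x => x + latticePt n.1) ⁻¹' cell d, f x := by
        rw [← iUnion_subtype (fun n => n ∈ F)
          (fun n => (fun x => x + latticePt n.1) ⁻¹' cell d)]
    _ ≤ ∑' n : F, ∫⁻ x in (fun x => x + latticePt n.1) ⁻¹' cell d, f x :=
        lintegral_iUnion_le _ _
    _ < ∞ := by
        simp_rw [hone]
        rw [tsum_fintype]
        exact ENNReal.sum_lt_top.2 fun _ _ => hfin

/-! ### Fourier series on the cell -/

/-- The monomials form a Hilbert basis of `L_2` of the torus. -/
noncomputable def torusBasis (d : ℕ) : HilbertBasis (Fin d → ℤ) ℂ (Lp ℂ 2 (torusVol d)) :=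
  UnitAddTorus.mFourierBasis

/-- The identification of `L_2(Ω)` with `L_2` of the torus. -/
noncomputable def toTorusL2 (d : ℕ) : L2Cell d ≃ₗᵢ[ℂ] Lp ℂ 2 (torusVol d) :=
  LinearIsometryEquiv.ofSurjective
    (Lp.compMeasurePreservingₗᵢ ℂ torusSec (measurePreserving_torusSec d)) <| by
    intro g
    refine ⟨Lp.compMeasurePreserving torusMk (measurePreserving_torusMk d) g, ?_⟩
    change Lp.compMeasurePreserving _ _ (Lp.compMeasurePreserving _ _ g) = g
    rw [← Lp.compMeasurePreserving_comp_apply]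
    have : (torusMk ∘ torusSec : (Fin d → UnitAddCircle) → _) = id :=
      funext torusMk_torusSec
    simp [this]

/-- The exponentials `e^{2πi⟨n,x⟩}` as a Hilbert basis of `L_2(Ω)`. -/
noncomputable def cellBasis (d : ℕ) : HilbertBasis (Fin d → ℤ) ℂ (L2Cell d) :=
  HilbertBasis.ofRepr ((toTorusL2 d).trans (torusBasis d).repr)

/-- The Fourier coefficients of a function on the cell, as `fourierCoef` but for functions instead of
classes of functions. -/
noncomputable def fCoef {d : ℕ} (f : E d → ℂ) (n : Fin d → ℤ) : ℂ :=
  ∫ x in cell d, f x * Complex.exp (-(2 * Real.pi * Complex.I *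
    ((inner ℝ (latticePt n) x : ℝ) : ℂ)))

lemma inner_latticePt {d : ℕ} (n : Fin d → ℤ) (x : E d) :
    inner ℝ (latticePt n) x = ∑ i, (n i : ℝ) * x i := by
  simp [latticePt, PiLp.inner_apply, mul_comm]

lemma mFourier_torusMk {d : ℕ} (n : Fin d → ℤ) (x : E d) :
    UnitAddTorus.mFourier (-n) (torusMk x) =
      Complex.exp (-(2 * Real.pi * Complex.I * ((inner ℝ (latticePt n) x : ℝ) : ℂ))) := by
  rw [inner_latticePt]
  simp only [UnitAddTorus.mFourier, ContinuousMap.coe_mk, torusMk, fourier_coe_apply]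
  rw [← Complex.exp_sum]
  congr 1
  push_cast
  rw [Finset.mul_sum, ← Finset.sum_neg_distrib]
  refine Finset.sum_congr rfl fun i _ => ?_
  simp
  ring

lemma torusBasis_repr {d : ℕ} (g : Lp ℂ 2 (torusVol d)) (n : Fin d → ℤ) :
    (torusBasis d).repr g n = ∫ t, UnitAddTorus.mFourier (-n) t • g t ∂(torusVol d) :=
  UnitAddTorus.mFourierBasis_repr g n

lemma cellBasis_repr {d : ℕ} (u : L2Cell d) (n : Fin d → ℤ) :
    (cellBasis d).repr u n = fourierCoef u n := by
  change (torusBasis d).repr (toTorusL2 d u) n = _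
  rw [torusBasis_repr, fourierCoef]
  have h1 : (toTorusL2 d u : (Fin d → UnitAddCircle) → ℂ) =ᵐ[torusVol d] u ∘ torusSec :=
    Lp.coeFn_compMeasurePreserving u (measurePreserving_torusSec d)
  have hm : StronglyMeasurable fun t : Fin d → UnitAddCircle =>
      UnitAddTorus.mFourier (-n) t * u (torusSec t) :=
    (UnitAddTorus.mFourier (-n)).continuous.stronglyMeasurable.mul
      ((Lp.stronglyMeasurable u).comp_measurable measurable_torusSec)
  calc _ = ∫ t, UnitAddTorus.mFourier (-n) t * u (torusSec t) ∂(torusVol d) := by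
        refine integral_congr_ae ?_
        filter_upwards [h1] with t ht
        rw [ht, smul_eq_mul, Function.comp_apply]
    _ = ∫ x in cell d, UnitAddTorus.mFourier (-n) (torusMk x) * u (torusSec (torusMk x)) := by
        rw [← (measurePreserving_torusMk d).map_eq,
          integral_map measurable_torusMk.aemeasurable hm.aestronglyMeasurable]
    _ = _ := by
        refine setIntegral_congr_fun (measurableSet_cell d) fun x hx => ?_
        rw [mFourier_torusMk, torusSec_torusMk, toCell_of_mem hx, mul_comm]

lemma fourierCoef_eq_fCoef {d : ℕ} (u : L2Cell d) (n : Fin d → ℤ) :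
    fourierCoef u n = fCoef u n := rfl

lemma fCoef_congr {d : ℕ} {f g : E d → ℂ} (h : f =ᵐ[volume.restrict (cell d)] g)
    (n : Fin d → ℤ) : fCoef f n = fCoef g n := by
  refine integral_congr_ae ?_
  filter_upwards [h] with x hx
  rw [hx]

lemma fourierCoef_add {d : ℕ} (u v : L2Cell d) (n : Fin d → ℤ) :
    fourierCoef (u + v) n = fourierCoef u n + fourierCoef v n := by
  simp [← cellBasis_repr]

lemma fourierCoef_sub {d : ℕ} (u v : L2Cell d) (n : Fin d → ℤ) :
    fourierCoef (u - v) n = fourierCoef u n - fourierCoef v n := by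
  simp [← cellBasis_repr]

lemma fourierCoef_smul {d : ℕ} (c : ℂ) (u : L2Cell d) (n : Fin d → ℤ) :
    fourierCoef (c • u) n = c * fourierCoef u n := by
  simp [← cellBasis_repr]

lemma ext_fourierCoef {d : ℕ} {u v : L2Cell d} (h : ∀ n, fourierCoef u n = fourierCoef v n) :
    u = v := by
  apply (cellBasis d).repr.injective
  ext n
  rw [cellBasis_repr, cellBasis_repr, h]

lemma hasSum_fourierCoef_sq {d : ℕ} (u : L2Cell d) :
    HasSum (fun n => ‖fourierCoef u n‖ ^ 2) (‖u‖ ^ 2) := by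
  have h := lp.hasSum_norm (p := 2) (by norm_num) ((cellBasis d).repr u)
  simpa [cellBasis_repr] using h

/-- Parseval's identity, with values in `[0,∞]`. -/
lemma lintegral_cell_sq_eq_tsum {d : ℕ} {f : E d → ℂ} (hf : MemLp f 2 (volume.restrict (cell d))) :
    ∫⁻ x in cell d, ENNReal.ofReal (‖f x‖ ^ 2) =
      ∑' n, ENNReal.ofReal (‖fCoef f n‖ ^ 2) := by
  have h := hasSum_fourierCoef_sq (hf.toLp f)
  rw [← ENNReal.ofReal_tsum_of_nonneg (fun n => by positivity)]
  · rw [← ofReal_integral_eq_lintegral_ofReal]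
    · congr 1
      have h2 : ∀ n, fCoef f n = fourierCoef (hf.toLp f) n := fun n =>
        (fCoef_congr hf.coeFn_toLp n).symm
      simp_rw [h2]
      rw [h.tsum_eq, ← real_inner_self_eq_norm_sq]
      have := L2.inner_def (𝕜 := ℂ) (hf.toLp f) (hf.toLp f)
      have h3 : ((‖hf.toLp f‖ ^ 2 : ℝ) : ℂ) = ((∫ x in cell d, ‖f x‖ ^ 2 : ℝ) : ℂ) := by
        rw [← integral_complex_ofReal]
        push_cast
        rw [inner_self_eq_norm_sq_to_K] at this
        refine Eq.trans (by simp) (this.trans ?_)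
        refine integral_congr_ae ?_
        filter_upwards [hf.coeFn_toLp] with x hx
        rw [hx, inner_self_eq_norm_sq_to_K]
        simp
      rw [real_inner_self_eq_norm_sq]
      exact_mod_cast h3.symm
    · exact hf.integrable_norm_pow (by norm_num)
    · exact Filter.Eventually.of_forall fun x => by positivity
  · refine h.summable.congr fun n => ?_
    rw [fourierCoef_eq_fCoef, fCoef_congr hf.coeFn_toLp]

/-- Translation of a periodic function multiplies its Fourier coefficients by characters. -/
lemma fCoef_comp_add {d : ℕ} {f : E d → ℂ} (hp : IsPeriodic f) (hf : StronglyMeasurable f)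
    (z : E d) (n : Fin d → ℤ) :
    fCoef (fun x => f (x + z)) n =
      Complex.exp (2 * Real.pi * Complex.I * ((inner ℝ (latticePt n) z : ℝ) : ℂ)) * fCoef f n := by
  set g : E d → ℂ := fun x => f x * Complex.exp (-(2 * Real.pi * Complex.I *
    ((inner ℝ (latticePt n) x : ℝ) : ℂ))) with hg
  have hgp : IsPeriodic g := by
    refine isPeriodic_of_add_latticePt fun x m => ?_
    simp only [hg]
    rw [hp.add_latticePt, inner_add_right]
    congr 1
    have hint : inner ℝ (latticePt n) (latticePt m) = ((∑ i, n i * m i : ℤ) : ℝ) := by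
      rw [inner_latticePt]; simp [latticePt]
    rw [hint, Complex.exp_eq_exp_iff_exists_int]
    refine ⟨-∑ i, n i * m i, ?_⟩
    push_cast
    ring
  have hgm : StronglyMeasurable g := by
    refine hf.mul (Continuous.stronglyMeasurable ?_)
    fun_prop
  have := hgp.integral_add hgm z
  rw [fCoef, fCoef, ← this, ← integral_const_mul]
  congr 1
  funext x
  simp only [hg]
  rw [inner_add_right, mul_left_comm, ← Complex.exp_add]
  congr 2
  push_cast
  ring

/-- Diagonal operators in a Hilbert basis, with a bounded real symbol. -/
lemma exists_diagonal {ι H : Type*} [NormedAddCommGroup H] [InnerProductSpace ℂ H]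
    (b : HilbertBasis ι ℂ H) (m : ι → ℝ) {C : ℝ} (hC : 0 ≤ C) (hm : ∀ i, |m i| ≤ C) :
    ∃ T : H →L[ℂ] H, (∀ u i, b.repr (T u) i = (m i : ℂ) * b.repr u i) ∧ ‖T‖ ≤ C := by
  have hle : ∀ (f : lp (fun _ : ι => ℂ) 2) i, ‖(m i : ℂ) * f i‖ ≤ C * ‖f i‖ := fun f i => by
    rw [norm_mul, Complex.norm_real, Real.norm_eq_abs]
    exact mul_le_mul_of_nonneg_right (hm i) (norm_nonneg _)
  have hle2 : ∀ (f : lp (fun _ : ι => ℂ) 2) i, ‖(m i : ℂ) * f i‖ ≤ ‖((C : ℂ) • f) i‖ :=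
    fun f i => by
      refine (hle f i).trans_eq ?_
      rw [lp.coeFn_smul, Pi.smul_apply, norm_smul, Complex.norm_real, Real.norm_of_nonneg hC]
  have hmem : ∀ f : lp (fun _ : ι => ℂ) 2, Memℓp (fun i => (m i : ℂ) * f i) 2 := fun f =>
    (lp.memℓp ((C : ℂ) • f)).mono' (hle2 f)
  let M : lp (fun _ : ι => ℂ) 2 →ₗ[ℂ] lp (fun _ : ι => ℂ) 2 :=
    { toFun := fun f => ⟨fun i => (m i : ℂ) * f i, hmem f⟩
      map_add' := fun f g => by ext i; exact mul_add _ _ _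
      map_smul' := fun c f => by ext i; exact mul_left_comm _ _ _ }
  have hM : ∀ f, ‖M f‖ ≤ C * ‖f‖ := fun f => by
    refine (lp.norm_mono (by norm_num) (y := (C : ℂ) • f) (hle2 f)).trans ?_
    rw [norm_smul, Complex.norm_real, Real.norm_of_nonneg hC]
  refine ⟨(b.repr.symm : _ ≃L[ℂ] _).toContinuousLinearMap ∘L (M.mkContinuous C hM) ∘L
    (b.repr : _ ≃L[ℂ] _).toContinuousLinearMap, ?_, ?_⟩
  · intro u i
    simp [M]
  · refine ContinuousLinearMap.opNorm_le_bound _ hC fun u => ?_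
    have := hM (b.repr u)
    simpa using this

/-- The constant function `1` on the cell. -/
noncomputable def constOne (d : ℕ) : L2Cell d :=
  (memLp_const (1 : ℂ)).toLp fun _ : E d => (1 : ℂ)

lemma coeFn_constOne (d : ℕ) : constOne d =ᵐ[volume.restrict (cell d)] fun _ => (1 : ℂ) :=
  MemLp.coeFn_toLp _

lemma cellBasis_zero (d : ℕ) : cellBasis d 0 = constOne d := by
  have h1 : toTorusL2 d (constOne d) = torusBasis d 0 := by
    refine (Lp.toLp_compMeasurePreserving (memLp_const (1 : ℂ))
      (measurePreserving_torusSec d)).trans ?_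
    have h2 : torusBasis d 0 = UnitAddTorus.mFourierLp 2 0 :=
      congrFun UnitAddTorus.coe_mFourierBasis 0
    rw [h2]
    apply Lp.ext
    refine (MemLp.coeFn_toLp _).trans ?_
    refine Filter.EventuallyEq.trans ?_ (UnitAddTorus.coeFn_mFourierLp 2 0).symm
    rw [UnitAddTorus.mFourier_zero]
    exact Filter.EventuallyEq.rfl
  apply (cellBasis d).repr.injective
  rw [HilbertBasis.repr_self]
  change _ = (torusBasis d).repr (toTorusL2 d (constOne d))
  rw [h1, HilbertBasis.repr_self]

lemma fourierCoef_constOne {d : ℕ} (n : Fin d → ℤ) :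
    fourierCoef (constOne d) n = if n = 0 then 1 else 0 := by
  rw [← cellBasis_repr, ← cellBasis_zero, HilbertBasis.repr_self, lp.single_apply,
    Pi.single_apply]

lemma inner_constOne {d : ℕ} (u : L2Cell d) : inner ℂ (constOne d) u = fourierCoef u 0 := by
  rw [← cellBasis_zero, ← HilbertBasis.repr_apply_apply, cellBasis_repr]

lemma norm_constOne (d : ℕ) : ‖constOne d‖ = 1 := by
  rw [← cellBasis_zero]
  exact (cellBasis d).orthonormal.1 0

lemma norm_fourierCoef_le {d : ℕ} (u : L2Cell d) (n : Fin d → ℤ) : ‖fourierCoef u n‖ ≤ ‖u‖ := by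
  have h := hasSum_fourierCoef_sq u
  exact abs_le_of_sq_le_sq' (le_hasSum h n fun _ _ => by positivity) (norm_nonneg _) |>.2

/-! ### Integrals of powers of the norm -/

instance {d : ℕ} [NeZero d] : Nontrivial (E d) := by
  have : Nonempty (Fin d) := ⟨0⟩
  infer_instance

/-- The exterior of the closed unit ball. -/
def farSet (d : ℕ) : Set (E d) := {z | 1 < ‖z‖}

lemma measurableSet_farSet (d : ℕ) : MeasurableSet (farSet d) :=
  measurableSet_lt measurable_const measurable_norm

lemma finrank_E (d : ℕ) : Module.finrank ℝ (E d) = d := by simp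

lemma pow_pred_mul_rpow {d : ℕ} [NeZero d] {y : ℝ} (hy : 0 < y) (q : ℝ) :
    y ^ (d - 1) * y ^ q = y ^ ((d : ℝ) - 1 + q) := by
  rw [Real.rpow_add hy, ← Real.rpow_natCast,
    Nat.cast_sub (Nat.one_le_iff_ne_zero.2 (NeZero.ne d)), Nat.cast_one]

lemma integrableOn_norm_rpow_ball {d : ℕ} [NeZero d] {q : ℝ} (hq : -(d : ℝ) < q) (r : ℝ) :
    IntegrableOn (fun z : E d => ‖z‖ ^ q) (Metric.ball 0 r) := by
  refine (integrableOn_fun_norm_addHaar volume (f := fun y : ℝ => y ^ q)).2 ?_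
  rw [finrank_E]
  rcases le_or_gt r 0 with hr | hr
  · rw [Ioo_eq_empty (not_lt.2 hr)]; exact integrableOn_empty
  · refine ((intervalIntegral.integrableOn_Ioo_rpow_iff hr (s := (d : ℝ) - 1 + q)).2
      (by linarith)).congr_fun (fun y hy => ?_) measurableSet_Ioo
    exact (pow_pred_mul_rpow hy.1 q).symm

lemma indicator_farSet_rpow {d : ℕ} (q : ℝ) (z : E d) :
    (farSet d).indicator (fun z => ‖z‖ ^ q) z = (Ioi (1 : ℝ)).indicator (fun y => y ^ q) ‖z‖ := by
  by_cases h : 1 < ‖z‖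
  · rw [indicator_of_mem (show z ∈ farSet d from h), indicator_of_mem (mem_Ioi.2 h)]
  · rw [indicator_of_notMem (show z ∉ farSet d from h), indicator_of_notMem (by simpa using h)]

lemma indicator_Ioi_rpow {d : ℕ} [NeZero d] (q : ℝ) {y : ℝ} (hy : 0 < y) :
    y ^ (d - 1) • (Ioi (1 : ℝ)).indicator (fun y => y ^ q) y =
      (Ioi (1 : ℝ)).indicator (fun y => y ^ ((d : ℝ) - 1 + q)) y := by
  by_cases h : 1 < y
  · simp [h, pow_pred_mul_rpow hy]
  · simp [h]

lemma integrableOn_norm_rpow_farSet {d : ℕ} [NeZero d] {q : ℝ} (hq : q < -(d : ℝ)) :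
    IntegrableOn (fun z : E d => ‖z‖ ^ q) (farSet d) := by
  rw [← integrable_indicator_iff (measurableSet_farSet d)]
  rw [funext (indicator_farSet_rpow (d := d) q)]
  rw [integrable_fun_norm_addHaar volume, finrank_E]
  refine IntegrableOn.congr_fun ?_ (fun y hy => (indicator_Ioi_rpow q hy).symm) measurableSet_Ioi
  exact ((integrable_indicator_iff measurableSet_Ioi).2
    (integrableOn_Ioi_rpow_of_lt (by linarith) one_pos)).integrableOn

/-- The measure of the unit sphere of `ℝ^d`. -/
noncomputable def sphereArea (d : ℕ) : ℝ := d * (volume : Measure (E d)).real (Metric.ball 0 1)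

lemma sphereArea_nonneg (d : ℕ) : 0 ≤ sphereArea d := by unfold sphereArea; positivity

lemma integral_norm_rpow_farSet {d : ℕ} [NeZero d] {q : ℝ} (hq : q < -(d : ℝ)) :
    ∫ z in farSet d, ‖z‖ ^ q = sphereArea d / (-q - d) := by
  rw [← integral_indicator (measurableSet_farSet d)]
  simp_rw [indicator_farSet_rpow]
  rw [integral_fun_norm_addHaar volume, finrank_E,
    setIntegral_congr_fun measurableSet_Ioi (fun y hy => indicator_Ioi_rpow q hy),
    setIntegral_indicator measurableSet_Ioi,
    show Ioi (0 : ℝ) ∩ Ioi 1 = Ioi 1 from inter_eq_right.2 (Ioi_subset_Ioi zero_le_one),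
    integral_Ioi_rpow_of_lt (by linarith) one_pos, sphereArea]
  simp only [Real.one_rpow, nsmul_eq_mul, smul_eq_mul]
  rw [show -q - (d : ℝ) = -((d : ℝ) - 1 + q + 1) by ring, div_neg, neg_div]
  ring

/-! ### The cosine kernel -/

/-- The function `z ↦ (1 - cos⟨k,z⟩) / |z|^{d+α}`. -/
noncomputable def cosKernel {d : ℕ} (α : ℝ) (k z : E d) : ℝ :=
  (1 - Real.cos (inner ℝ k z)) / ‖z‖ ^ ((d : ℝ) + α)

lemma cosKernel_nonneg {d : ℕ} (α : ℝ) (k z : E d) : 0 ≤ cosKernel α k z :=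
  div_nonneg (sub_nonneg.2 (Real.cos_le_one _)) (by positivity)

lemma measurable_cosKernel {d : ℕ} (α : ℝ) (k : E d) : Measurable (cosKernel α k) := by
  unfold cosKernel
  fun_prop

lemma div_norm_rpow_eq {d : ℕ} {α : ℝ} (a q : ℝ) {z : E d} (hz : z ≠ 0) :
    a * ‖z‖ ^ q / ‖z‖ ^ ((d : ℝ) + α) = a * ‖z‖ ^ (q - (d + α)) := by
  rw [Real.rpow_sub (norm_pos_iff.2 hz), mul_div_assoc]

lemma one_sub_cos_le_sq (x : ℝ) : 1 - Real.cos x ≤ x ^ 2 / 2 := by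
  linarith [Real.one_sub_sq_div_two_le_cos (x := x)]

lemma cosKernel_le_near {d : ℕ} (α : ℝ) (k z : E d) :
    cosKernel α k z ≤ ‖k‖ ^ 2 * ‖z‖ ^ (2 - ((d : ℝ) + α)) := by
  rcases eq_or_ne z 0 with rfl | hz
  · simp only [cosKernel, inner_zero_right, Real.cos_zero, sub_self, zero_div]
    positivity
  · rw [← div_norm_rpow_eq _ _ hz, cosKernel]
    gcongr
    rw [Real.rpow_two]
    calc _ ≤ (inner ℝ k z) ^ 2 / 2 := one_sub_cos_le_sq _
      _ ≤ (inner ℝ k z) ^ 2 := by linarith [sq_nonneg (inner ℝ k z : ℝ)]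
      _ = |inner ℝ k z| ^ 2 := (sq_abs _).symm
      _ ≤ (‖k‖ * ‖z‖) ^ 2 := by gcongr; exact abs_real_inner_le_norm k z
      _ = _ := by ring

lemma cosKernel_le_far {d : ℕ} (α : ℝ) (k z : E d) :
    cosKernel α k z ≤ 2 * ‖z‖ ^ (-((d : ℝ) + α)) := by
  rw [cosKernel, Real.rpow_neg (norm_nonneg _), ← div_eq_mul_inv]
  gcongr
  linarith [Real.neg_one_le_cos (inner ℝ k z)]

lemma compl_farSet_subset (d : ℕ) : (farSet d)ᶜ ⊆ Metric.ball 0 2 := by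
  intro z hz
  simp only [farSet, mem_compl_iff, mem_ofPred_eq, not_lt] at hz
  rw [mem_ball_zero_iff]; linarith

lemma integrable_of_near_of_far {d : ℕ} {f : E d → ℝ} (h1 : IntegrableOn f (Metric.ball 0 2))
    (h2 : IntegrableOn f (farSet d)) : Integrable f := by
  rw [← integrableOn_univ, ← compl_union_self (farSet d)]
  exact (h1.mono_set (compl_farSet_subset d)).union h2

lemma integrable_cosKernel {d : ℕ} [NeZero d] {α : ℝ} (hα : 0 < α) (hα2 : α < 2) (k : E d) :
    Integrable (cosKernel α k) := by
  refine integrable_of_near_of_far ?_ ?_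
  · refine Integrable.mono' ((integrableOn_norm_rpow_ball (q := 2 - ((d : ℝ) + α))
      (by linarith) 2).const_mul (‖k‖ ^ 2))
      (measurable_cosKernel α k).aestronglyMeasurable (Filter.Eventually.of_forall fun z => ?_)
    rw [Real.norm_of_nonneg (cosKernel_nonneg α k z)]
    exact cosKernel_le_near α k z
  · refine Integrable.mono' ((integrableOn_norm_rpow_farSet (q := -((d : ℝ) + α))
      (by linarith)).const_mul 2)
      (measurable_cosKernel α k).aestronglyMeasurable (Filter.Eventually.of_forall fun z => ?_)
    rw [Real.norm_of_nonneg (cosKernel_nonneg α k z)]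
    exact cosKernel_le_far α k z

lemma integral_cosKernel_of_norm_eq {d : ℕ} (α : ℝ) {k l : E d} (h : ‖k‖ = ‖l‖) :
    ∫ z, cosKernel α k z = ∫ z, cosKernel α l z := by
  set ρ := (ℝ ∙ (k - l))ᗮ.reflection
  have hρ : ρ k = l := Submodule.reflection_sub h
  rw [← ρ.measurePreserving.integral_comp ρ.toHomeomorph.measurableEmbedding (cosKernel α l)]
  congr 1
  funext z
  rw [cosKernel, cosKernel, ← hρ, ρ.inner_map_map, ρ.norm_map]

/-- The symbol of the fractional Laplacian: `∫ (1 - cos⟨k,z⟩) / |z|^{d+α} dz = c₀ |k|^α`. -/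
lemma integral_cosKernel {d : ℕ} [NeZero d] {α : ℝ} (hα : 0 < α) (k : E d) :
    ∫ z, cosKernel α k z = c0 d α * ‖k‖ ^ α := by
  rcases eq_or_ne k 0 with rfl | hk
  · simp [cosKernel, Real.zero_rpow hα.ne']
  have hs : 0 < ‖k‖ := norm_pos_iff.2 hk
  set e : E d := EuclideanSpace.single 0 1
  have he : ‖k‖ = ‖‖k‖ • e‖ := by simp [e, norm_smul]
  have hc : ∀ z, cosKernel α (‖k‖ • e) z = ‖k‖ ^ ((d : ℝ) + α) * cosKernel α e (‖k‖ • z) := by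
    intro z
    rw [cosKernel, cosKernel, norm_smul, norm_norm, inner_smul_left, inner_smul_right,
      Real.mul_rpow hs.le (norm_nonneg _)]
    have := Real.rpow_pos_of_pos hs ((d : ℝ) + α)
    simp only [conj_trivial]
    rw [mul_div_assoc', mul_div_mul_left _ _ this.ne']
  have hc0 : ∫ z, cosKernel α e z = c0 d α := by
    simp [c0, cosKernel, e, EuclideanSpace.inner_single_left]
  rw [integral_cosKernel_of_norm_eq α he]
  simp_rw [hc]
  rw [integral_const_mul, Measure.integral_comp_smul, hc0, finrank_E, abs_of_nonneg (by positivity),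
    Real.rpow_add hs, Real.rpow_natCast]
  simp only [smul_eq_mul]
  field_simp

lemma c0_pos {d : ℕ} [NeZero d] {α : ℝ} (hα : 0 < α) (hα2 : α < 2) : 0 < c0 d α := by
  set e : E d := EuclideanSpace.single 0 1
  have hc0 : ∫ z, cosKernel α e z = c0 d α := by
    simp [c0, cosKernel, e, EuclideanSpace.inner_single_left]
  rw [← hc0, integral_pos_iff_support_of_nonneg (cosKernel_nonneg α e)
    (integrable_cosKernel hα hα2 e)]
  have hopen : IsOpen {z : E d | z 0 ∈ Ioo (0 : ℝ) 1} :=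
    isOpen_Ioo.preimage (by fun_prop : Continuous fun z : E d => z 0)
  refine lt_of_lt_of_le (hopen.measure_pos volume ⟨(1 / 2 : ℝ) • e, ?_⟩) (measure_mono ?_)
  · simp [e]; norm_num
  · intro z hz
    simp only [mem_ofPred_eq, mem_Ioo] at hz
    have hz0 : z ≠ 0 := by rintro rfl; simp at hz
    have h1 : Real.cos (z 0) < 1 := by
      rw [← Real.cos_zero]
      exact Real.cos_lt_cos_of_nonneg_of_le_pi le_rfl (by linarith [Real.pi_gt_three]) hz.1
    have h2 : cosKernel α e z = (1 - Real.cos (z 0)) / ‖z‖ ^ ((d : ℝ) + α) := by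
      simp [cosKernel, e, EuclideanSpace.inner_single_left]
    rw [Function.mem_support, h2]
    exact (div_pos (by linarith) (Real.rpow_pos_of_pos (norm_pos_iff.2 hz0) _)).ne'

/-! ### The tail of the truncated linear kernel -/

/-- The function `z ↦ min(s|z|, 1) / |z|^{d+α}`. -/
noncomputable def minKernel {d : ℕ} (α s : ℝ) (z : E d) : ℝ :=
  min (s * ‖z‖) 1 / ‖z‖ ^ ((d : ℝ) + α)

/-- The integral of `min(s|z|, 1) / |z|^{d+α}` over the exterior of the unit ball. -/
noncomputable def tail (d : ℕ) (α s : ℝ) : ℝ := ∫ z in farSet d, minKernel α s z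

lemma minKernel_nonneg {d : ℕ} {α s : ℝ} (hs : 0 ≤ s) (z : E d) : 0 ≤ minKernel α s z := by
  unfold minKernel; positivity

lemma measurable_minKernel {d : ℕ} (α s : ℝ) : Measurable (minKernel (d := d) α s) := by
  unfold minKernel
  fun_prop

lemma min_one_le_rpow {x γ : ℝ} (hx : 0 ≤ x) (h0 : 0 ≤ γ) (h1 : γ ≤ 1) : min x 1 ≤ x ^ γ := by
  rcases le_or_gt x 1 with h | h
  · rw [min_eq_left h]
    exact Real.self_le_rpow_of_le_one hx h h1
  · rw [min_eq_right h.le]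
    exact Real.one_le_rpow h.le h0

lemma minKernel_le {d : ℕ} [NeZero d] {α s γ : ℝ} (hα : 0 < α) (hs : 0 ≤ s) (h0 : 0 ≤ γ)
    (h1 : γ ≤ 1) (z : E d) :
    minKernel α s z ≤ s ^ γ * ‖z‖ ^ (γ - ((d : ℝ) + α)) := by
  rcases eq_or_ne z 0 with rfl | hz
  · have : (0 : ℝ) < d + α := by positivity
    simp only [minKernel, norm_zero, Real.zero_rpow this.ne', div_zero]
    positivity
  · rw [← div_norm_rpow_eq _ _ hz, minKernel, ← Real.mul_rpow hs (norm_nonneg _)]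
    gcongr
    exact min_one_le_rpow (by positivity) h0 h1

lemma integrableOn_minKernel {d : ℕ} [NeZero d] {α s : ℝ} (hα : 0 < α) (hs : 0 ≤ s) :
    IntegrableOn (minKernel α s) (farSet d) := by
  refine Integrable.mono' ((integrableOn_norm_rpow_farSet (q := 0 - ((d : ℝ) + α))
    (by linarith)).const_mul (s ^ (0 : ℝ)))
    (measurable_minKernel α s).aestronglyMeasurable (Filter.Eventually.of_forall fun z => ?_)
  rw [Real.norm_of_nonneg (minKernel_nonneg hs z)]
  exact minKernel_le hα hs le_rfl zero_le_one z

lemma tail_nonneg {d : ℕ} {α s : ℝ} (hs : 0 ≤ s) : 0 ≤ tail d α s :=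
  integral_nonneg fun z => minKernel_nonneg hs z

/-- The power `γ` is free: `γ = 1` serves for `α > 1`, and `γ` close to `1` for `α = 1`. -/
lemma tail_le {d : ℕ} [NeZero d] {α s γ : ℝ} (hα : 0 < α) (hs : 0 ≤ s) (h0 : 0 ≤ γ)
    (h1 : γ ≤ 1) (h2 : γ < α) : tail d α s ≤ sphereArea d / (α - γ) * s ^ γ := by
  have hq : γ - ((d : ℝ) + α) < -d := by linarith
  calc tail d α s ≤ ∫ z in farSet d, s ^ γ * ‖z‖ ^ (γ - ((d : ℝ) + α)) :=
        integral_mono (integrableOn_minKernel hα hs)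
          ((integrableOn_norm_rpow_farSet hq).const_mul _) fun z => minKernel_le hα hs h0 h1 z
    _ = _ := by
        rw [integral_const_mul, integral_norm_rpow_farSet hq]
        rw [show -(γ - ((d : ℝ) + α)) - d = α - γ by ring, mul_comm]

/-- For `α < 1` the truncated kernel is integrable also near the origin, and scaling shows that
its integral is a multiple of `s^α`. -/
lemma exists_tail_le_of_lt_one (d : ℕ) [NeZero d] {α : ℝ} (hα : 0 < α) (hα1 : α < 1) :
    ∃ C, ∀ s, 0 ≤ s → tail d α s ≤ C * s ^ α := by
  have hint : Integrable (minKernel (d := d) α 1) := by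
    refine integrable_of_near_of_far ?_ (integrableOn_minKernel hα zero_le_one)
    refine Integrable.mono' ((integrableOn_norm_rpow_ball (q := 1 - ((d : ℝ) + α))
      (by linarith) 2).const_mul ((1 : ℝ) ^ (1 : ℝ)))
      (measurable_minKernel α 1).aestronglyMeasurable (Filter.Eventually.of_forall fun z => ?_)
    rw [Real.norm_of_nonneg (minKernel_nonneg zero_le_one z)]
    exact minKernel_le hα zero_le_one zero_le_one le_rfl z
  refine ⟨∫ z : E d, minKernel α 1 z, fun s hs => ?_⟩
  rcases hs.eq_or_lt with rfl | hs
  · simp [tail, minKernel, Real.zero_rpow hα.ne']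
  have hc : ∀ z : E d, minKernel α s z = s ^ ((d : ℝ) + α) * minKernel α 1 (s • z) := by
    intro z
    have := Real.rpow_pos_of_pos hs ((d : ℝ) + α)
    rw [minKernel, minKernel, norm_smul, Real.norm_of_nonneg hs.le, one_mul,
      Real.mul_rpow hs.le (norm_nonneg _), mul_div_assoc', mul_div_mul_left _ _ this.ne']
  have hI : Integrable (minKernel (d := d) α s) := by
    simp_rw [funext hc]
    exact ((integrable_comp_smul_iff volume _ hs.ne').2 hint).const_mul _
  calc tail d α s ≤ ∫ z : E d, minKernel α s z :=
        setIntegral_le_integral hI (Filter.Eventually.of_forall fun z => minKernel_nonneg hs.le z)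
    _ = _ := by
        simp_rw [hc]
        rw [integral_const_mul, Measure.integral_comp_smul, finrank_E,
          abs_of_nonneg (by positivity), Real.rpow_add hs, Real.rpow_natCast]
        simp only [smul_eq_mul]
        field_simp

/-! ### The energy of a quasi-periodic function -/

/-- The frequencies `2πn + ξ` of the quasi-periodic functions with quasi-momentum `ξ`. -/
noncomputable def freq {d : ℕ} (ξ : E d) (n : Fin d → ℤ) : E d :=
  (2 * Real.pi) • latticePt n + ξ

/-- The measure `dx dy` on `Ω × ℝ^d`. -/
noncomputable def stripMeasure (d : ℕ) : Measure (E d × E d) :=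
  (volume.restrict (cell d)).prod volume

/-- The quantity `∫_Ω dx ∫_{ℝ^d} dy |e^{i⟨ξ,x⟩}u(x) - e^{i⟨ξ,y⟩}u(y)|² / |x - y|^{d+α}`. -/
noncomputable def energy {d : ℕ} (α : ℝ) (ξ : E d) (u : E d → ℂ) : ℝ≥0∞ :=
  ∫⁻ p, ENNReal.ofReal (‖bloch ξ u p.1 - bloch ξ u p.2‖ ^ 2 / ‖p.1 - p.2‖ ^ ((d : ℝ) + α))
    ∂(stripMeasure d)

/-- Up to a unimodular factor, the increment of `e^{i⟨ξ,x⟩}u(x)` from `x` to `x + z`. -/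
noncomputable def shiftDiff {d : ℕ} (ξ : E d) (u : E d → ℂ) (z x : E d) : ℂ :=
  Complex.exp (Complex.I * ((inner ℝ ξ z : ℝ) : ℂ)) * perExt u (x + z) - perExt u x

lemma bloch_sub_bloch_add {d : ℕ} (ξ : E d) (u : E d → ℂ) (x z : E d) :
    bloch ξ u x - bloch ξ u (x + z) =
      -(Complex.exp (Complex.I * ((inner ℝ ξ x : ℝ) : ℂ)) * shiftDiff ξ u z x) := by
  simp only [bloch, shiftDiff, inner_add_right, Complex.ofReal_add, mul_add, Complex.exp_add]
  ring

lemma norm_exp_I_mul {x : ℝ} : ‖Complex.exp (Complex.I * (x : ℂ))‖ = 1 := by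
  rw [mul_comm, Complex.norm_exp_ofReal_mul_I]

lemma norm_bloch_sub {d : ℕ} (ξ : E d) (u : E d → ℂ) (x z : E d) :
    ‖bloch ξ u x - bloch ξ u (x + z)‖ = ‖shiftDiff ξ u z x‖ := by
  rw [bloch_sub_bloch_add, norm_neg, norm_mul, norm_exp_I_mul, one_mul]

lemma measurable_perExt {d : ℕ} {u : E d → ℂ} (hu : Measurable u) : Measurable (perExt u) :=
  hu.comp measurable_toCell

lemma measurable_bloch {d : ℕ} (ξ : E d) {u : E d → ℂ} (hu : Measurable u) :
    Measurable (bloch ξ u) := by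
  have := measurable_perExt hu
  unfold bloch
  fun_prop

lemma measurable_coe {d : ℕ} (u : L2Cell d) : Measurable (u : E d → ℂ) :=
  (Lp.stronglyMeasurable u).measurable

/-- Integration over `Ω × ℝ^d` in the variables `x` and `z = y - x`. -/
lemma lintegral_strip {d : ℕ} {F : E d × E d → ℝ≥0∞} (hF : Measurable F) :
    ∫⁻ p, F p ∂(stripMeasure d) = ∫⁻ z, ∫⁻ x in cell d, F (x, x + z) := by
  rw [stripMeasure, lintegral_prod _ hF.aemeasurable]
  calc _ = ∫⁻ x in cell d, ∫⁻ z, F (x, x + z) := lintegral_congr fun x =>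
        (lintegral_add_left_eq_self (μ := (volume : Measure (E d))) (fun y => F (x, y)) x).symm
    _ = _ := lintegral_lintegral_swap (by fun_prop)

lemma perExt_ae_eq {d : ℕ} (u : E d → ℂ) : perExt u =ᵐ[volume.restrict (cell d)] u := by
  filter_upwards [ae_restrict_mem (measurableSet_cell d)] with x hx
  rw [perExt, toCell_of_mem hx]

lemma memLp_two_iff_lintegral {X : Type*} [MeasurableSpace X] {ν : Measure X} {f : X → ℂ}
    (hf : AEStronglyMeasurable f ν) :
    MemLp f 2 ν ↔ ∫⁻ x, ENNReal.ofReal (‖f x‖ ^ 2) ∂ν < ∞ := by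
  rw [memLp_two_iff_integrable_sq_norm hf, lt_top_iff_ne_top]
  exact (lintegral_ofReal_ne_top_iff_integrable (f := fun x => ‖f x‖ ^ 2) (hf.norm.pow 2)
      (Filter.Eventually.of_forall fun x => by positivity)).symm

lemma memLp_perExt_add {d : ℕ} (u : L2Cell d) (z : E d) :
    MemLp (fun x => perExt u (x + z)) 2 (volume.restrict (cell d)) := by
  have hm := measurable_perExt (measurable_coe u)
  have h0 : MemLp (perExt u) 2 (volume.restrict (cell d)) :=
    (memLp_congr_ae (perExt_ae_eq u)).2 (Lp.memLp u)
  rw [memLp_two_iff_lintegral hm.aestronglyMeasurable] at h0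
  have hm2 : Measurable fun x => perExt u (x + z) := hm.comp (measurable_add_const z)
  rw [memLp_two_iff_lintegral hm2.aestronglyMeasurable]
  have := ((isPeriodic_perExt (u : E d → ℂ)).comp
    fun c => ENNReal.ofReal (‖c‖ ^ 2)).lintegral_add (by fun_prop) z
  rwa [this]

lemma memLp_shiftDiff {d : ℕ} (ξ : E d) (u : L2Cell d) (z : E d) :
    MemLp (shiftDiff ξ u z) 2 (volume.restrict (cell d)) :=
  ((memLp_perExt_add u z).const_mul _).sub (by simpa using memLp_perExt_add u 0)

lemma fCoef_sub {d : ℕ} {f g : E d → ℂ} (hf : MemLp f 2 (volume.restrict (cell d)))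
    (hg : MemLp g 2 (volume.restrict (cell d))) (n : Fin d → ℤ) :
    fCoef (fun x => f x - g x) n = fCoef f n - fCoef g n := by
  have h1 : fCoef f n = fourierCoef (hf.toLp f) n := (fCoef_congr hf.coeFn_toLp n).symm
  have h2 : fCoef g n = fourierCoef (hg.toLp g) n := (fCoef_congr hg.coeFn_toLp n).symm
  have h3 : fCoef (fun x => f x - g x) n = fourierCoef ((hf.sub hg).toLp (f - g)) n :=
    (fCoef_congr (hf.sub hg).coeFn_toLp n).symm
  rw [h1, h2, h3, ← fourierCoef_sub, MemLp.toLp_sub]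

lemma fCoef_const_mul {d : ℕ} (c : ℂ) (f : E d → ℂ) (n : Fin d → ℤ) :
    fCoef (fun x => c * f x) n = c * fCoef f n := by
  simp only [fCoef, mul_assoc]
  exact integral_const_mul _ _

lemma fCoef_shiftDiff {d : ℕ} (ξ : E d) (u : L2Cell d) (z : E d) (n : Fin d → ℤ) :
    fCoef (shiftDiff ξ u z) n =
      (Complex.exp (Complex.I * ((inner ℝ (freq ξ n) z : ℝ) : ℂ)) - 1) * fourierCoef u n := by
  have h1 := fCoef_sub ((memLp_perExt_add u z).const_mul
    (Complex.exp (Complex.I * ((inner ℝ ξ z : ℝ) : ℂ)))) (by simpa using memLp_perExt_add u 0) n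
  have h2 : fCoef (perExt u) n = fourierCoef u n := fCoef_congr (perExt_ae_eq u) n
  change fCoef (fun x => _ - perExt u x) n = _
  rw [h1, fCoef_const_mul, fCoef_comp_add (isPeriodic_perExt _)
    (measurable_perExt (measurable_coe u)).stronglyMeasurable, h2, ← mul_assoc,
    ← Complex.exp_add, sub_mul, one_mul, freq, inner_add_left, inner_smul_left]
  congr 3
  push_cast
  simp only [conj_trivial]
  push_cast
  ring

lemma norm_exp_sub_one_sq (x : ℝ) :
    ‖Complex.exp (Complex.I * (x : ℂ)) - 1‖ ^ 2 = 2 * (1 - Real.cos x) := by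
  rw [mul_comm, Complex.exp_mul_I, ← Complex.normSq_eq_norm_sq, Complex.normSq_apply]
  have h1 : (Complex.cos x).re = Real.cos x := Complex.cos_ofReal_re x
  have h2 : (Complex.sin x).re = Real.sin x := Complex.sin_ofReal_re x
  simp [h1, h2]
  nlinarith [Real.sin_sq_add_cos_sq x]

/-- The form with `μ = 1` is diagonalised by the Fourier transform. -/
lemma energy_eq_tsum {d : ℕ} [NeZero d] {α : ℝ} (hα : 0 < α) (hα2 : α < 2) (ξ : E d)
    (u : L2Cell d) :
    energy α ξ u = ∑' n, ENNReal.ofReal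
      (2 * c0 d α * (‖freq ξ n‖ ^ α * ‖fourierCoef u n‖ ^ 2)) := by
  have hb := measurable_bloch ξ (measurable_coe u)
  rw [energy, lintegral_strip (by fun_prop)]
  have h1 : ∀ z : E d, ∫⁻ x in cell d, ENNReal.ofReal
      (‖bloch ξ u x - bloch ξ u (x + z)‖ ^ 2 / ‖x - (x + z)‖ ^ ((d : ℝ) + α)) =
      ∑' n, ENNReal.ofReal (2 * ‖fourierCoef u n‖ ^ 2 * cosKernel α (freq ξ n) z) := by
    intro z
    have h2 : ∀ x, ENNReal.ofReal
        (‖bloch ξ u x - bloch ξ u (x + z)‖ ^ 2 / ‖x - (x + z)‖ ^ ((d : ℝ) + α)) =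
        ENNReal.ofReal ((‖z‖ ^ ((d : ℝ) + α))⁻¹) * ENNReal.ofReal (‖shiftDiff ξ u z x‖ ^ 2) := by
      intro x
      rw [norm_bloch_sub, sub_add_cancel_left, norm_neg, div_eq_inv_mul,
        ENNReal.ofReal_mul (by positivity)]
    simp_rw [h2]
    rw [lintegral_const_mul' _ _ ENNReal.ofReal_ne_top,
      lintegral_cell_sq_eq_tsum (memLp_shiftDiff ξ u z), ← ENNReal.tsum_mul_left]
    refine tsum_congr fun n => ?_
    rw [← ENNReal.ofReal_mul (by positivity), fCoef_shiftDiff, norm_mul, mul_pow,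
      norm_exp_sub_one_sq, cosKernel]
    congr 1
    ring
  simp only [h1]
  rw [lintegral_tsum fun n =>
    ((measurable_cosKernel α (freq ξ n)).const_mul _).ennreal_ofReal.aemeasurable]
  refine tsum_congr fun n => ?_
  rw [← ofReal_integral_eq_lintegral_ofReal ((integrable_cosKernel hα hα2 _).const_mul _)
    (Filter.Eventually.of_forall fun z => mul_nonneg (by positivity) (cosKernel_nonneg _ _ _)),
    integral_const_mul, integral_cosKernel hα]
  congr 1
  ring

lemma tsum_ofReal_lt_top_iff {ι : Type*} {f : ι → ℝ} (hf : ∀ i, 0 ≤ f i) :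
    ∑' i, ENNReal.ofReal (f i) < ∞ ↔ Summable f := by
  constructor
  · intro h
    have := ENNReal.summable_toReal h.ne
    exact this.congr fun i => ENNReal.toReal_ofReal (hf i)
  · intro h
    rw [← ENNReal.ofReal_tsum_of_nonneg hf h]
    exact ENNReal.ofReal_lt_top

lemma energy_lt_top_iff {d : ℕ} [NeZero d] {α : ℝ} (hα : 0 < α) (hα2 : α < 2) (ξ : E d)
    (u : L2Cell d) :
    energy α ξ u < ∞ ↔ Summable fun n => ‖freq ξ n‖ ^ α * ‖fourierCoef u n‖ ^ 2 := by
  have hc := c0_pos (d := d) hα hα2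
  rw [energy_eq_tsum hα hα2, tsum_ofReal_lt_top_iff fun n => by positivity]
  exact summable_mul_left_iff (by positivity)

lemma add_rpow_le_two_rpow {a b α : ℝ} (ha : 0 ≤ a) (hb : 0 ≤ b) (hα : 0 < α) :
    (a + b) ^ α ≤ 2 ^ α * (a ^ α + b ^ α) := by
  have h : (a + b) ^ α ≤ (2 * max a b) ^ α := by
    gcongr
    linarith [le_max_left a b, le_max_right a b]
  refine h.trans ?_
  rw [Real.mul_rpow two_pos.le (le_max_of_le_left ha)]
  gcongr
  rcases max_cases a b with ⟨h, _⟩ | ⟨h, _⟩ <;> rw [h]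
  · linarith [Real.rpow_nonneg hb α]
  · linarith [Real.rpow_nonneg ha α]

/-- The energy space does not depend on the quasi-momentum. -/
lemma summable_freq_of_summable {d : ℕ} {α : ℝ} (hα : 0 < α) (ξ η : E d)
    {u : L2Cell d} (h : Summable fun n => ‖freq ξ n‖ ^ α * ‖fourierCoef u n‖ ^ 2) :
    Summable fun n => ‖freq η n‖ ^ α * ‖fourierCoef u n‖ ^ 2 := by
  have h2 := (h.add ((hasSum_fourierCoef_sq u).summable.mul_left (‖η - ξ‖ ^ α))).mul_left (2 ^ α)
  refine h2.of_nonneg_of_le (fun n => by positivity) fun n => ?_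
  have e : freq η n = freq ξ n + (η - ξ) := by simp only [freq]; abel
  have : ‖freq η n‖ ^ α ≤ 2 ^ α * (‖freq ξ n‖ ^ α + ‖η - ξ‖ ^ α) := by
    rw [e]
    refine le_trans ?_ (add_rpow_le_two_rpow (norm_nonneg _) (norm_nonneg _) hα)
    gcongr
    exact norm_add_le _ _
  calc _ ≤ 2 ^ α * (‖freq ξ n‖ ^ α + ‖η - ξ‖ ^ α) * ‖fourierCoef u n‖ ^ 2 := by gcongr
    _ = _ := by ring

/-! ### The periodic Sobolev space as the form domain -/

/-- The integrand of the Gagliardo seminorm of a periodic extension. -/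
noncomputable def gagliardo {d : ℕ} (α : ℝ) (u : E d → ℂ) (x y : E d) : ℝ≥0∞ :=
  ENNReal.ofReal (‖perExt u x - perExt u y‖ ^ 2 / ‖x - y‖ ^ ((d : ℝ) + α))

lemma measurable_gagliardo {d : ℕ} (α : ℝ) {u : E d → ℂ} (hu : Measurable u) :
    Measurable (Function.uncurry (gagliardo α u)) := by
  have := measurable_perExt hu
  unfold gagliardo Function.uncurry
  fun_prop

lemma bloch_zero {d : ℕ} (u : E d → ℂ) : bloch 0 u = perExt u := by
  funext x; simp [bloch]

lemma energy_zero {d : ℕ} (α : ℝ) {u : E d → ℂ} (hu : Measurable u) :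
    energy α 0 u = ∫⁻ x in cell d, ∫⁻ y, gagliardo α u x y := by
  rw [energy, bloch_zero, stripMeasure]
  exact lintegral_prod _ (measurable_gagliardo α hu).aemeasurable

lemma norm_le_sqrt_of_mem_cell {d : ℕ} {x : E d} (hx : x ∈ cell d) : ‖x‖ ≤ √d := by
  rw [EuclideanSpace.norm_eq]
  refine Real.sqrt_le_sqrt ?_
  calc ∑ i, ‖x i‖ ^ 2 ≤ ∑ _i : Fin d, (1 : ℝ) := by
        refine Finset.sum_le_sum fun i _ => ?_
        have := hx i
        rw [Real.norm_of_nonneg this.1]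
        exact pow_le_one₀ this.1 this.2.le
    _ = d := by simp

lemma memSobolevLoc_of_energy {d : ℕ} {α : ℝ} (u : L2Cell d) (h : energy α 0 u < ∞) :
    MemSobolevLoc (α / 2) (perExt u) := by
  have hu := measurable_coe u
  rw [energy_zero α hu] at h
  intro r
  constructor
  · rw [memLp_two_iff_lintegral (measurable_perExt hu).aestronglyMeasurable]
    have h0 := memLp_perExt_add u 0
    simp only [add_zero] at h0
    rw [memLp_two_iff_lintegral (measurable_perExt hu).aestronglyMeasurable] at h0
    exact ((isPeriodic_perExt (u : E d → ℂ)).comp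
      fun c => ENNReal.ofReal (‖c‖ ^ 2)).lintegral_ball_lt_top h0 r
  · have hper : IsPeriodic fun x => ∫⁻ y, gagliardo α u x y := by
      refine isPeriodic_of_add_latticePt fun x n => ?_
      rw [← lintegral_add_right_eq_self (μ := (volume : Measure (E d)))
        (fun y => gagliardo α u (x + latticePt n) y) (latticePt n)]
      refine lintegral_congr fun y => ?_
      simp only [gagliardo, (isPeriodic_perExt _).add_latticePt, add_sub_add_right_eq_sub]
    refine lt_of_le_of_lt ?_ (hper.lintegral_ball_lt_top h r)
    refine lintegral_mono fun x => ?_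
    refine (setLIntegral_le_lintegral _ _).trans_eq (lintegral_congr fun y => ?_)
    rw [gagliardo, mul_div_cancel₀ _ (two_ne_zero' ℝ)]

lemma memSobolev_cell_of_energy {d : ℕ} {α : ℝ} (u : L2Cell d) (h : energy α 0 u < ∞) :
    MemSobolev (α / 2) (cell d) u := by
  have hu := measurable_coe u
  rw [energy_zero α hu] at h
  refine ⟨Lp.memLp u, lt_of_le_of_lt ?_ h⟩
  refine setLIntegral_mono' (measurableSet_cell d) fun x hx => ?_
  refine le_trans (le_of_eq ?_) (setLIntegral_le_lintegral (cell d) _)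
  refine setLIntegral_congr_fun (measurableSet_cell d) fun y hy => ?_
  simp only [gagliardo, perExt, toCell_of_mem hx, toCell_of_mem hy]
  rw [mul_div_cancel₀ _ (two_ne_zero' ℝ)]

lemma gagliardo_add_le {d : ℕ} (α : ℝ) (u : E d → ℂ) (x z : E d) :
    gagliardo α u x (x + z) ≤ ENNReal.ofReal (‖z‖ ^ (-((d : ℝ) + α))) *
      (ENNReal.ofReal 2 *
        (ENNReal.ofReal (‖perExt u x‖ ^ 2) + ENNReal.ofReal (‖perExt u (x + z)‖ ^ 2))) := by
  rw [← ENNReal.ofReal_add (by positivity) (by positivity),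
    ← ENNReal.ofReal_mul (by positivity), ← ENNReal.ofReal_mul (by positivity), gagliardo]
  refine ENNReal.ofReal_le_ofReal ?_
  rw [sub_add_cancel_left, norm_neg, Real.rpow_neg (norm_nonneg _), div_eq_inv_mul]
  gcongr
  have := norm_sub_le (perExt u x) (perExt u (x + z))
  nlinarith [sq_nonneg (‖perExt u x‖ - ‖perExt u (x + z)‖),
    norm_nonneg (perExt u x - perExt u (x + z))]

lemma lintegral_perExt_sq_add {d : ℕ} (u : L2Cell d) (z : E d) :
    ∫⁻ x in cell d, ENNReal.ofReal (‖perExt u (x + z)‖ ^ 2) =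
      ∫⁻ x in cell d, ENNReal.ofReal (‖perExt u x‖ ^ 2) := by
  have hpu := measurable_perExt (measurable_coe u)
  exact ((isPeriodic_perExt (u : E d → ℂ)).comp
    fun c => ENNReal.ofReal (‖c‖ ^ 2)).lintegral_add (by fun_prop) z

lemma lintegral_perExt_sq_lt_top {d : ℕ} (u : L2Cell d) :
    ∫⁻ x in cell d, ENNReal.ofReal (‖perExt u x‖ ^ 2) < ∞ := by
  have h0 := memLp_perExt_add u 0
  simp only [add_zero] at h0
  rwa [memLp_two_iff_lintegral (measurable_perExt (measurable_coe u)).aestronglyMeasurable] at h0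

/-- Large increments are controlled by the `L_2`-norm. -/
lemma lintegral_gagliardo_far_lt_top {d : ℕ} [NeZero d] {α : ℝ} (hα : 0 < α) (u : L2Cell d) :
    ∫⁻ z in farSet d, ∫⁻ x in cell d, gagliardo α u x (x + z) < ∞ := by
  have hpu := measurable_perExt (measurable_coe u)
  have hm := lintegral_perExt_sq_lt_top u
  have hs := lintegral_perExt_sq_add u
  generalize ∫⁻ x in cell d, ENNReal.ofReal (‖perExt u x‖ ^ 2) = m at hm hs
  have hs0 : ∫⁻ x in cell d, ENNReal.ofReal (‖perExt u x‖ ^ 2) = m := by simpa using hs 0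
  calc _ ≤ ∫⁻ z in farSet d, ENNReal.ofReal (‖z‖ ^ (-((d : ℝ) + α))) * (ENNReal.ofReal 2 * (m + m)) := by
        refine lintegral_mono fun z => ?_
        refine (lintegral_mono (gagliardo_add_le α u · z)).trans ?_
        rw [lintegral_const_mul' _ _ ENNReal.ofReal_ne_top,
          lintegral_const_mul' _ _ ENNReal.ofReal_ne_top, lintegral_add_left (by fun_prop), hs, hs0]
    _ = (∫⁻ z in farSet d, ENNReal.ofReal (‖z‖ ^ (-((d : ℝ) + α)))) * (ENNReal.ofReal 2 * (m + m)) :=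
        lintegral_mul_const _ (by fun_prop)
    _ < ∞ := ENNReal.mul_lt_top
          (integrableOn_norm_rpow_farSet (q := -((d : ℝ) + α)) (by linarith)).lintegral_lt_top
          (ENNReal.mul_lt_top ENNReal.ofReal_lt_top (ENNReal.add_lt_top.2 ⟨hm, hm⟩))

/-- Small increments take place inside a fixed ball. -/
lemma lintegral_gagliardo_near_lt_top {d : ℕ} {α : ℝ} (u : L2Cell d)
    (h : MemSobolevLoc (α / 2) (perExt u)) :
    ∫⁻ z in (farSet d)ᶜ, ∫⁻ x in cell d, gagliardo α u x (x + z) < ∞ := by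
  have hg' : Measurable fun p : E d × E d => gagliardo α u p.2 (p.2 + p.1) := by
    have := measurable_perExt (measurable_coe u)
    unfold gagliardo
    fun_prop
  rw [lintegral_lintegral_swap hg'.aemeasurable]
  refine lt_of_le_of_lt ?_ (h (√d + 2)).2
  have hcell : cell d ⊆ Metric.ball 0 (√d + 2) := fun x hx => by
    have := norm_le_sqrt_of_mem_cell hx
    rw [mem_ball_zero_iff]; linarith
  refine (setLIntegral_mono' (measurableSet_cell d) fun x hx => ?_).trans
    (lintegral_mono_set hcell)
  have hsub : (farSet d)ᶜ ⊆ (fun z => x + z) ⁻¹' Metric.ball 0 (√d + 2) := by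
    intro z hz
    have h1 := norm_le_sqrt_of_mem_cell hx
    have h2 : ‖z‖ ≤ 1 := by simpa [farSet] using hz
    rw [mem_preimage, mem_ball_zero_iff]
    linarith [norm_add_le x z]
  refine (lintegral_mono_set hsub).trans_eq ?_
  rw [(measurePreserving_add_left volume x).setLIntegral_comp_preimage_emb
    (measurableEmbedding_addLeft x) (fun y => gagliardo α u x y)]
  refine lintegral_congr fun y => ?_
  rw [gagliardo, mul_div_cancel₀ _ (two_ne_zero' ℝ)]

lemma energy_lt_top_of_memSobolevLoc {d : ℕ} [NeZero d] {α : ℝ} (hα : 0 < α) (u : L2Cell d)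
    (h : MemSobolevLoc (α / 2) (perExt u)) : energy α 0 u < ∞ := by
  have e : energy α 0 u = ∫⁻ z, ∫⁻ x in cell d, gagliardo α u x (x + z) := by
    rw [energy, bloch_zero]
    have h := lintegral_strip (F := fun p => gagliardo α u p.1 p.2)
      (measurable_gagliardo α (measurable_coe u))
    exact h
  rw [e, ← lintegral_add_compl (fun z => ∫⁻ x in cell d, gagliardo α u x (x + z)) (measurableSet_farSet d)]
  exact ENNReal.add_lt_top.2 ⟨lintegral_gagliardo_far_lt_top hα u,
    lintegral_gagliardo_near_lt_top u h⟩

/-- The form domain in terms of Fourier coefficients. Any `ξ` may be used, by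
`summable_freq_of_summable`. -/
lemma mem_perSobolev_iff {d : ℕ} [NeZero d] {α : ℝ} (hα : 0 < α) (hα2 : α < 2) (ξ : E d)
    (u : L2Cell d) :
    u ∈ perSobolev d (α / 2) ↔ Summable fun n => ‖freq ξ n‖ ^ α * ‖fourierCoef u n‖ ^ 2 := by
  trans energy α 0 u < ∞
  · exact ⟨fun h => energy_lt_top_of_memSobolevLoc hα u h.2, fun h =>
      ⟨memSobolev_cell_of_energy u h, memSobolevLoc_of_energy u h⟩⟩
  · rw [energy_lt_top_iff hα hα2]
    exact ⟨summable_freq_of_summable hα 0 ξ, summable_freq_of_summable hα ξ 0⟩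

/-! ### The form as an inner product of increments -/

/-- A coefficient which satisfies the bounds and the periodicity condition everywhere. -/
structure IsPeriodicCoefficient {d : ℕ} (μm μp : ℝ) (μ : E d → E d → ℝ) : Prop where
  measurable : Measurable fun p : E d × E d => μ p.1 p.2
  le : ∀ x y, μm ≤ μ x y
  ge : ∀ x y, μ x y ≤ μp
  periodic : ∀ x y (m n : Fin d → ℤ), μ (x + latticePt m) (y + latticePt n) = μ x y

/-- The measure `μ(x,y) |x - y|^{-d-α} dx dy` on `Ω × ℝ^d`. -/
noncomputable def formMeasure {d : ℕ} (α : ℝ) (μ : E d → E d → ℝ) : Measure (E d × E d) :=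
  (stripMeasure d).withDensity fun p =>
    ENNReal.ofReal (μ p.1 p.2 / ‖p.1 - p.2‖ ^ ((d : ℝ) + α))

/-- The increments `e^{i⟨ξ,x⟩}u(x) - e^{i⟨ξ,y⟩}u(y)`. -/
noncomputable def incr {d : ℕ} (ξ : E d) (u : E d → ℂ) (p : E d × E d) : ℂ :=
  bloch ξ u p.1 - bloch ξ u p.2

/-- The sum `∑ |2πn + ξ|^α |û_n|²`. -/
noncomputable def freqEnergy {d : ℕ} (α : ℝ) (ξ : E d) (u : L2Cell d) : ℝ :=
  ∑' n, ‖freq ξ n‖ ^ α * ‖fourierCoef u n‖ ^ 2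

lemma freqEnergy_nonneg {d : ℕ} (α : ℝ) (ξ : E d) (u : L2Cell d) : 0 ≤ freqEnergy α ξ u :=
  tsum_nonneg fun n => by positivity

lemma measurable_incr {d : ℕ} (ξ : E d) {u : E d → ℂ} (hu : Measurable u) :
    Measurable (incr ξ u) := by
  have := measurable_bloch ξ hu
  unfold incr
  fun_prop

lemma energy_eq_ofReal {d : ℕ} [NeZero d] {α : ℝ} (hα : 0 < α) (hα2 : α < 2) (ξ : E d)
    {u : L2Cell d} (hu : u ∈ perSobolev d (α / 2)) :
    energy α ξ u = ENNReal.ofReal (2 * c0 d α * freqEnergy α ξ u) := by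
  have hs := (mem_perSobolev_iff hα hα2 ξ u).1 hu
  have hc := c0_pos (d := d) hα hα2
  rw [energy_eq_tsum hα hα2, ← ENNReal.ofReal_tsum_of_nonneg (fun n => by positivity)
    (hs.mul_left _), tsum_mul_left, freqEnergy]

namespace IsPeriodicCoefficient

variable {d : ℕ} {μm μp : ℝ} {μ : E d → E d → ℝ}

lemma measurable_weight (h : IsPeriodicCoefficient μm μp μ) (α : ℝ) :
    Measurable fun p : E d × E d => μ p.1 p.2 / ‖p.1 - p.2‖ ^ ((d : ℝ) + α) := by
  have := h.measurable
  fun_prop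

lemma lintegral_formMeasure (h : IsPeriodicCoefficient μm μp μ) (h0 : 0 < μm) (α : ℝ)
    {f : E d × E d → ℝ} (hf : Measurable f) :
    ∫⁻ p, ENNReal.ofReal (f p) ∂(formMeasure α μ) =
      ∫⁻ p, ENNReal.ofReal (μ p.1 p.2 / ‖p.1 - p.2‖ ^ ((d : ℝ) + α) * f p) ∂(stripMeasure d) := by
  rw [formMeasure, lintegral_withDensity_eq_lintegral_mul _ (h.measurable_weight α).ennreal_ofReal
    hf.ennreal_ofReal]
  refine lintegral_congr fun p => ?_
  have : 0 < μ p.1 p.2 := h0.trans_le (h.le _ _)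
  rw [Pi.mul_apply, ← ENNReal.ofReal_mul (by positivity)]

lemma lintegral_incr_le (h : IsPeriodicCoefficient μm μp μ) (h0 : 0 < μm) (α : ℝ) (ξ : E d)
    (u : L2Cell d) :
    ∫⁻ p, ENNReal.ofReal (‖incr ξ u p‖ ^ 2) ∂(formMeasure α μ) ≤
      ENNReal.ofReal μp * energy α ξ u := by
  have hm := measurable_incr ξ (measurable_coe u)
  rw [h.lintegral_formMeasure h0 α (hm.norm.pow_const 2), energy,
    ← lintegral_const_mul' _ _ ENNReal.ofReal_ne_top]
  refine lintegral_mono fun p => ?_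
  have h1 := h.le p.1 p.2
  rw [← ENNReal.ofReal_mul (h0.le.trans (h1.trans (h.ge p.1 p.2)))]
  refine ENNReal.ofReal_le_ofReal ?_
  rw [div_mul_eq_mul_div, ← mul_div_assoc]
  exact div_le_div_of_nonneg_right
    (mul_le_mul_of_nonneg_right (h.ge _ _) (by positivity)) (by positivity)

lemma le_lintegral_incr (h : IsPeriodicCoefficient μm μp μ) (h0 : 0 < μm) (α : ℝ) (ξ : E d)
    (u : L2Cell d) :
    ENNReal.ofReal μm * energy α ξ u ≤
      ∫⁻ p, ENNReal.ofReal (‖incr ξ u p‖ ^ 2) ∂(formMeasure α μ) := by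
  have hm := measurable_incr ξ (measurable_coe u)
  rw [h.lintegral_formMeasure h0 α (hm.norm.pow_const 2), energy,
    ← lintegral_const_mul' _ _ ENNReal.ofReal_ne_top]
  refine lintegral_mono fun p => ?_
  rw [← ENNReal.ofReal_mul h0.le]
  refine ENNReal.ofReal_le_ofReal ?_
  rw [div_mul_eq_mul_div, ← mul_div_assoc]
  exact div_le_div_of_nonneg_right
    (mul_le_mul_of_nonneg_right (h.le _ _) (by positivity)) (by positivity)

lemma memLp_incr [NeZero d] (h : IsPeriodicCoefficient μm μp μ) (h0 : 0 < μm) {α : ℝ}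
    (hα : 0 < α) (hα2 : α < 2) (ξ : E d) {u : L2Cell d} (hu : u ∈ perSobolev d (α / 2)) :
    MemLp (incr ξ u) 2 (formMeasure α μ) := by
  rw [memLp_two_iff_lintegral (measurable_incr ξ (measurable_coe u)).aestronglyMeasurable]
  refine (h.lintegral_incr_le h0 α ξ u).trans_lt ?_
  rw [energy_eq_ofReal hα hα2 ξ hu, ← ENNReal.ofReal_mul' (by
    have := c0_pos (d := d) hα hα2
    have := freqEnergy_nonneg α ξ u
    positivity)]
  exact ENNReal.ofReal_lt_top

lemma blochForm_eq_integral (h : IsPeriodicCoefficient μm μp μ) (h0 : 0 < μm) (α : ℝ)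
    (ξ : E d) (u v : L2Cell d) :
    blochForm α μ ξ u v =
      (1 / 2 : ℂ) * ∫ p, incr ξ u p * (starRingEnd ℂ) (incr ξ v p) ∂(formMeasure α μ) := by
  rw [formMeasure, integral_withDensity_eq_integral_toReal_smul
    (h.measurable_weight α).ennreal_ofReal
    (Filter.Eventually.of_forall fun _ => ENNReal.ofReal_lt_top), blochForm, stripMeasure]
  congr 2
  funext p
  have : 0 < μ p.1 p.2 := h0.trans_le (h.le _ _)
  rw [ENNReal.toReal_ofReal (by positivity), Complex.real_smul]
  rfl

lemma blochForm_eq_inner (h : IsPeriodicCoefficient μm μp μ) (h0 : 0 < μm) (α : ℝ)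
    (ξ : E d) {u v : L2Cell d} {U V : Lp ℂ 2 (formMeasure α μ)}
    (hU : U =ᵐ[formMeasure α μ] incr ξ u) (hV : V =ᵐ[formMeasure α μ] incr ξ v) :
    blochForm α μ ξ u v = (1 / 2 : ℂ) * inner ℂ V U := by
  rw [h.blochForm_eq_integral h0, L2.inner_def]
  congr 1
  refine integral_congr_ae ?_
  filter_upwards [hU, hV] with p h1 h2
  rw [h1, h2, RCLike.inner_apply]

end IsPeriodicCoefficient

lemma norm_sq_eq_lintegral {X : Type*} [MeasurableSpace X] {ν : Measure X} (f : Lp ℂ 2 ν) :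
    ENNReal.ofReal (‖f‖ ^ 2) = ∫⁻ x, ENNReal.ofReal (‖f x‖ ^ 2) ∂ν := by
  have h1 : ((‖f‖ ^ 2 : ℝ) : ℂ) = ((∫ x, ‖f x‖ ^ 2 ∂ν : ℝ) : ℂ) := by
    have := L2.inner_def (𝕜 := ℂ) f f
    rw [inner_self_eq_norm_sq_to_K] at this
    rw [← integral_complex_ofReal]
    refine Eq.trans (by simp) (this.trans ?_)
    refine integral_congr_ae (Filter.Eventually.of_forall fun x => ?_)
    simp only
    rw [inner_self_eq_norm_sq_to_K]
    simp
  rw [Complex.ofReal_inj.1 h1, ofReal_integral_eq_lintegral_ofReal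
    ((Lp.memLp f).integrable_norm_pow (by norm_num))
    (Filter.Eventually.of_forall fun x => by positivity)]

lemma ae_strip {d : ℕ} {p : E d → Prop} (h : ∀ᵐ x : E d, p x) :
    ∀ᵐ q ∂(stripMeasure d), p q.1 ∧ p q.2 := by
  have h1 : ∀ᵐ x ∂(volume.restrict (cell d)), p x := ae_restrict_of_ae h
  filter_upwards [Measure.quasiMeasurePreserving_fst.ae h1,
    Measure.quasiMeasurePreserving_snd.ae h] with q h2 h3 using ⟨h2, h3⟩

lemma incr_congr {d : ℕ} {α : ℝ} {μ : E d → E d → ℝ} (ξ : E d) {u v : E d → ℂ}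
    (h : u =ᵐ[volume.restrict (cell d)] v) : incr ξ u =ᵐ[formMeasure α μ] incr ξ v := by
  have h1 := ae_strip (ae_toCell h)
  refine (withDensity_absolutelyContinuous _ _).ae_le ?_
  filter_upwards [h1] with p hp
  simp only [incr, bloch, perExt, hp.1, hp.2]

lemma incr_add_ae {d : ℕ} {α : ℝ} {μ : E d → E d → ℝ} (ξ : E d) (u v : L2Cell d) :
    incr ξ (u + v : L2Cell d) =ᵐ[formMeasure α μ] incr ξ u + incr ξ v := by
  refine (incr_congr ξ (Lp.coeFn_add u v)).trans (Filter.EventuallyEq.of_eq ?_)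
  funext p
  simp only [incr, bloch, perExt, Pi.add_apply]
  ring

lemma incr_smul_ae {d : ℕ} {α : ℝ} {μ : E d → E d → ℝ} (ξ : E d) (c : ℂ) (u : L2Cell d) :
    incr ξ (c • u : L2Cell d) =ᵐ[formMeasure α μ] c • incr ξ u := by
  refine (incr_congr ξ (Lp.coeFn_smul c u)).trans (Filter.EventuallyEq.of_eq ?_)
  funext p
  simp only [incr, bloch, perExt, Pi.smul_apply, smul_eq_mul]
  ring

namespace IsPeriodicCoefficient

variable {d : ℕ} [NeZero d] {μm μp : ℝ} {μ : E d → E d → ℝ} {α : ℝ}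

lemma norm_sq_le (h : IsPeriodicCoefficient μm μp μ) (h0 : 0 < μm) (hα : 0 < α) (hα2 : α < 2)
    (ξ : E d) {u : L2Cell d} (hu : u ∈ perSobolev d (α / 2)) {U : Lp ℂ 2 (formMeasure α μ)}
    (hU : U =ᵐ[formMeasure α μ] incr ξ u) :
    ‖U‖ ^ 2 ≤ 2 * c0 d α * μp * freqEnergy α ξ u := by
  have hc := c0_pos (d := d) hα hα2
  have hq := freqEnergy_nonneg α ξ u
  have hp : 0 ≤ μp := h0.le.trans ((h.le 0 0).trans (h.ge 0 0))
  have h1 := h.lintegral_incr_le h0 α ξ u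
  have h2 := norm_sq_eq_lintegral U
  rw [lintegral_congr_ae (hU.mono fun p hp => by simp only [hp] : (fun p => ENNReal.ofReal
    (‖U p‖ ^ 2)) =ᵐ[formMeasure α μ] fun p => ENNReal.ofReal (‖incr ξ u p‖ ^ 2))] at h2
  rw [← h2, energy_eq_ofReal hα hα2 ξ hu, ← ENNReal.ofReal_mul hp] at h1
  have h3 := (ENNReal.ofReal_le_ofReal_iff (by positivity)).1 h1
  linarith

lemma le_norm_sq (h : IsPeriodicCoefficient μm μp μ) (h0 : 0 < μm) (hα : 0 < α) (hα2 : α < 2)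
    (ξ : E d) {u : L2Cell d} (hu : u ∈ perSobolev d (α / 2)) {U : Lp ℂ 2 (formMeasure α μ)}
    (hU : U =ᵐ[formMeasure α μ] incr ξ u) :
    2 * c0 d α * μm * freqEnergy α ξ u ≤ ‖U‖ ^ 2 := by
  have h1 := h.le_lintegral_incr h0 α ξ u
  have h2 := norm_sq_eq_lintegral U
  rw [lintegral_congr_ae (hU.mono fun p hp => by simp only [hp] : (fun p => ENNReal.ofReal
    (‖U p‖ ^ 2)) =ᵐ[formMeasure α μ] fun p => ENNReal.ofReal (‖incr ξ u p‖ ^ 2))] at h2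
  rw [← h2, energy_eq_ofReal hα hα2 ξ hu, ← ENNReal.ofReal_mul h0.le] at h1
  have h3 := (ENNReal.ofReal_le_ofReal_iff (by positivity)).1 h1
  linarith

/-- The increments as an element of `L_2`. -/
noncomputable def incrLp (h : IsPeriodicCoefficient μm μp μ) (h0 : 0 < μm) (hα : 0 < α)
    (hα2 : α < 2) (ξ : E d) {u : L2Cell d} (hu : u ∈ perSobolev d (α / 2)) :
    Lp ℂ 2 (formMeasure α μ) := (h.memLp_incr h0 hα hα2 ξ hu).toLp _

lemma incrLp_ae (h : IsPeriodicCoefficient μm μp μ) (h0 : 0 < μm) (hα : 0 < α)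
    (hα2 : α < 2) (ξ : E d) {u : L2Cell d} (hu : u ∈ perSobolev d (α / 2)) :
    h.incrLp h0 hα hα2 ξ hu =ᵐ[formMeasure α μ] incr ξ u := MemLp.coeFn_toLp _

/-- If `S` maps `L_2(Ω)` boundedly to the form domain, then `w ↦ incr ξ (S w)` is a bounded
operator. -/
lemma exists_incr_clm (h : IsPeriodicCoefficient μm μp μ) (h0 : 0 < μm) (hα : 0 < α)
    (hα2 : α < 2) (ξ : E d) (S : L2Cell d →L[ℂ] L2Cell d)
    (hS : ∀ w, S w ∈ perSobolev d (α / 2)) (hS2 : ∀ w, freqEnergy α ξ (S w) ≤ ‖w‖ ^ 2) :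
    ∃ J : L2Cell d →L[ℂ] Lp ℂ 2 (formMeasure α μ),
      ∀ w, J w =ᵐ[formMeasure α μ] incr ξ (S w) := by
  have hp : 0 ≤ μp := h0.le.trans ((h.le 0 0).trans (h.ge 0 0))
  have hc := c0_pos (d := d) hα hα2
  have key := fun w => h.incrLp_ae h0 hα hα2 ξ (hS w)
  let J : L2Cell d →ₗ[ℂ] Lp ℂ 2 (formMeasure α μ) :=
    { toFun := fun w => h.incrLp h0 hα hα2 ξ (hS w)
      map_add' := fun w w' => by
        apply Lp.ext
        refine (key _).trans ?_
        rw [map_add]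
        refine (incr_add_ae ξ _ _).trans ?_
        exact ((key w).symm.add (key w').symm).trans (Lp.coeFn_add _ _).symm
      map_smul' := fun c w => by
        apply Lp.ext
        refine (key _).trans ?_
        rw [map_smul]
        refine (incr_smul_ae ξ _ _).trans ?_
        exact ((key w).symm.const_smul c).trans (Lp.coeFn_smul c _).symm }
  refine ⟨J.mkContinuous (√(2 * c0 d α * μp)) fun w => ?_, key⟩
  have h1 := h.norm_sq_le h0 hα hα2 ξ (hS w) (key w)
  refine abs_le_of_sq_le_sq' ?_ (by positivity) |>.2
  rw [mul_pow, Real.sq_sqrt (by positivity)]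
  refine h1.trans ?_
  have := hS2 w
  gcongr

end IsPeriodicCoefficient

/-! ### Existence of the resolvent -/

/-- The Lax–Milgram construction for a form `½⟨J w', J w⟩` given on the range of `S`. -/
lemma exists_resolvent_of_factor {H K : Type*} [NormedAddCommGroup H] [InnerProductSpace ℂ H]
    [CompleteSpace H] [NormedAddCommGroup K] [InnerProductSpace ℂ K] [CompleteSpace K]
    (S : H →L[ℂ] H) (J : H →L[ℂ] K) {t c : ℝ} (hc : 0 < c)
    (hcoer : ∀ w, c * ‖w‖ ^ 2 ≤ 1 / 2 * ‖J w‖ ^ 2 + t * ‖S w‖ ^ 2) :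
    ∃ R : H →L[ℂ] H, ∀ f u, R f = u ↔
      ∃ w, S w = u ∧ ∀ w', (1 / 2 : ℂ) * inner ℂ (J w') (J w) + t * inner ℂ (S w') (S w) =
        inner ℂ (S w') f := by
  set L : H →L[ℂ] H := (1 / 2 : ℂ) • (J.adjoint ∘L J) + (t : ℂ) • (S.adjoint ∘L S)
  have hL : ∀ w w', inner ℂ w' (L w) =
      (1 / 2 : ℂ) * inner ℂ (J w') (J w) + t * inner ℂ (S w') (S w) := by
    intro w w'
    simp [L, ContinuousLinearMap.adjoint_inner_right]
  have hunit : IsUnit L := by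
    refine L.isUnit_of_forall_le_norm_inner_map (c := ⟨c, hc.le⟩) hc fun w => ?_
    rw [norm_inner_symm, hL w w, inner_self_eq_norm_sq_to_K, inner_self_eq_norm_sq_to_K]
    have e : (1 / 2 : ℂ) * ((‖J w‖ : ℝ) : ℂ) ^ 2 + t * ((‖S w‖ : ℝ) : ℂ) ^ 2 =
        ((1 / 2 * ‖J w‖ ^ 2 + t * ‖S w‖ ^ 2 : ℝ) : ℂ) := by push_cast; ring
    refine le_trans ?_ (le_abs_self _ |>.trans_eq
      ((Complex.norm_real _).symm.trans (congrArg norm e.symm)))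
    rw [mul_comm]
    exact hcoer w
  obtain ⟨V, hV1, hV2⟩ : ∃ V : H →L[ℂ] H, L * V = 1 ∧ V * L = 1 := by
    obtain ⟨U, hU⟩ := hunit
    exact ⟨(U⁻¹ : (H →L[ℂ] H)ˣ), hU ▸ U.mul_inv, hU ▸ U.inv_mul⟩
  have h1 : ∀ x, L (V x) = x := fun x => congrArg (fun T : H →L[ℂ] H => T x) hV1
  have h2 : ∀ x, V (L x) = x := fun x => congrArg (fun T : H →L[ℂ] H => T x) hV2
  refine ⟨S ∘L V ∘L S.adjoint, fun f u => ⟨fun h => ?_, ?_⟩⟩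
  · refine ⟨V (S.adjoint f), h, fun w' => ?_⟩
    rw [← hL, h1, ContinuousLinearMap.adjoint_inner_right]
  · rintro ⟨w, rfl, hw⟩
    have h3 : L w = S.adjoint f := by
      refine ext_inner_left ℂ fun w' => ?_
      rw [hL, hw, ContinuousLinearMap.adjoint_inner_right]
    simp only [ContinuousLinearMap.comp_apply]
    rw [← h3, h2]

/-- The multiplier `(1 + |2πn + ξ|^α)^{-1/2}` maps `L_2(Ω)` onto the form domain. -/
lemma exists_smoothing {d : ℕ} [NeZero d] {α : ℝ} (hα : 0 < α) (hα2 : α < 2) (ξ : E d) :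
    ∃ S : L2Cell d →L[ℂ] L2Cell d, (∀ w, S w ∈ perSobolev d (α / 2)) ∧
      (∀ w, freqEnergy α ξ (S w) + ‖S w‖ ^ 2 = ‖w‖ ^ 2) ∧
      ∀ u ∈ perSobolev d (α / 2), ∃ w, S w = u := by
  set m : (Fin d → ℤ) → ℝ := fun n => (√(1 + ‖freq ξ n‖ ^ α))⁻¹
  have hpos : ∀ n, 0 < 1 + ‖freq ξ n‖ ^ α := fun n => by positivity
  have hm1 : ∀ n, |m n| ≤ 1 := fun n => by
    rw [abs_of_nonneg (by positivity)]
    refine inv_le_one_of_one_le₀ (Real.one_le_sqrt.2 ?_)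
    linarith [Real.rpow_nonneg (norm_nonneg (freq ξ n)) α]
  have hm2 : ∀ n, m n ^ 2 = (1 + ‖freq ξ n‖ ^ α)⁻¹ := fun n => by
    rw [inv_pow, Real.sq_sqrt (hpos n).le]
  obtain ⟨S, hS, -⟩ := exists_diagonal (cellBasis d) m zero_le_one hm1
  simp only [cellBasis_repr] at hS
  have hsq : ∀ w n, ‖fourierCoef (S w) n‖ ^ 2 =
      (1 + ‖freq ξ n‖ ^ α)⁻¹ * ‖fourierCoef w n‖ ^ 2 := fun w n => by
    rw [hS, norm_mul, mul_pow, Complex.norm_real, Real.norm_eq_abs, sq_abs, hm2]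
  have hsum : ∀ w, Summable fun n => ‖freq ξ n‖ ^ α * ‖fourierCoef (S w) n‖ ^ 2 := fun w => by
    refine (hasSum_fourierCoef_sq w).summable.of_nonneg_of_le (fun n => by positivity) fun n => ?_
    rw [hsq, ← mul_assoc]
    refine mul_le_of_le_one_left (by positivity) ?_
    rw [← div_eq_mul_inv, div_le_one (hpos n)]
    linarith
  refine ⟨S, fun w => (mem_perSobolev_iff hα hα2 ξ _).2 (hsum w), fun w => ?_, fun u hu => ?_⟩
  · have h1 := (hsum w).hasSum.add (hasSum_fourierCoef_sq (S w))
    refine h1.unique ?_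
    convert hasSum_fourierCoef_sq w using 2 with n
    rw [hsq]
    have := hpos n
    field_simp
    ring
  · have hu' := ((mem_perSobolev_iff hα hα2 ξ u).1 hu).add (hasSum_fourierCoef_sq u).summable
    have hmem : Memℓp (fun n => ((√(1 + ‖freq ξ n‖ ^ α) : ℝ) : ℂ) * fourierCoef u n) 2 := by
      refine memℓp_gen (hu'.congr fun n => ?_)
      simp only [ENNReal.toReal_ofNat, Real.rpow_two]
      rw [norm_mul, mul_pow, Complex.norm_real, Real.norm_eq_abs, sq_abs, Real.sq_sqrt (hpos n).le]
      ring
    refine ⟨(cellBasis d).repr.symm ⟨_, hmem⟩, ext_fourierCoef fun n => ?_⟩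
    rw [hS, ← cellBasis_repr, LinearIsometryEquiv.apply_symm_apply]
    simp only [m]
    rw [← mul_assoc, ← Complex.ofReal_mul, inv_mul_cancel₀ (Real.sqrt_pos.2 (hpos n)).ne']
    simp

lemma IsPeriodicCoefficient.exists_resolvent {d : ℕ} [NeZero d] {μm μp : ℝ} {μ : E d → E d → ℝ}
    {α : ℝ} (h : IsPeriodicCoefficient μm μp μ) (h0 : 0 < μm) (hα : 0 < α) (hα2 : α < 2)
    (ξ : E d) {t : ℝ} (ht : 0 < t) :
    ∃ R : L2Cell d →L[ℂ] L2Cell d, IsShiftedInverse (opGraph α μ ξ) t R := by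
  obtain ⟨S, hS1, hS2, hS3⟩ := exists_smoothing hα hα2 ξ
  obtain ⟨J, hJ⟩ := h.exists_incr_clm h0 hα hα2 ξ S hS1 fun w => by
    have := hS2 w
    nlinarith [sq_nonneg ‖S w‖]
  have hc := c0_pos (d := d) hα hα2
  have hcoer : ∀ w, min (c0 d α * μm) t * ‖w‖ ^ 2 ≤ 1 / 2 * ‖J w‖ ^ 2 + t * ‖S w‖ ^ 2 := by
    intro w
    have h1 := h.le_norm_sq h0 hα hα2 ξ (hS1 w) (hJ w)
    have h2 := freqEnergy_nonneg α ξ (S w)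
    have h3 : min (c0 d α * μm) t * freqEnergy α ξ (S w) ≤ c0 d α * μm * freqEnergy α ξ (S w) := by
      gcongr; exact min_le_left _ _
    have h4 : min (c0 d α * μm) t * ‖S w‖ ^ 2 ≤ t * ‖S w‖ ^ 2 := by
      gcongr; exact min_le_right _ _
    rw [← hS2 w]
    nlinarith
  obtain ⟨R, hR⟩ := exists_resolvent_of_factor S J (lt_min (by positivity) ht) hcoer
  refine ⟨R, fun f u => (hR f u).trans ⟨?_, ?_⟩⟩
  · rintro ⟨w, rfl, hw⟩
    refine ⟨f - (t : ℂ) • S w, ⟨hS1 w, fun v hv => ?_⟩, sub_add_cancel _ _⟩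
    obtain ⟨w', rfl⟩ := hS3 v hv
    simp only
    rw [h.blochForm_eq_inner h0 α ξ (hJ w) (hJ w'), inner_sub_right, inner_smul_right, ← hw]
    ring
  · rintro ⟨g, ⟨hu, hg⟩, rfl⟩
    obtain ⟨w, rfl⟩ := hS3 u hu
    refine ⟨w, rfl, fun w' => ?_⟩
    have := hg _ (hS1 w')
    simp only at this
    rw [inner_add_right, inner_smul_right, ← this, h.blochForm_eq_inner h0 α ξ (hJ w) (hJ w')]

/-! ### The coupling of constants with functions of mean value zero -/

/-- The Cauchy–Schwarz inequality for integrals with values in `[0,∞]`. -/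
lemma lintegral_mul_le_sqrt {X : Type*} [MeasurableSpace X] {ν : Measure X} {f g : X → ℝ≥0∞}
    (hf : AEMeasurable f ν) (hg : AEMeasurable g ν) :
    ∫⁻ x, f x * g x ∂ν ≤ (∫⁻ x, f x ^ 2 ∂ν) ^ (1 / 2 : ℝ) * (∫⁻ x, g x ^ 2 ∂ν) ^ (1 / 2 : ℝ) := by
  have h := ENNReal.lintegral_mul_le_Lp_mul_Lq ν Real.HolderConjugate.two_two hf hg
  simpa using h

lemma lintegral_norm_le_sqrt {X : Type*} [MeasurableSpace X] {ν : Measure X}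
    [IsProbabilityMeasure ν] {f : X → ℂ} (hf : AEStronglyMeasurable f ν) :
    ∫⁻ x, ENNReal.ofReal ‖f x‖ ∂ν ≤ (∫⁻ x, ENNReal.ofReal (‖f x‖ ^ 2) ∂ν) ^ (1 / 2 : ℝ) := by
  have h := lintegral_mul_le_sqrt (ν := ν) (f := fun x => ENNReal.ofReal ‖f x‖) (g := fun _ => 1)
    hf.norm.aemeasurable.ennreal_ofReal aemeasurable_const
  simpa [ENNReal.ofReal_pow] using h

lemma ofReal_rpow_half {a : ℝ} (ha : 0 ≤ a) :
    ENNReal.ofReal a ^ (1 / 2 : ℝ) = ENNReal.ofReal √a := by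
  rw [ENNReal.ofReal_rpow_of_nonneg ha (by norm_num), Real.sqrt_eq_rpow]

lemma lintegral_perExt_sq {d : ℕ} (v : L2Cell d) :
    ∫⁻ x in cell d, ENNReal.ofReal (‖perExt v x‖ ^ 2) = ENNReal.ofReal (‖v‖ ^ 2) := by
  rw [norm_sq_eq_lintegral]
  refine lintegral_congr_ae ?_
  filter_upwards [perExt_ae_eq v] with x hx
  rw [hx]

lemma measurable_shiftDiff {d : ℕ} (ξ : E d) {u : E d → ℂ} (hu : Measurable u) (z : E d) :
    Measurable (shiftDiff ξ u z) := by
  have := measurable_perExt hu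
  unfold shiftDiff
  fun_prop

lemma lintegral_shiftDiff_le {d : ℕ} (ξ : E d) (v : L2Cell d) (z : E d) :
    ∫⁻ x in cell d, ENNReal.ofReal ‖shiftDiff ξ v z x‖ ≤ ENNReal.ofReal (2 * ‖v‖) := by
  have hpv := measurable_perExt (measurable_coe v)
  have h1 : ∀ z, ∫⁻ x in cell d, ENNReal.ofReal ‖perExt v (x + z)‖ ≤ ENNReal.ofReal ‖v‖ := by
    intro z
    rw [((isPeriodic_perExt (v : E d → ℂ)).comp fun c => ENNReal.ofReal ‖c‖).lintegral_add
      (by fun_prop) z]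
    refine (lintegral_norm_le_sqrt hpv.aestronglyMeasurable).trans_eq ?_
    rw [lintegral_perExt_sq, ofReal_rpow_half (by positivity), Real.sqrt_sq (norm_nonneg _)]
  have h2 := h1 0
  simp only [add_zero] at h2
  calc _ ≤ ∫⁻ x in cell d, (ENNReal.ofReal ‖perExt v (x + z)‖ + ENNReal.ofReal ‖perExt v x‖) := by
        refine lintegral_mono fun x => ?_
        rw [← ENNReal.ofReal_add (norm_nonneg _) (norm_nonneg _)]
        refine ENNReal.ofReal_le_ofReal ((norm_sub_le _ _).trans_eq ?_)
        rw [norm_mul, norm_exp_I_mul, one_mul]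
    _ ≤ ENNReal.ofReal ‖v‖ + ENNReal.ofReal ‖v‖ := by
        rw [lintegral_add_left (by fun_prop)]
        exact add_le_add (h1 z) h2
    _ = _ := by rw [← ENNReal.ofReal_add (norm_nonneg _) (norm_nonneg _), two_mul]

/-- The absolute increments `|e^{i⟨ξ,z⟩} - 1|` of the plane wave. -/
noncomputable def waveIncr {d : ℕ} (ξ z : E d) : ℝ :=
  ‖Complex.exp (Complex.I * ((inner ℝ ξ z : ℝ) : ℂ)) - 1‖

lemma waveIncr_nonneg {d : ℕ} (ξ z : E d) : 0 ≤ waveIncr ξ z := norm_nonneg _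

lemma measurable_waveIncr {d : ℕ} (ξ : E d) : Measurable (waveIncr ξ) := by
  unfold waveIncr
  fun_prop

lemma waveIncr_sq {d : ℕ} (ξ z : E d) :
    waveIncr ξ z ^ 2 = 2 * (1 - Real.cos (inner ℝ ξ z)) := norm_exp_sub_one_sq _

lemma waveIncr_le {d : ℕ} (ξ z : E d) : waveIncr ξ z ≤ 2 * min (‖ξ‖ * ‖z‖) 1 := by
  have h0 : (0 : ℝ) ≤ 2 * min (‖ξ‖ * ‖z‖) 1 := by positivity
  refine abs_le_of_sq_le_sq' ?_ h0 |>.2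
  rw [waveIncr_sq]
  rcases le_total (‖ξ‖ * ‖z‖) 1 with h | h
  · rw [min_eq_left h]
    have h1 := one_sub_cos_le_sq (inner ℝ ξ z)
    have h2 : (inner ℝ ξ z : ℝ) ^ 2 ≤ (‖ξ‖ * ‖z‖) ^ 2 :=
      sq_le_sq' (neg_le_of_abs_le (abs_real_inner_le_norm ξ z))
        (le_of_abs_le (abs_real_inner_le_norm ξ z))
    nlinarith
  · rw [min_eq_right h]
    linarith [Real.neg_one_le_cos (inner ℝ ξ z)]

lemma norm_incr_one {d : ℕ} (ξ x z : E d) :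
    ‖incr ξ (fun _ => 1) (x, x + z)‖ = waveIncr ξ z := by
  rw [incr, norm_bloch_sub, shiftDiff, waveIncr]
  simp [perExt]

/-- The energy, written in terms of the increments `z = y - x`. -/
lemma energy_eq_lintegral_shiftDiff {d : ℕ} (α : ℝ) (ξ : E d) (v : L2Cell d) :
    energy α ξ v = ∫⁻ z : E d, ENNReal.ofReal ((‖z‖ ^ ((d : ℝ) + α))⁻¹) *
      ∫⁻ x in cell d, ENNReal.ofReal (‖shiftDiff ξ v z x‖ ^ 2) := by
  have hb := measurable_bloch ξ (measurable_coe v)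
  rw [energy, lintegral_strip (by fun_prop)]
  refine lintegral_congr fun z => ?_
  rw [← lintegral_const_mul' _ _ ENNReal.ofReal_ne_top]
  refine lintegral_congr fun x => ?_
  rw [norm_bloch_sub, sub_add_cancel_left, norm_neg, div_eq_inv_mul,
    ENNReal.ofReal_mul (by positivity)]

lemma measurable_lintegral_shiftDiff {d : ℕ} (ξ : E d) (v : L2Cell d) {φ : ℂ → ℝ≥0∞}
    (hφ : Measurable φ) : Measurable fun z => ∫⁻ x in cell d, φ (shiftDiff ξ v z x) := by
  have hpv := measurable_perExt (measurable_coe v)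
  refine Measurable.lintegral_prod_right' (f := fun q : E d × E d => φ (shiftDiff ξ v q.1 q.2)) ?_
  unfold shiftDiff
  fun_prop

/-- Short increments: the Cauchy–Schwarz inequality for the measure `|z|^{-d-α} dz`. -/
lemma lintegral_wave_near {d : ℕ} [NeZero d] {α : ℝ} (hα : 0 < α) (hα2 : α < 2) :
    ∃ K, 0 ≤ K ∧ ∀ (ξ : E d) (v : L2Cell d), v ∈ perSobolev d (α / 2) →
      ∫⁻ z in (farSet d)ᶜ, ENNReal.ofReal (waveIncr ξ z * (‖z‖ ^ ((d : ℝ) + α))⁻¹) *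
        ∫⁻ x in cell d, ENNReal.ofReal ‖shiftDiff ξ v z x‖ ≤
      ENNReal.ofReal (K * ‖ξ‖ * √(freqEnergy α ξ v)) := by
  have hint := integrableOn_norm_rpow_ball (d := d) (q := 2 - ((d : ℝ) + α)) (by linarith) 2
  set K₁ : ℝ := ∫ z in Metric.ball (0 : E d) 2, ‖z‖ ^ (2 - ((d : ℝ) + α))
  have hK₁ : 0 ≤ K₁ := integral_nonneg fun z => by positivity
  have hc := c0_pos (d := d) hα hα2
  refine ⟨√(4 * K₁) * √(2 * c0 d α), by positivity, fun ξ v hv => ?_⟩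
  have hq := freqEnergy_nonneg α ξ v
  have hw := measurable_waveIncr ξ
  -- the weight is divided evenly between the two factors
  set ρ : E d → ℝ := fun z => √((‖z‖ ^ ((d : ℝ) + α))⁻¹)
  have hρm : Measurable ρ := by simp only [ρ]; fun_prop
  have hρ0 : ∀ z, 0 ≤ ρ z := fun z => Real.sqrt_nonneg _
  have hρ : ∀ z, ρ z ^ 2 = (‖z‖ ^ ((d : ℝ) + α))⁻¹ := fun z => Real.sq_sqrt (by positivity)
  set N : E d → ℝ≥0∞ := fun z => ∫⁻ x in cell d, ENNReal.ofReal ‖shiftDiff ξ v z x‖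
  have hNm : Measurable N := measurable_lintegral_shiftDiff ξ v
    (φ := fun c => ENNReal.ofReal ‖c‖) (by fun_prop)
  have hN : ∀ z, N z ^ 2 ≤ ∫⁻ x in cell d, ENNReal.ofReal (‖shiftDiff ξ v z x‖ ^ 2) := by
    intro z
    have := lintegral_norm_le_sqrt (ν := volume.restrict (cell d))
      (measurable_shiftDiff ξ (measurable_coe v) z).aestronglyMeasurable
    calc N z ^ 2 ≤ (_ ^ (1 / 2 : ℝ)) ^ 2 := pow_le_pow_left₀ zero_le this 2
      _ = _ := by rw [← ENNReal.rpow_mul_natCast]; norm_num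
  have hfirst : ∫⁻ z in (farSet d)ᶜ, ENNReal.ofReal (waveIncr ξ z * ρ z) ^ 2 ≤
      ENNReal.ofReal (‖ξ‖ ^ 2 * (4 * K₁)) := by
    calc _ ≤ ∫⁻ z in Metric.ball (0 : E d) 2,
          ENNReal.ofReal (4 * ‖ξ‖ ^ 2 * ‖z‖ ^ (2 - ((d : ℝ) + α))) := by
          refine (lintegral_mono_set (compl_farSet_subset d)).trans (lintegral_mono fun z => ?_)
          have h2 := cosKernel_le_near α ξ z
          rw [← ENNReal.ofReal_pow (mul_nonneg (waveIncr_nonneg ξ z) (hρ0 z)), mul_pow, hρ,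
            waveIncr_sq]
          refine ENNReal.ofReal_le_ofReal ?_
          rw [cosKernel, div_eq_mul_inv] at h2
          have : (0 : ℝ) ≤ ‖ξ‖ ^ 2 * ‖z‖ ^ (2 - ((d : ℝ) + α)) := by positivity
          linarith
      _ = _ := by
          rw [← ofReal_integral_eq_lintegral_ofReal (hint.const_mul _)
            (Filter.Eventually.of_forall fun z => by positivity), integral_const_mul]
          congr 1
          simp only [K₁]
          ring
  have hsecond : ∫⁻ z in (farSet d)ᶜ, (ENNReal.ofReal (ρ z) * N z) ^ 2 ≤
      ENNReal.ofReal (2 * c0 d α * freqEnergy α ξ v) := by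
    rw [← energy_eq_ofReal hα hα2 ξ hv, energy_eq_lintegral_shiftDiff]
    refine (setLIntegral_le_lintegral _ _).trans (lintegral_mono fun z => ?_)
    rw [mul_pow, ← ENNReal.ofReal_pow (hρ0 z), hρ]
    gcongr
    exact hN z
  calc _ = ∫⁻ z in (farSet d)ᶜ, ENNReal.ofReal (waveIncr ξ z * ρ z) *
        (ENNReal.ofReal (ρ z) * N z) := by
        refine lintegral_congr fun z => ?_
        rw [← mul_assoc, ← ENNReal.ofReal_mul (mul_nonneg (waveIncr_nonneg ξ z) (hρ0 z)),
          mul_assoc (waveIncr ξ z), ← sq, hρ]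
    _ ≤ _ := lintegral_mul_le_sqrt (by fun_prop) (by fun_prop)
    _ ≤ ENNReal.ofReal (‖ξ‖ ^ 2 * (4 * K₁)) ^ (1 / 2 : ℝ) *
        ENNReal.ofReal (2 * c0 d α * freqEnergy α ξ v) ^ (1 / 2 : ℝ) := by gcongr
    _ = _ := by
        rw [ofReal_rpow_half (by positivity), ofReal_rpow_half (by positivity),
          ← ENNReal.ofReal_mul (by positivity), Real.sqrt_mul (by positivity),
          Real.sqrt_sq (norm_nonneg _),
          Real.sqrt_mul (by positivity : 0 ≤ 2 * c0 d α) (freqEnergy α ξ v)]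
        congr 1
        ring

/-- Long increments, where only `|e^{i⟨ξ,z⟩} - 1| ≤ 2 min(|ξ||z|, 1)` is used. -/
lemma lintegral_wave_far {d : ℕ} [NeZero d] {α : ℝ} (hα : 0 < α) (ξ : E d) (v : L2Cell d) :
    ∫⁻ z in farSet d, ENNReal.ofReal (waveIncr ξ z * (‖z‖ ^ ((d : ℝ) + α))⁻¹) *
        ∫⁻ x in cell d, ENNReal.ofReal ‖shiftDiff ξ v z x‖ ≤
      ENNReal.ofReal (4 * tail d α ‖ξ‖ * ‖v‖) := by
  calc _ ≤ ∫⁻ z in farSet d, ENNReal.ofReal (4 * ‖v‖ * minKernel α ‖ξ‖ z) := by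
        refine lintegral_mono fun z => ?_
        refine (mul_le_mul_right (lintegral_shiftDiff_le ξ v z) _).trans ?_
        rw [← ENNReal.ofReal_mul (mul_nonneg (waveIncr_nonneg ξ z) (by positivity))]
        refine ENNReal.ofReal_le_ofReal ?_
        have h := waveIncr_le ξ z
        calc _ ≤ 2 * min (‖ξ‖ * ‖z‖) 1 * (‖z‖ ^ ((d : ℝ) + α))⁻¹ * (2 * ‖v‖) := by gcongr
          _ = _ := by rw [minKernel]; ring
    _ = _ := by
        rw [← ofReal_integral_eq_lintegral_ofReal
          ((integrableOn_minKernel hα (norm_nonneg ξ)).const_mul _)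
          (Filter.Eventually.of_forall fun z =>
            mul_nonneg (by positivity) (minKernel_nonneg (norm_nonneg ξ) z)), integral_const_mul]
        congr 1
        rw [tail]
        ring

/-- The coupling in the form between the constant function and a function `v`. -/
lemma exists_norm_blochForm_constOne_le {d : ℕ} [NeZero d] {α : ℝ} (hα : 0 < α) (hα2 : α < 2) :
    ∃ K, 0 ≤ K ∧ ∀ (μm μp : ℝ) (μ : E d → E d → ℝ), 0 < μm → IsPeriodicCoefficient μm μp μ →
      ∀ (ξ : E d), ∀ v ∈ perSobolev d (α / 2),
        ‖blochForm α μ ξ (constOne d) v‖ ≤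
          μp * (K * ‖ξ‖ * √(freqEnergy α ξ v) + 2 * tail d α ‖ξ‖ * ‖v‖) := by
  obtain ⟨K, hK, hnear⟩ := lintegral_wave_near (d := d) hα hα2
  refine ⟨K / 2, by positivity, fun μm μp μ h0 h ξ v hv => ?_⟩
  have hp : 0 ≤ μp := h0.le.trans ((h.le 0 0).trans (h.ge 0 0))
  have hm1 : Measurable (incr ξ fun _ : E d => (1 : ℂ)) := measurable_incr ξ measurable_const
  have hmv := measurable_incr ξ (measurable_coe v)
  have ht := tail_nonneg (d := d) (α := α) (norm_nonneg ξ)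
  have e1 : ∫ p, incr ξ (constOne d) p * (starRingEnd ℂ) (incr ξ v p) ∂(formMeasure α μ) =
      ∫ p, incr ξ (fun _ => 1) p * (starRingEnd ℂ) (incr ξ v p) ∂(formMeasure α μ) := by
    refine integral_congr_ae ?_
    filter_upwards [incr_congr (α := α) (μ := μ) ξ (coeFn_constOne d)] with p hp
    rw [hp]
  have e2 : ∫⁻ p, ENNReal.ofReal ‖incr ξ (fun _ => 1) p * (starRingEnd ℂ) (incr ξ v p)‖
      ∂(formMeasure α μ) ≤ ENNReal.ofReal μp *
        ENNReal.ofReal (K * ‖ξ‖ * √(freqEnergy α ξ v) + 4 * tail d α ‖ξ‖ * ‖v‖) := by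
    simp only [norm_mul, RCLike.norm_conj]
    rw [h.lintegral_formMeasure h0 α
      (f := fun p => ‖incr ξ (fun _ => 1) p‖ * ‖incr ξ v p‖) (hm1.norm.mul hmv.norm)]
    calc _ ≤ ∫⁻ p, ENNReal.ofReal μp * ENNReal.ofReal ((‖p.1 - p.2‖ ^ ((d : ℝ) + α))⁻¹ *
          (‖incr ξ (fun _ => 1) p‖ * ‖incr ξ v p‖)) ∂(stripMeasure d) := by
          refine lintegral_mono fun p => ?_
          rw [← ENNReal.ofReal_mul hp]
          refine ENNReal.ofReal_le_ofReal ?_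
          rw [div_eq_mul_inv, mul_assoc]
          exact mul_le_mul_of_nonneg_right (h.ge _ _) (by positivity)
      _ = ENNReal.ofReal μp * ∫⁻ z : E d, ENNReal.ofReal
          (waveIncr ξ z * (‖z‖ ^ ((d : ℝ) + α))⁻¹) *
            ∫⁻ x in cell d, ENNReal.ofReal ‖shiftDiff ξ v z x‖ := by
          rw [lintegral_const_mul' _ _ ENNReal.ofReal_ne_top, lintegral_strip (by fun_prop)]
          congr 1
          refine lintegral_congr fun z => ?_
          rw [← lintegral_const_mul' _ _ ENNReal.ofReal_ne_top]
          refine lintegral_congr fun x => ?_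
          rw [norm_incr_one, sub_add_cancel_left, norm_neg, incr, norm_bloch_sub,
            ← ENNReal.ofReal_mul (mul_nonneg (waveIncr_nonneg ξ z) (by positivity))]
          congr 1
          ring
      _ ≤ _ := by
          gcongr
          rw [← lintegral_add_compl _ (measurableSet_farSet d), add_comm,
            ENNReal.ofReal_add (by positivity) (by positivity)]
          exact add_le_add (hnear ξ v hv) (lintegral_wave_far hα ξ v)
  rw [← ENNReal.ofReal_mul hp] at e2
  rw [h.blochForm_eq_integral h0, e1, norm_mul]
  have e3 := (norm_integral_le_lintegral_norm (μ := formMeasure α μ) (fun p =>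
    incr ξ (fun _ => 1) p * (starRingEnd ℂ) (incr ξ v p))).trans
    (ENNReal.toReal_le_of_le_ofReal (by positivity) e2)
  have e4 : ‖(1 / 2 : ℂ)‖ = 1 / 2 := by simp
  rw [e4]
  linarith

/-! ### Averaging of the coefficient against the cosine kernel -/

lemma abs_rpow_neg_sub_rpow_neg_le {a x y p : ℝ} (ha : 0 < a) (hp : 0 ≤ p) (hx : a ≤ x)
    (hy : a ≤ y) : |x ^ (-p) - y ^ (-p)| ≤ p * a ^ (-p - 1) * |x - y| := by
  have hd : ∀ u ∈ Ici a, HasDerivWithinAt (fun v : ℝ => v ^ (-p)) (-p * u ^ (-p - 1)) (Ici a) u :=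
    fun u hu => (Real.hasDerivAt_rpow_const (Or.inl (ha.trans_le hu).ne')).hasDerivWithinAt
  refine (convex_Ici a).norm_image_sub_le_of_norm_hasDerivWithin_le hd (fun u hu => ?_) hy hx
  rw [norm_mul, norm_neg, Real.norm_of_nonneg hp,
    Real.norm_of_nonneg (Real.rpow_nonneg (ha.le.trans hu) _)]
  gcongr ?_ * ?_
  exact Real.rpow_le_rpow_of_nonpos ha hu (by linarith)

lemma min_mul_one_le {x y c : ℝ} (hc : 1 ≤ c) (h : x ≤ c * y) : min x 1 ≤ c * min y 1 := by
  rcases le_total y 1 with h1 | h1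
  · rw [min_eq_left h1]; exact (min_le_left _ _).trans h
  · rw [min_eq_right h1]; exact (min_le_right _ _).trans (by linarith)

lemma abs_cos_sub_cos_le (a b : ℝ) :
    |Real.cos b - Real.cos a| ≤ |b - a| * min (|b + a| / 2) 1 := by
  rw [Real.cos_sub_cos, abs_mul, abs_mul]
  have h1 : |Real.sin ((b + a) / 2)| ≤ min (|b + a| / 2) 1 := by
    refine le_min ?_ (Real.abs_sin_le_one _)
    have := Real.abs_sin_le_abs (x := (b + a) / 2)
    rwa [abs_div, abs_two] at this
  have h2 : |Real.sin ((b - a) / 2)| ≤ |b - a| / 2 := by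
    have := Real.abs_sin_le_abs (x := (b - a) / 2)
    rwa [abs_div, abs_two] at this
  have h3 : |(-2 : ℝ)| = 2 := by norm_num
  rw [h3]
  calc 2 * |Real.sin ((b + a) / 2)| * |Real.sin ((b - a) / 2)| ≤
      2 * min (|b + a| / 2) 1 * (|b - a| / 2) := by gcongr
    _ = _ := by ring

lemma one_sub_cos_le_mul_min (b : ℝ) : 1 - Real.cos b ≤ 2 * |b| * min |b| 1 := by
  rcases le_total |b| 1 with h | h
  · rw [min_eq_left h]
    have := one_sub_cos_le_sq b
    rw [← sq_abs b] at this
    nlinarith [sq_nonneg |b|]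
  · rw [min_eq_right h]
    linarith [Real.neg_one_le_cos b]

/-- The cosine kernel varies slowly at infinity. -/
lemma abs_cosKernel_sub_le {d : ℕ} {α D : ℝ} (hα : 0 < α) (ξ : E d) {z w : E d}
    (hw : ‖w‖ ≤ D) (hz : 2 * D ≤ ‖z‖) (hz0 : 0 < ‖z‖) :
    |cosKernel α ξ z - cosKernel α ξ (z - w)| ≤
      (2 * D + 8 * ((d + α) * D * 2 ^ ((d : ℝ) + α + 1))) * ‖ξ‖ * minKernel α ‖ξ‖ z := by
  set p : ℝ := d + α with hpdef
  have hp : 0 < p := by positivity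
  have hD : 0 ≤ D := (norm_nonneg w).trans hw
  set r := ‖z‖
  set s := ‖ξ‖
  have hs : 0 ≤ s := norm_nonneg ξ
  set m := min (s * r) 1 with hm
  have hm0 : 0 ≤ m := by positivity
  have hr1 : r / 2 ≤ ‖z - w‖ := by linarith [norm_sub_norm_le z w]
  have hr2 : ‖z - w‖ ≤ 2 * r := by linarith [norm_sub_le z w]
  have hr' : |r - ‖z - w‖| ≤ D := by
    have := abs_norm_sub_norm_le z (z - w)
    rw [sub_sub_cancel] at this
    exact this.trans hw
  set a : ℝ := inner ℝ ξ z
  set b : ℝ := inner ℝ ξ (z - w)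
  have ha : |a| ≤ s * r := abs_real_inner_le_norm _ _
  have hb : |b| ≤ 2 * (s * r) := by
    refine (abs_real_inner_le_norm _ _).trans ?_
    calc s * ‖z - w‖ ≤ s * (2 * r) := by gcongr
      _ = _ := by ring
  have hab : |b - a| ≤ s * D := by
    have : b - a = -inner ℝ ξ w := by simp only [a, b, inner_sub_right]; ring
    rw [this, abs_neg]
    exact (abs_real_inner_le_norm _ _).trans (by gcongr)
  have h1 : |Real.cos b - Real.cos a| ≤ s * D * (2 * m) := by
    refine (abs_cos_sub_cos_le a b).trans ?_
    gcongr
    exact min_mul_one_le one_le_two (by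
      have : 0 ≤ s * r := by positivity
      linarith [abs_add_le b a])
  have h2 : |1 - Real.cos b| ≤ 8 * (s * r) * m := by
    rw [abs_of_nonneg (sub_nonneg.2 (Real.cos_le_one b))]
    refine (one_sub_cos_le_mul_min b).trans ?_
    calc 2 * |b| * min |b| 1 ≤ 2 * (2 * (s * r)) * (2 * m) := by
          gcongr
          exact min_mul_one_le one_le_two hb
      _ = _ := by ring
  have h3 : |r ^ (-p) - ‖z - w‖ ^ (-p)| ≤ p * D * 2 ^ (p + 1) * (r ^ (-p) / r) := by
    refine (abs_rpow_neg_sub_rpow_neg_le (half_pos hz0) hp.le (by linarith) hr1).trans ?_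
    have e : (r / 2) ^ (-p - 1) = 2 ^ (p + 1) * (r ^ (-p) / r) := by
      rw [Real.div_rpow hz0.le two_pos.le, Real.rpow_sub_one hz0.ne',
        show -p - 1 = -(p + 1) by ring, Real.rpow_neg two_pos.le, div_inv_eq_mul, mul_comm]
    rw [e]
    calc _ ≤ p * (2 ^ (p + 1) * (r ^ (-p) / r)) * D := by gcongr
      _ = _ := by ring
  have e0 : cosKernel α ξ z - cosKernel α ξ (z - w) =
      (Real.cos b - Real.cos a) * r ^ (-p) +
        (1 - Real.cos b) * (r ^ (-p) - ‖z - w‖ ^ (-p)) := by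
    rw [cosKernel, cosKernel, div_eq_mul_inv, div_eq_mul_inv, ← hpdef,
      ← Real.rpow_neg (norm_nonneg _), ← Real.rpow_neg (norm_nonneg _)]
    ring
  have hrp : 0 ≤ r ^ (-p) := Real.rpow_nonneg hz0.le _
  rw [e0]
  calc _ ≤ |Real.cos b - Real.cos a| * r ^ (-p) +
        |1 - Real.cos b| * |r ^ (-p) - ‖z - w‖ ^ (-p)| := by
        refine (abs_add_le _ _).trans ?_
        rw [abs_mul, abs_mul, abs_of_nonneg hrp]
    _ ≤ s * D * (2 * m) * r ^ (-p) +
        8 * (s * r) * m * (p * D * 2 ^ (p + 1) * (r ^ (-p) / r)) := by gcongr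
    _ = _ := by
        rw [minKernel, div_eq_mul_inv (min _ _), ← hpdef, ← Real.rpow_neg (norm_nonneg _), ← hm]
        change _ = _ * s * (m * r ^ (-p))
        field_simp

/-- Translations within the cell change the cosine kernel in `L_1` only to the order of
`|ξ|² + |ξ| τ`, `τ` being the tail: near the origin the kernel itself is of order `|ξ|²`, and at
infinity it varies slowly. -/
lemma exists_integral_abs_cosKernel_sub_le (d : ℕ) [NeZero d] {α : ℝ} (hα : 0 < α) (hα2 : α < 2) :
    ∃ C, 0 ≤ C ∧ ∀ ξ : E d, ∀ w ∈ cell d,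
      ∫ z, |cosKernel α ξ z - cosKernel α ξ (z - w)| ≤
        C * (‖ξ‖ ^ 2 + ‖ξ‖ * tail d α ‖ξ‖) := by
  set D : ℝ := √d
  have hD : 1 ≤ D := Real.one_le_sqrt.2 (by exact_mod_cast Nat.one_le_iff_ne_zero.2 (NeZero.ne d))
  have hint := integrableOn_norm_rpow_ball (d := d) (q := 2 - ((d : ℝ) + α)) (by linarith) (4 * D)
  set K : ℝ := ∫ z in Metric.ball (0 : E d) (4 * D), ‖z‖ ^ (2 - ((d : ℝ) + α))
  have hK : 0 ≤ K := integral_nonneg fun z => by positivity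
  set M : ℝ := 2 * D + 8 * ((d + α) * D * 2 ^ ((d : ℝ) + α + 1))
  have hM : 0 ≤ M := by positivity
  refine ⟨2 * K + M, by positivity, fun ξ w hw => ?_⟩
  have hwD : ‖w‖ ≤ D := norm_le_sqrt_of_mem_cell hw
  have hg := integrable_cosKernel hα hα2 ξ
  have hgw : Integrable fun z => cosKernel α ξ (z - w) := hg.comp_sub_right w
  have hdiff : Integrable fun z => |cosKernel α ξ z - cosKernel α ξ (z - w)| := (hg.sub hgw).abs
  have hball : ∫ z in Metric.ball (0 : E d) (4 * D), cosKernel α ξ z ≤ ‖ξ‖ ^ 2 * K := by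
    rw [← integral_const_mul]
    exact integral_mono hg.integrableOn (hint.const_mul _) fun z => cosKernel_le_near α ξ z
  have hnear : ∫ z in Metric.ball (0 : E d) (2 * D),
      |cosKernel α ξ z - cosKernel α ξ (z - w)| ≤ 2 * K * ‖ξ‖ ^ 2 := by
    calc _ ≤ ∫ z in Metric.ball (0 : E d) (2 * D), (cosKernel α ξ z + cosKernel α ξ (z - w)) := by
          refine integral_mono hdiff.integrableOn (hg.add hgw).integrableOn fun z => ?_
          have h1 := cosKernel_nonneg α ξ z
          have h2 := cosKernel_nonneg α ξ (z - w)
          exact abs_le.2 ⟨by linarith, by linarith⟩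
      _ = (∫ z in Metric.ball (0 : E d) (2 * D), cosKernel α ξ z) +
          ∫ z in Metric.ball (0 : E d) (2 * D), cosKernel α ξ (z - w) :=
          integral_add hg.integrableOn hgw.integrableOn
      _ ≤ ‖ξ‖ ^ 2 * K + ‖ξ‖ ^ 2 * K := by
          refine add_le_add (le_trans ?_ hball) (le_trans ?_ hball)
          · refine setIntegral_mono_set hg.integrableOn
              (Filter.Eventually.of_forall (cosKernel_nonneg α ξ)) ?_
            exact (Metric.ball_subset_ball (by linarith)).eventuallyLE
          · rw [← (measurePreserving_sub_right volume w).setIntegral_preimage_emb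
              (measurableEmbedding_subRight w) (cosKernel α ξ)]
            refine setIntegral_mono_set hgw.integrableOn
              (Filter.Eventually.of_forall fun z => cosKernel_nonneg α ξ (z - w)) ?_
            refine Filter.Eventually.of_forall fun z hz => ?_
            replace hz : z ∈ Metric.ball (0 : E d) (2 * D) := hz
            change z ∈ (fun z => z - w) ⁻¹' Metric.ball (0 : E d) (4 * D)
            rw [mem_ball_zero_iff] at hz
            rw [mem_preimage, mem_ball_zero_iff]
            linarith [norm_sub_le z w]
      _ = _ := by ring
  have hsub : (Metric.ball (0 : E d) (2 * D))ᶜ ⊆ farSet d := fun z hz => by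
    rw [mem_compl_iff, mem_ball_zero_iff, not_lt] at hz
    exact lt_of_lt_of_le (by linarith) hz
  have hmk := integrableOn_minKernel (d := d) (s := ‖ξ‖) hα (norm_nonneg ξ)
  have hfar : ∫ z in (Metric.ball (0 : E d) (2 * D))ᶜ,
      |cosKernel α ξ z - cosKernel α ξ (z - w)| ≤ M * (‖ξ‖ * tail d α ‖ξ‖) := by
    calc _ ≤ ∫ z in (Metric.ball (0 : E d) (2 * D))ᶜ, M * ‖ξ‖ * minKernel α ‖ξ‖ z := by
          refine setIntegral_mono_on hdiff.integrableOn ((hmk.mono_set hsub).const_mul _)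
            measurableSet_ball.compl fun z hz => ?_
          rw [mem_compl_iff, mem_ball_zero_iff, not_lt] at hz
          exact abs_cosKernel_sub_le hα ξ hwD hz (by linarith)
      _ = M * ‖ξ‖ * ∫ z in (Metric.ball (0 : E d) (2 * D))ᶜ, minKernel α ‖ξ‖ z :=
          integral_const_mul _ _
      _ ≤ M * ‖ξ‖ * tail d α ‖ξ‖ := by
          gcongr
          exact setIntegral_mono_set hmk
            (Filter.Eventually.of_forall (minKernel_nonneg (norm_nonneg ξ))) hsub.eventuallyLE
      _ = _ := by ring
  have ht := tail_nonneg (d := d) (α := α) (norm_nonneg ξ)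
  have hs : 0 ≤ ‖ξ‖ * tail d α ‖ξ‖ := by positivity
  rw [← integral_add_compl (measurableSet_ball (x := (0 : E d)) (ε := 2 * D)) hdiff]
  nlinarith [mul_nonneg hK hs, mul_nonneg hM (sq_nonneg ‖ξ‖)]

/-- A periodic function may be replaced by its mean value, up to the `L_1`-oscillation of the
density: average over the translations of the density by the vectors of the cell. -/
lemma abs_integral_mul_sub_mean_le {d : ℕ} {N g : E d → ℝ} {B K : ℝ} (hN : Measurable N)
    (hNB : ∀ x, |N x| ≤ B) (hper : IsPeriodic N) (hg : Integrable g)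
    (hK : ∀ w ∈ cell d, ∫ z, |g z - g (z - w)| ≤ K) :
    |(∫ z, N z * g z) - (∫ w in cell d, N w) * ∫ z, g z| ≤ B * K := by
  have hB : 0 ≤ B := (abs_nonneg _).trans (hNB 0)
  have hNg : Integrable fun z => N z * g z :=
    hg.bdd_mul (c := B) hN.aestronglyMeasurable (Filter.Eventually.of_forall hNB)
  have hNgw : ∀ w, Integrable fun z => N z * g (z - w) := fun w =>
    (hg.comp_sub_right w).bdd_mul (c := B) hN.aestronglyMeasurable (Filter.Eventually.of_forall hNB)
  have hprod : Integrable (fun p : E d × E d => N (p.2 + p.1) * g p.2)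
      ((volume.restrict (cell d)).prod volume) :=
    (hg.comp_snd _).bdd_mul (c := B)
      (hN.comp (measurable_snd.add measurable_fst)).aestronglyMeasurable
      (Filter.Eventually.of_forall fun p => hNB _)
  have hshift : ∀ w, ∫ z, N (z + w) * g z = ∫ z, N z * g (z - w) := fun w => by
    rw [← integral_add_right_eq_self (fun z => N z * g (z - w)) w]
    simp only [add_sub_cancel_right]
  have h1 : (∫ w in cell d, N w) * ∫ z, g z = ∫ w in cell d, ∫ z, N z * g (z - w) := by
    simp_rw [← hshift]
    rw [integral_integral_swap hprod, ← integral_const_mul]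
    refine integral_congr_ae (Filter.Eventually.of_forall fun z => ?_)
    simp only
    rw [integral_mul_const]
    congr 1
    have := hper.integral_add hN.stronglyMeasurable z
    simp_rw [add_comm z]
    exact this.symm
  have h2 : ∫ z, N z * g z = ∫ _w in cell d, ∫ z, N z * g z := by simp
  have h3 : Integrable (fun w => ∫ z, N z * g (z - w)) (volume.restrict (cell d)) := by
    have := hprod.integral_prod_left
    simp only [hshift] at this
    exact this
  rw [h1, h2, ← integral_sub (integrable_const _) h3, ← Real.norm_eq_abs]
  have h4 : ∀ᵐ w ∂(volume.restrict (cell d)),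
      ‖(∫ z, N z * g z) - ∫ z, N z * g (z - w)‖ ≤ B * K := by
    filter_upwards [ae_restrict_mem (measurableSet_cell d)] with w hw
    rw [← integral_sub hNg (hNgw w)]
    calc _ ≤ ∫ z, B * |g z - g (z - w)| := by
          refine norm_integral_le_of_norm_le ((hg.sub (hg.comp_sub_right w)).abs.const_mul B)
            (Filter.Eventually.of_forall fun z => ?_)
          rw [← mul_sub, norm_mul, Real.norm_eq_abs, Real.norm_eq_abs]
          exact mul_le_mul_of_nonneg_right (hNB z) (abs_nonneg _)
      _ ≤ _ := by
          rw [integral_const_mul]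
          exact mul_le_mul_of_nonneg_left (hK w hw) hB
  have := norm_integral_le_of_norm_le_const h4
  simpa using this

lemma latticePt_zero {d : ℕ} : latticePt (0 : Fin d → ℤ) = 0 := by
  ext i; simp [latticePt]

lemma integrable_strip_cosKernel {d : ℕ} [NeZero d] {α : ℝ} (hα : 0 < α) (hα2 : α < 2) (ξ : E d) :
    Integrable (fun p : E d × E d => cosKernel α ξ (p.2 - p.1)) (stripMeasure d) := by
  have hm := measurable_cosKernel α ξ
  have hm2 : Measurable fun p : E d × E d => cosKernel α ξ (p.2 - p.1) :=
    hm.comp (measurable_snd.sub measurable_fst)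
  rw [← lintegral_ofReal_ne_top_iff_integrable hm2.aestronglyMeasurable
    (Filter.Eventually.of_forall fun p => cosKernel_nonneg _ _ _), lintegral_strip (by fun_prop)]
  simp only [add_sub_cancel_left, lintegral_const, measure_univ, mul_one]
  exact (integrable_cosKernel hα hα2 ξ).lintegral_lt_top.ne

lemma blochForm_constOne {d : ℕ} (α : ℝ) (μ : E d → E d → ℝ) (ξ : E d) :
    blochForm α μ ξ (constOne d) (constOne d) =
      ((∫ p, μ p.1 p.2 * cosKernel α ξ (p.2 - p.1) ∂(stripMeasure d) : ℝ) : ℂ) := by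
  rw [← integral_complex_ofReal, blochForm, ← integral_const_mul, ← stripMeasure]
  refine integral_congr_ae ?_
  filter_upwards [ae_strip (ae_toCell (coeFn_constOne d))] with p hp
  have e1 : ∀ x : E d, constOne d (toCell x) = 1 →
      bloch ξ (constOne d) x = Complex.exp (Complex.I * ((inner ℝ ξ x : ℝ) : ℂ)) := fun x hx => by
    simp only [bloch, perExt, hx, mul_one]
  obtain ⟨x, y⟩ := p
  obtain ⟨z, rfl⟩ : ∃ z, y = x + z := ⟨y - x, by simp⟩
  rw [Complex.mul_conj, Complex.normSq_eq_norm_sq]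
  simp only at hp ⊢
  rw [e1 _ hp.1, e1 _ hp.2, inner_add_right, Complex.ofReal_add, mul_add, Complex.exp_add,
    ← mul_one_sub, norm_mul, norm_exp_I_mul, one_mul, norm_sub_rev (1 : ℂ), norm_exp_sub_one_sq,
    add_sub_cancel_left, sub_add_cancel_left, norm_neg, cosKernel]
  push_cast
  ring

namespace IsPeriodicCoefficient

variable {d : ℕ} [NeZero d] {μm μp : ℝ} {μ : E d → E d → ℝ} {α : ℝ}

lemma abs_strip_integral_sub_le (h : IsPeriodicCoefficient μm μp μ) (h0 : 0 < μm) (hα : 0 < α)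
    (hα2 : α < 2) (ξ : E d) {K : ℝ}
    (hK : ∀ w ∈ cell d, ∫ z, |cosKernel α ξ z - cosKernel α ξ (z - w)| ≤ K) :
    |(∫ p, μ p.1 p.2 * cosKernel α ξ (p.2 - p.1) ∂(stripMeasure d)) -
      meanCoef μ * (c0 d α * ‖ξ‖ ^ α)| ≤ μp * K := by
  have hm := h.measurable
  have hbd : ∀ x y, |μ x y| ≤ μp := fun x y => by
    rw [abs_of_pos (h0.trans_le (h.le x y))]
    exact h.ge x y
  have hI : Integrable (fun p : E d × E d => μ p.1 p.2 * cosKernel α ξ (p.2 - p.1))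
      ((volume.restrict (cell d)).prod volume) :=
    (integrable_strip_cosKernel hα hα2 ξ).bdd_mul (c := μp) hm.aestronglyMeasurable
      (Filter.Eventually.of_forall fun p => hbd _ _)
  have hI2 : Integrable (fun p : E d × E d => μ p.1 p.2)
      ((volume.restrict (cell d)).prod (volume.restrict (cell d))) :=
    Integrable.of_bound hm.aestronglyMeasurable μp
      (Filter.Eventually.of_forall fun p => hbd _ _)
  have hx : ∀ x : E d, Measurable (μ x) := fun x =>
    hm.comp (measurable_prodMk_left (x := x))
  have hper : ∀ x, IsPeriodic (μ x) := fun x => isPeriodic_of_add_latticePt fun y n => by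
    have := h.periodic x y 0 n
    rwa [latticePt_zero, add_zero] at this
  rw [stripMeasure, integral_prod _ hI, meanCoef, integral_prod _ hI2,
    ← integral_mul_const, ← integral_sub hI.integral_prod_left (hI2.integral_prod_left.mul_const _),
    ← Real.norm_eq_abs]
  have key : ∀ x, ‖(∫ y, μ x y * cosKernel α ξ (y - x)) -
      (∫ y in cell d, μ x y) * (c0 d α * ‖ξ‖ ^ α)‖ ≤ μp * K := by
    intro x
    have h1 : ∫ y, μ x y * cosKernel α ξ (y - x) = ∫ z, μ x (z + x) * cosKernel α ξ z := by
      rw [← integral_add_right_eq_self (fun y => μ x y * cosKernel α ξ (y - x)) x]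
      simp only [add_sub_cancel_right]
    have h2 := abs_integral_mul_sub_mean_le (N := fun z => μ x (z + x))
      ((hx x).comp (measurable_add_const x)) (fun z => hbd x (z + x)) ((hper x).comp_add x)
      (integrable_cosKernel hα hα2 ξ) hK
    rw [(hper x).integral_add (hx x).stronglyMeasurable x, integral_cosKernel hα] at h2
    rw [h1]
    exact h2
  have := norm_integral_le_of_norm_le_const (μ := (volume : Measure (E d)).restrict (cell d))
    (Filter.Eventually.of_forall key)
  simpa using this

end IsPeriodicCoefficient

/-- On constants the form agrees with the effective form up to second order. -/
lemma exists_norm_blochForm_sub_le (d : ℕ) [NeZero d] {α : ℝ} (hα : 0 < α) (hα2 : α < 2) :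
    ∃ C, 0 ≤ C ∧ ∀ (μm μp : ℝ) (μ : E d → E d → ℝ), 0 < μm → IsPeriodicCoefficient μm μp μ →
      ∀ ξ : E d, ‖blochForm α μ ξ (constOne d) (constOne d) -
        ((meanCoef μ * c0 d α * ‖ξ‖ ^ α : ℝ) : ℂ)‖ ≤
          μp * (C * (‖ξ‖ ^ 2 + ‖ξ‖ * tail d α ‖ξ‖)) := by
  obtain ⟨C, hC, hK⟩ := exists_integral_abs_cosKernel_sub_le d hα hα2
  refine ⟨C, hC, fun μm μp μ h0 h ξ => ?_⟩
  rw [blochForm_constOne, ← Complex.ofReal_sub, Complex.norm_real, Real.norm_eq_abs, mul_assoc]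
  exact h.abs_strip_integral_sub_le h0 hα hα2 ξ (hK ξ)

/-! ### Regularisation of the coefficient -/

/-- Every coefficient agrees almost everywhere with one for which the bounds and the periodicity
hold everywhere. -/
lemma IsCoefficient.exists_isPeriodicCoefficient {d : ℕ} {μm μp : ℝ} {μ : E d → E d → ℝ}
    (h : IsCoefficient μm μp μ) :
    ∃ μ' : E d → E d → ℝ, IsPeriodicCoefficient μm μp μ' ∧
      ∀ᵐ p : E d × E d, μ' p.1 p.2 = μ p.1 p.2 := by
  obtain ⟨p₀, hp₀⟩ := h.bounds.exists
  have hle : μm ≤ μp := hp₀.1.trans hp₀.2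
  set f := h.aemeasurable.mk
  have hf : Measurable f := h.aemeasurable.measurable_mk
  refine ⟨fun x y => max μm (min μp (f (toCell x, toCell y))), ?_, ?_⟩
  · refine ⟨?_, fun x y => le_max_left _ _, fun x y => max_le hle (min_le_left _ _), ?_⟩
    · have h1 : Measurable fun p : E d × E d => f (toCell p.1, toCell p.2) :=
        hf.comp ((measurable_toCell.comp measurable_fst).prodMk
          (measurable_toCell.comp measurable_snd))
      exact measurable_const.max (measurable_const.min h1)
    · intro x y m n
      simp only [toCell_add_latticePt]
  · have h1 : ∀ᵐ p : E d × E d, ∀ m n : Fin d → ℤ,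
        f (p.1 + latticePt m, p.2 + latticePt n) = μ p.1 p.2 := by
      rw [ae_all_iff]
      intro m
      rw [ae_all_iff]
      intro n
      have hmp : MeasurePreserving (fun p : E d × E d => (p.1 + latticePt m, p.2 + latticePt n)) :=
        (measurePreserving_add_right volume (latticePt m)).prod
          (measurePreserving_add_right volume (latticePt n))
      filter_upwards [hmp.quasiMeasurePreserving.ae h.aemeasurable.ae_eq_mk, h.periodic m n]
        with p hp1 hp2
      rw [← hp2]
      exact hp1.symm
    filter_upwards [h1, h.bounds] with p hp hb
    have := hp (fun i => -⌊p.1 i⌋) fun i => -⌊p.2 i⌋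
    rw [add_neg_floor_eq_toCell, add_neg_floor_eq_toCell] at this
    rw [this, min_eq_right hb.2, max_eq_right hb.1]

lemma blochForm_congr {d : ℕ} {μ μ' : E d → E d → ℝ} (h : ∀ᵐ p : E d × E d, μ' p.1 p.2 = μ p.1 p.2)
    (α : ℝ) (ξ : E d) (u v : L2Cell d) : blochForm α μ' ξ u v = blochForm α μ ξ u v := by
  have hac : ((volume : Measure (E d)).restrict (cell d)).prod (volume : Measure (E d)) ≪
      volume := (Measure.absolutelyContinuous_of_le Measure.restrict_le_self).prod
        Measure.AbsolutelyContinuous.rfl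
  rw [blochForm, blochForm]
  congr 1
  refine integral_congr_ae ?_
  filter_upwards [hac.ae_le h] with p hp
  rw [hp]

lemma opGraph_congr {d : ℕ} {μ μ' : E d → E d → ℝ} (h : ∀ᵐ p : E d × E d, μ' p.1 p.2 = μ p.1 p.2)
    (α : ℝ) (ξ : E d) : opGraph α μ' ξ = opGraph α μ ξ := by
  simp only [opGraph, blochForm_congr h]

lemma meanCoef_congr {d : ℕ} {μ μ' : E d → E d → ℝ}
    (h : ∀ᵐ p : E d × E d, μ' p.1 p.2 = μ p.1 p.2) : meanCoef μ' = meanCoef μ := by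
  have hac : ((volume : Measure (E d)).restrict (cell d)).prod
      ((volume : Measure (E d)).restrict (cell d)) ≪ volume :=
    (Measure.absolutelyContinuous_of_le Measure.restrict_le_self).prod
      (Measure.absolutelyContinuous_of_le Measure.restrict_le_self)
  exact integral_congr_ae (hac.ae_le h)

lemma IsPeriodicCoefficient.le_meanCoef {d : ℕ} {μm μp : ℝ} {μ : E d → E d → ℝ}
    (h : IsPeriodicCoefficient μm μp μ) : μm ≤ meanCoef μ := by
  have hI : Integrable (fun p : E d × E d => μ p.1 p.2)
      ((volume.restrict (cell d)).prod (volume.restrict (cell d))) :=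
    Integrable.of_bound h.measurable.aestronglyMeasurable (max |μm| |μp|)
      (Filter.Eventually.of_forall fun p => abs_le_max_abs_abs (h.le _ _) (h.ge _ _))
  have := integral_mono (integrable_const μm) hI fun p => h.le p.1 p.2
  simpa [meanCoef] using this

/-! ### The effective resolvent -/

/-- The resolvent of the effective operator is the Fourier multiplier `(κ|2πn + ξ|^α + t)⁻¹`. -/
lemma exists_effective_resolvent {d : ℕ} {α κ t : ℝ} (hκ : 0 ≤ κ) (ht : 0 < t) (ξ : E d) :
    ∃ R : L2Cell d →L[ℂ] L2Cell d, IsShiftedInverse (multGraph α κ ξ) t R ∧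
      (∀ f n, fourierCoef (R f) n =
        (((κ * ‖freq ξ n‖ ^ α + t)⁻¹ : ℝ) : ℂ) * fourierCoef f n) ∧ ‖R‖ ≤ t⁻¹ := by
  have hpos : ∀ n, 0 < κ * ‖freq ξ n‖ ^ α + t := fun n => by positivity
  obtain ⟨R, hR, hRn⟩ := exists_diagonal (cellBasis d)
    (fun n => (κ * ‖freq ξ n‖ ^ α + t)⁻¹) (C := t⁻¹) (by positivity) fun n => by
      rw [abs_of_pos (inv_pos.2 (hpos n))]
      gcongr
      have : 0 ≤ κ * ‖freq ξ n‖ ^ α := by positivity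
      linarith
  simp only [cellBasis_repr] at hR
  refine ⟨R, fun f u => ⟨?_, ?_⟩, hR, hRn⟩
  · rintro rfl
    refine ⟨f - (t : ℂ) • R f, fun n => ?_, sub_add_cancel _ _⟩
    have := (hpos n).ne'
    have h2 : ((κ * ‖freq ξ n‖ ^ α + t : ℝ) : ℂ) ≠ 0 := by exact_mod_cast this
    simp only
    rw [fourierCoef_sub, fourierCoef_smul, hR, ← freq]
    rw [Complex.ofReal_inv]
    field_simp
    push_cast
    ring
  · rintro ⟨g, hg, rfl⟩
    refine ext_fourierCoef fun n => ?_
    have h2 : ((κ * ‖freq ξ n‖ ^ α + t : ℝ) : ℂ) ≠ 0 := by exact_mod_cast (hpos n).ne'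
    have h3 := hg n
    simp only at h3
    rw [← freq] at h3
    rw [hR, fourierCoef_add, fourierCoef_smul, h3, ← add_mul, Complex.ofReal_inv, ← mul_assoc,
      ← Complex.ofReal_add, inv_mul_cancel₀ h2, one_mul]

/-! ### Algebraic properties of the form -/

namespace IsPeriodicCoefficient

variable {d : ℕ} [NeZero d] {μm μp : ℝ} {μ : E d → E d → ℝ} {α : ℝ}

lemma blochForm_smul_add (h : IsPeriodicCoefficient μm μp μ) (h0 : 0 < μm) (hα : 0 < α)
    (hα2 : α < 2) (ξ : E d) (c : ℂ) {u v w : L2Cell d} (hu : u ∈ perSobolev d (α / 2))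
    (hv : v ∈ perSobolev d (α / 2)) (hw : w ∈ perSobolev d (α / 2)) :
    blochForm α μ ξ (c • u + v) w = c * blochForm α μ ξ u w + blochForm α μ ξ v w := by
  have hU := h.incrLp_ae h0 hα hα2 ξ hu
  have hV := h.incrLp_ae h0 hα hα2 ξ hv
  have hW := h.incrLp_ae h0 hα hα2 ξ hw
  have hS : c • h.incrLp h0 hα hα2 ξ hu + h.incrLp h0 hα hα2 ξ hv =ᵐ[formMeasure α μ]
      incr ξ (c • u + v : L2Cell d) :=
    (Lp.coeFn_add _ _).trans ((((Lp.coeFn_smul c _).trans (hU.const_smul c)).trans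
      (incr_smul_ae ξ c u).symm).add hV |>.trans (incr_add_ae ξ _ _).symm)
  rw [h.blochForm_eq_inner h0 α ξ hS hW, h.blochForm_eq_inner h0 α ξ hU hW,
    h.blochForm_eq_inner h0 α ξ hV hW, inner_add_right, inner_smul_right]
  ring

lemma blochForm_conj (h : IsPeriodicCoefficient μm μp μ) (h0 : 0 < μm) (hα : 0 < α)
    (hα2 : α < 2) (ξ : E d) {u v : L2Cell d} (hu : u ∈ perSobolev d (α / 2))
    (hv : v ∈ perSobolev d (α / 2)) :
    (starRingEnd ℂ) (blochForm α μ ξ u v) = blochForm α μ ξ v u := by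
  have hU := h.incrLp_ae h0 hα hα2 ξ hu
  have hV := h.incrLp_ae h0 hα hα2 ξ hv
  rw [h.blochForm_eq_inner h0 α ξ hU hV, h.blochForm_eq_inner h0 α ξ hV hU, map_mul,
    inner_conj_symm]
  congr 1
  rw [map_div₀, map_one, map_ofNat]

lemma le_re_blochForm (h : IsPeriodicCoefficient μm μp μ) (h0 : 0 < μm) (hα : 0 < α)
    (hα2 : α < 2) (ξ : E d) {u : L2Cell d} (hu : u ∈ perSobolev d (α / 2)) :
    c0 d α * μm * freqEnergy α ξ u ≤ (blochForm α μ ξ u u).re := by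
  have hU := h.incrLp_ae h0 hα hα2 ξ hu
  have h1 := h.le_norm_sq h0 hα hα2 ξ hu hU
  rw [h.blochForm_eq_inner h0 α ξ hU hU, inner_self_eq_norm_sq_to_K]
  have e : (1 / 2 : ℂ) * ((‖h.incrLp h0 hα hα2 ξ hu‖ : ℝ) : ℂ) ^ 2 =
      ((1 / 2 * ‖h.incrLp h0 hα hα2 ξ hu‖ ^ 2 : ℝ) : ℂ) := by push_cast; ring
  refine le_trans ?_ (congrArg Complex.re e).ge
  rw [Complex.ofReal_re]
  linarith

end IsPeriodicCoefficient

/-! ### The splitting into constants and functions of mean value zero -/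

lemma pi_le_norm_freq {d : ℕ} {ξ : E d} (hξ : ξ ∈ dualCell d) {n : Fin d → ℤ} (hn : n ≠ 0) :
    Real.pi ≤ ‖freq ξ n‖ := by
  obtain ⟨i, hi⟩ := Function.ne_iff.1 hn
  have h1 : |2 * Real.pi * n i + ξ i| ≤ ‖freq ξ n‖ := by
    have := PiLp.norm_apply_le (freq ξ n) i
    simpa [freq, latticePt] using this
  refine le_trans ?_ h1
  have h2 : (1 : ℝ) ≤ |(n i : ℝ)| := by exact_mod_cast Int.one_le_abs hi
  have h3 : |ξ i| ≤ Real.pi := abs_le.2 ⟨(hξ i).1, (hξ i).2.le⟩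
  have h4 : 2 * Real.pi ≤ |2 * Real.pi * n i| := by
    rw [abs_mul, abs_of_pos Real.two_pi_pos]
    nlinarith [Real.pi_pos]
  have h5 := abs_sub_abs_le_abs_add (2 * Real.pi * n i) (ξ i)
  linarith

lemma freq_zero {d : ℕ} (ξ : E d) : freq ξ 0 = ξ := by
  simp [freq, latticePt_zero]

lemma constOne_mem {d : ℕ} [NeZero d] {α : ℝ} (hα : 0 < α) (hα2 : α < 2) :
    constOne d ∈ perSobolev d (α / 2) := by
  rw [mem_perSobolev_iff hα hα2 0]
  refine summable_of_ne_finset_zero (s := {0}) fun n hn => ?_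
  rw [fourierCoef_constOne, if_neg (by simpa using hn)]
  simp

/-- The component of mean value zero. -/
noncomputable def meanZeroPart {d : ℕ} (u : L2Cell d) : L2Cell d :=
  u - fourierCoef u 0 • constOne d

lemma smul_add_meanZeroPart {d : ℕ} (u : L2Cell d) :
    fourierCoef u 0 • constOne d + meanZeroPart u = u := by
  simp [meanZeroPart]

lemma fourierCoef_meanZeroPart {d : ℕ} (u : L2Cell d) (n : Fin d → ℤ) :
    fourierCoef (meanZeroPart u) n = if n = 0 then 0 else fourierCoef u n := by
  rw [meanZeroPart, fourierCoef_sub, fourierCoef_smul, fourierCoef_constOne]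
  split_ifs with h <;> simp [h]

lemma norm_fourierCoef_meanZeroPart_le {d : ℕ} (u : L2Cell d) (n : Fin d → ℤ) :
    ‖fourierCoef (meanZeroPart u) n‖ ≤ ‖fourierCoef u n‖ := by
  rw [fourierCoef_meanZeroPart]
  split_ifs <;> simp

lemma meanZeroPart_mem {d : ℕ} [NeZero d] {α : ℝ} (hα : 0 < α) (hα2 : α < 2) {u : L2Cell d}
    (hu : u ∈ perSobolev d (α / 2)) : meanZeroPart u ∈ perSobolev d (α / 2) := by
  rw [mem_perSobolev_iff hα hα2 0] at hu ⊢
  refine hu.of_nonneg_of_le (fun n => by positivity) fun n => ?_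
  gcongr
  exact norm_fourierCoef_meanZeroPart_le u n

lemma freqEnergy_eq_add {d : ℕ} [NeZero d] {α : ℝ} (hα : 0 < α) (hα2 : α < 2) (ξ : E d)
    {u : L2Cell d} (hu : u ∈ perSobolev d (α / 2)) :
    freqEnergy α ξ u = ‖ξ‖ ^ α * ‖fourierCoef u 0‖ ^ 2 + freqEnergy α ξ (meanZeroPart u) := by
  have h := (mem_perSobolev_iff hα hα2 ξ u).1 hu
  rw [freqEnergy, h.tsum_eq_add_tsum_ite 0, freq_zero, freqEnergy]
  congr 1
  refine tsum_congr fun n => ?_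
  rw [fourierCoef_meanZeroPart]
  split_ifs <;> simp

/-- On functions of mean value zero the energy controls the `L_2`-norm with constant `1`, because
`|2πn + ξ| ≥ π` for `n ≠ 0`. -/
lemma norm_meanZeroPart_le {d : ℕ} [NeZero d] {α : ℝ} (hα : 0 < α) (hα2 : α < 2) {ξ : E d}
    (hξ : ξ ∈ dualCell d) {u : L2Cell d} (hu : u ∈ perSobolev d (α / 2)) :
    ‖meanZeroPart u‖ ≤ √(freqEnergy α ξ (meanZeroPart u)) := by
  refine Real.le_sqrt_of_sq_le ?_
  refine hasSum_le (fun n => ?_) (hasSum_fourierCoef_sq (meanZeroPart u))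
    ((mem_perSobolev_iff hα hα2 ξ _).1 (meanZeroPart_mem hα hα2 hu)).hasSum
  rcases eq_or_ne n 0 with rfl | hn
  · simp [fourierCoef_meanZeroPart]
  · refine le_mul_of_one_le_left (by positivity) (Real.one_le_rpow ?_ hα.le)
    linarith [pi_le_norm_freq hξ hn, Real.pi_gt_three]

lemma inner_meanZeroPart_constOne {d : ℕ} (u : L2Cell d) :
    inner ℂ (meanZeroPart u) (constOne d) = 0 := by
  rw [← inner_conj_symm, inner_constOne, fourierCoef_meanZeroPart]
  simp

/-! ### The rate -/

/-- The quotient `(s + τ(s)) / (s^α + ε^α)`, which measures how strongly constants are coupled to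
functions of mean value zero, against the rate. -/
lemma exists_coupling_le_rate (d : ℕ) [NeZero d] {α : ℝ} (hα : 0 < α) (hα2 : α < 2) {S : ℝ}
    (hS : 0 ≤ S) :
    ∃ C : ℝ, 0 ≤ C ∧ ∀ ε : ℝ, 0 < ε → ε ≤ 1 → ∀ s : ℝ, 0 ≤ s → s ≤ S →
      (1 + (s + tail d α s) / (s ^ α + ε ^ α)) ^ 2 ≤ C * rate α ε := by
  -- it suffices to bound the unsquared quantity by a square root of the rate
  have key : ∀ ρ : ℝ → ℝ, (∀ ε : ℝ, 0 < ε → ρ ε ^ 2 = rate α ε) →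
      (∃ C : ℝ, 0 ≤ C ∧ ∀ ε : ℝ, 0 < ε → ε ≤ 1 → 1 ≤ ρ ε ∧ ∀ s : ℝ, 0 ≤ s → s ≤ S →
        s + tail d α s ≤ C * ρ ε * (s ^ α + ε ^ α)) →
      ∃ C : ℝ, 0 ≤ C ∧ ∀ ε : ℝ, 0 < ε → ε ≤ 1 → ∀ s : ℝ, 0 ≤ s → s ≤ S →
        (1 + (s + tail d α s) / (s ^ α + ε ^ α)) ^ 2 ≤ C * rate α ε := by
    rintro ρ hρ ⟨C, hC, h⟩
    refine ⟨(1 + C) ^ 2, by positivity, fun ε hε hε1 s hs hsS => ?_⟩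
    obtain ⟨h1, h2⟩ := h ε hε hε1
    have hT : 0 < s ^ α + ε ^ α := by positivity
    have h3 := (div_le_iff₀ hT).2 (h2 s hs hsS)
    have h4 : 0 ≤ (s + tail d α s) / (s ^ α + ε ^ α) :=
      div_nonneg (add_nonneg hs (tail_nonneg hs)) hT.le
    rw [← hρ ε hε, ← mul_pow]
    refine pow_le_pow_left₀ (by linarith) ?_ 2
    linarith
  rcases lt_trichotomy α 1 with h1 | h1 | h1
  · obtain ⟨C, hC⟩ := exists_tail_le_of_lt_one d hα h1
    refine key (fun _ => 1) (fun ε _ => by simp [rate, h1])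
      ⟨S ^ (1 - α) + |C|, by positivity, fun ε hε _ => ⟨le_rfl, fun s hs hsS => ?_⟩⟩
    have h2 : s ≤ S ^ (1 - α) * s ^ α := by
      calc s = s ^ (1 - α) * s ^ α := by
            rw [← Real.rpow_add_of_nonneg hs (by linarith) hα.le, sub_add_cancel, Real.rpow_one]
        _ ≤ S ^ (1 - α) * s ^ α := by
            gcongr
    have h3 : tail d α s ≤ |C| * s ^ α := (hC s hs).trans (by gcongr; exact le_abs_self C)
    have h4 : 0 ≤ (S ^ (1 - α) + |C|) * ε ^ α := by positivity
    linarith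
  · subst h1
    refine key (fun ε => 1 + |Real.log ε|) (fun ε _ => by simp [rate])
      ⟨1 + sphereArea d * Real.exp 1, ?_, fun ε hε hε1 => ⟨by simp, fun s hs _ => ?_⟩⟩
    · have := sphereArea_nonneg d
      positivity
    set l : ℝ := 1 + |Real.log ε|
    have hl : 1 ≤ l := by simp [l]
    have hl0 : 0 < l := by linarith
    have hli : l⁻¹ ≤ 1 := inv_le_one_of_one_le₀ hl
    -- the exponent `1 - 1 / (1 + |log ε|)` balances the loss `1 / (1 - γ)` against `ε ^ (γ - 1)`
    have h2 := tail_le (d := d) (γ := 1 - l⁻¹) hα hs (by linarith) (by linarith [inv_pos.2 hl0])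
      (by linarith [inv_pos.2 hl0])
    rw [sub_sub_cancel, div_inv_eq_mul] at h2
    have h3 : s ^ (1 - l⁻¹) ≤ Real.exp 1 * (s + ε) := by
      have h4 : ε ^ (-l⁻¹) ≤ Real.exp 1 := by
        rw [Real.rpow_def_of_pos hε]
        refine Real.exp_le_exp.2 ?_
        have h5 : -Real.log ε ≤ l := by linarith [neg_le_abs (Real.log ε)]
        calc Real.log ε * -l⁻¹ = -Real.log ε * l⁻¹ := by ring
          _ ≤ l * l⁻¹ := by gcongr
          _ = 1 := mul_inv_cancel₀ hl0.ne'
      calc s ^ (1 - l⁻¹) ≤ (s + ε) ^ (1 - l⁻¹) := by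
            gcongr
            linarith
        _ = (s + ε) * (s + ε) ^ (-l⁻¹) := by
            rw [sub_eq_add_neg, Real.rpow_add (by positivity), Real.rpow_one]
        _ ≤ (s + ε) * ε ^ (-l⁻¹) := by
            have h5 : ε ≤ s + ε := by linarith
            have h6 : -l⁻¹ ≤ 0 := by linarith [inv_pos.2 hl0]
            exact mul_le_mul_of_nonneg_left (Real.rpow_le_rpow_of_nonpos hε h5 h6) (by positivity)
        _ ≤ (s + ε) * Real.exp 1 := by gcongr
        _ = _ := mul_comm _ _
    have h6 : sphereArea d * l * s ^ (1 - l⁻¹) ≤ sphereArea d * l * (Real.exp 1 * (s + ε)) := by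
      have := sphereArea_nonneg d
      gcongr
    rw [Real.rpow_one, Real.rpow_one]
    have h7 : s ≤ l * (s + ε) := by nlinarith
    linarith
  · refine key (fun ε => ε ^ (1 - α)) (fun ε hε => ?_)
      ⟨1 + sphereArea d / (α - 1), ?_, fun ε hε hε1 => ⟨?_, fun s hs _ => ?_⟩⟩
    · rw [rate, if_neg (by linarith), if_neg (by linarith), ← Real.rpow_natCast,
        ← Real.rpow_mul hε.le]
      congr 1
      push_cast
      ring
    · have := div_nonneg (sphereArea_nonneg d) (sub_nonneg.2 h1.le)
      positivity
    · exact Real.one_le_rpow_of_pos_of_le_one_of_nonpos hε hε1 (by linarith)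
    have h2 := tail_le (d := d) (γ := 1) hα hs zero_le_one le_rfl h1
    rw [Real.rpow_one] at h2
    have h3 : s ≤ ε ^ (1 - α) * (s ^ α + ε ^ α) := by
      have h0 : ε ^ (1 - α) * ε ^ α = ε := by
        rw [← Real.rpow_add hε, sub_add_cancel, Real.rpow_one]
      rcases le_total s ε with h | h
      · have : 0 ≤ ε ^ (1 - α) * s ^ α := by positivity
        linarith
      · have hs' : 0 < s := hε.trans_le h
        have h4 : s ≤ ε ^ (1 - α) * s ^ α := by
          calc s = s ^ (1 - α) * s ^ α := by
                rw [← Real.rpow_add hs', sub_add_cancel, Real.rpow_one]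
            _ ≤ _ := by
                have h5 : 1 - α ≤ 0 := by linarith
                exact mul_le_mul_of_nonneg_right (Real.rpow_le_rpow_of_nonpos hε h h5)
                  (by positivity)
        linarith
    have h5 : 0 ≤ 1 + sphereArea d / (α - 1) := by
      have := div_nonneg (sphereArea_nonneg d) (sub_nonneg.2 h1.le)
      positivity
    calc s + tail d α s ≤ (1 + sphereArea d / (α - 1)) * s := by linarith
      _ ≤ (1 + sphereArea d / (α - 1)) * (ε ^ (1 - α) * (s ^ α + ε ^ α)) := by gcongr
      _ = _ := by ring

/-! ### Solving the coupled inequalities -/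

/-- The elementary inequality behind the resolvent estimate. The solution of the equation is
`c + v` with `|c| = k`, `‖v‖ = N` and form norm `X` of `v`; the hypotheses come from testing with
the solution, with `v` and with constants, and `δ` is the error in `c`. -/
lemma exists_coupled_estimate {m A T₁ : ℝ} (hm : 0 < m) (hA : 0 ≤ A) (hT₁ : 0 ≤ T₁) :
    ∃ C : ℝ, 0 ≤ C ∧ ∀ T β k X N δ F : ℝ, 0 < T → T ≤ T₁ → 0 ≤ β → 0 ≤ k → 0 ≤ X → N ≤ X →
      0 ≤ F → m * (T * k ^ 2 + X ^ 2) ≤ F * (k + N) → m * X ^ 2 ≤ F * N + A * β * k * X →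
      m * T * δ ≤ A * β ^ 2 * k + A * β * X → δ + N ≤ C * F * (1 + β / T) ^ 2 := by
  set D := T₁ / (4 * m)
  have hD : 0 ≤ D := by positivity
  set B := 1 + (1 + D) / m
  have hB : 1 ≤ B := by
    have : 0 ≤ (1 + D) / m := by positivity
    linarith
  refine ⟨A * B / m + A * (1 + A * B) / m ^ 2 + (1 + A * B) / m, by positivity, ?_⟩
  intro T β k X N δ F hT hTT hβ hk hX hN hF h1 h2 h3
  have hb : 0 ≤ β / T := by positivity
  have hβb : β = β / T * T := by field_simp
  set b := β / T
  -- `y = T k` solves a quadratic inequality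
  set y := T * k
  have hy : 0 ≤ y := by positivity
  have hy2 : m * y ^ 2 ≤ F * y + D * F ^ 2 := by
    have e1 : m * (T * k ^ 2) ≤ F * k + F ^ 2 / (4 * m) := by
      have e2 : F * X ≤ m * X ^ 2 + F ^ 2 / (4 * m) := by
        have : m * X ^ 2 + F ^ 2 / (4 * m) - F * X = (2 * m * X - F) ^ 2 / (4 * m) := by
          field_simp
          ring
        have h0 : 0 ≤ (2 * m * X - F) ^ 2 / (4 * m) := by positivity
        linarith
      nlinarith [mul_le_mul_of_nonneg_left hN hF]
    calc m * y ^ 2 = T * (m * (T * k ^ 2)) := by simp only [y]; ring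
      _ ≤ T * (F * k + F ^ 2 / (4 * m)) := by gcongr
      _ = F * y + T / (4 * m) * F ^ 2 := by simp only [y]; ring
      _ ≤ F * y + D * F ^ 2 := by simp only [D]; gcongr
  have hyF : y ≤ B * F := by
    by_contra! hlt
    have hFy : F ≤ y := le_trans (le_mul_of_one_le_left hF hB) hlt.le
    have hy0 : 0 < y := lt_of_le_of_lt (by positivity) hlt
    have e1 : m * y ≤ (1 + D) * F := by
      refine le_of_mul_le_mul_right ?_ hy0
      nlinarith [mul_le_mul_of_nonneg_left hFy (mul_nonneg hD hF)]
    have e2 : y ≤ (1 + D) / m * F := by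
      rw [div_mul_eq_mul_div, le_div_iff₀ hm]
      linarith
    have e3 : B * F = F + (1 + D) / m * F := by simp only [B]; ring
    linarith
  have hX1 : X ≤ F * (1 + A * B * b) / m := by
    rw [le_div_iff₀ hm]
    rcases hX.eq_or_lt with h0 | h0
    · rw [← h0, zero_mul]
      positivity
    · have e1 : m * X ≤ F + A * b * y := by
        refine le_of_mul_le_mul_right ?_ h0
        have e2 : A * β * k = A * b * y := by rw [hβb]; simp only [y]; ring
        rw [e2] at h2
        nlinarith [mul_le_mul_of_nonneg_left hN hF]
      have e3 : A * b * y ≤ A * b * (B * F) := by gcongr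
      linarith
  have hδ : m * δ ≤ A * b ^ 2 * y + A * b * X := by
    refine le_of_mul_le_mul_right ?_ hT
    calc m * δ * T = m * T * δ := by ring
      _ ≤ A * β ^ 2 * k + A * β * X := h3
      _ = _ := by rw [hβb]; simp only [y]; ring
  have hδ2 : δ ≤ F * (A * B * b ^ 2 / m + A * b * (1 + A * B * b) / m ^ 2) := by
    have e1 : δ ≤ (A * b ^ 2 * (B * F) + A * b * (F * (1 + A * B * b) / m)) / m := by
      rw [le_div_iff₀ hm, mul_comm δ]
      refine hδ.trans ?_
      gcongr
    refine e1.trans_eq ?_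
    field_simp
  have f1 : b ^ 2 ≤ (1 + b) ^ 2 := by gcongr; linarith
  have f2 : 1 + A * B * b ≤ (1 + A * B) * (1 + b) := by nlinarith [mul_nonneg hA (by linarith : 0 ≤ B)]
  have f3 : b * (1 + A * B * b) ≤ (1 + A * B) * (1 + b) ^ 2 := by
    have : b * (1 + A * B * b) ≤ (1 + b) * ((1 + A * B) * (1 + b)) := by
      gcongr
      linarith
    linarith
  have f4 : 1 + A * B * b ≤ (1 + A * B) * (1 + b) ^ 2 := by
    refine f2.trans ?_
    have : 0 ≤ (1 + A * B) := by positivity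
    gcongr
    nlinarith
  calc δ + N ≤ F * (A * B * b ^ 2 / m + A * b * (1 + A * B * b) / m ^ 2)
        + F * (1 + A * B * b) / m := by linarith
    _ = F * (A * B / m * b ^ 2 + A / m ^ 2 * (b * (1 + A * B * b)) + 1 / m * (1 + A * B * b)) := by
        ring
    _ ≤ F * (A * B / m * (1 + b) ^ 2 + A / m ^ 2 * ((1 + A * B) * (1 + b) ^ 2) +
        1 / m * ((1 + A * B) * (1 + b) ^ 2)) := by gcongr
    _ = _ := by ring

/-! ### The resolvent estimate -/

lemma IsShiftedInverse.exists_weak {d : ℕ} {α t : ℝ} {μ : E d → E d → ℝ} {ξ : E d}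
    {R : L2Cell d →L[ℂ] L2Cell d} (hR : IsShiftedInverse (opGraph α μ ξ) t R) (f : L2Cell d) :
    R f ∈ perSobolev d (α / 2) ∧ ∀ φ ∈ perSobolev d (α / 2),
      blochForm α μ ξ (R f) φ + t * inner ℂ φ (R f) = inner ℂ φ f := by
  obtain ⟨g, ⟨hu, hg⟩, hgf⟩ := (hR f (R f)).1 rfl
  refine ⟨hu, fun φ hφ => ?_⟩
  have h1 : (inner ℂ φ f : ℂ) = inner ℂ φ (g + (t : ℂ) • R f) := by rw [hgf]
  rw [hg φ hφ, h1, inner_add_right, inner_smul_right]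

/-- Away from the zeroth coefficient the effective resolvent is bounded uniformly in all
parameters. -/
lemma norm_meanZeroPart_effective_le {d : ℕ} {α κ t m : ℝ} (hα : 0 < α) (hm : 0 < m) (hκ : m ≤ κ)
    (ht : 0 < t) {ξ : E d} (hξ : ξ ∈ dualCell d) {R₀ : L2Cell d →L[ℂ] L2Cell d}
    (hR₀ : ∀ f n, fourierCoef (R₀ f) n =
        (((κ * ‖freq ξ n‖ ^ α + t)⁻¹ : ℝ) : ℂ) * fourierCoef f n) (f : L2Cell d) :
    ‖meanZeroPart (R₀ f)‖ ≤ 1 / m * ‖f‖ := by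
  refine le_of_sq_le_sq ?_ (by positivity)
  rw [mul_pow]
  refine hasSum_le (fun n => ?_) (hasSum_fourierCoef_sq (meanZeroPart (R₀ f)))
    ((hasSum_fourierCoef_sq f).mul_left ((1 / m) ^ 2))
  rw [← mul_pow, fourierCoef_meanZeroPart]
  refine pow_le_pow_left₀ (norm_nonneg _) ?_ 2
  split_ifs with hn
  · rw [norm_zero]
    positivity
  · have h1 : 1 ≤ ‖freq ξ n‖ ^ α := Real.one_le_rpow
      (by linarith [pi_le_norm_freq hξ hn, Real.pi_gt_three]) hα.le
    have h2 : m ≤ κ * ‖freq ξ n‖ ^ α + t := by nlinarith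
    rw [hR₀, norm_mul, Complex.norm_real, Real.norm_of_nonneg (inv_nonneg.2 (by linarith)),
      one_div]
    gcongr

lemma re_ofReal_mul_inner_self {d : ℕ} (t : ℝ) (u : L2Cell d) :
    ((t : ℂ) * inner ℂ u u).re = t * ‖u‖ ^ 2 := by
  rw [Complex.re_ofReal_mul]
  exact congrArg (t * ·) (inner_self_eq_norm_sq (𝕜 := ℂ) u)

/-- The resolvents are bounded by `t⁻¹`. -/
lemma IsPeriodicCoefficient.norm_resolvent_le {d : ℕ} [NeZero d] {α μm μp t : ℝ}
    {μ : E d → E d → ℝ} (h : IsPeriodicCoefficient μm μp μ) (h0 : 0 < μm) (hα : 0 < α)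
    (hα2 : α < 2) (ht : 0 < t) {ξ : E d} {R : L2Cell d →L[ℂ] L2Cell d}
    (hR : IsShiftedInverse (opGraph α μ ξ) t R) : ‖R‖ ≤ t⁻¹ := by
  refine R.opNorm_le_bound (by positivity) fun f => ?_
  obtain ⟨hu, hw⟩ := hR.exists_weak f
  have h1 := congrArg Complex.re (hw _ hu)
  have h3 : (inner ℂ (R f) f).re ≤ ‖R f‖ * ‖f‖ :=
    (Complex.re_le_norm _).trans (norm_inner_le_norm _ _)
  have h4 := h.le_re_blochForm h0 hα hα2 ξ hu
  have h5 : 0 ≤ c0 d α * μm * freqEnergy α ξ (R f) :=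
    mul_nonneg (mul_nonneg (c0_pos hα hα2).le h0.le) (freqEnergy_nonneg _ _ _)
  rw [Complex.add_re, re_ofReal_mul_inner_self] at h1
  have h6 : t * ‖R f‖ ^ 2 ≤ ‖R f‖ * ‖f‖ := by linarith
  rw [inv_mul_eq_div, le_div_iff₀ ht]
  rcases (norm_nonneg (R f)).eq_or_lt with h7 | h7
  · rw [← h7, zero_mul]
    positivity
  · refine le_of_mul_le_mul_left ?_ h7
    linarith

/-- Comparison of the resolvents by testing the equation `𝔸(ξ)u + tu = f` with `u`, with its part
`v` of mean value zero, and with the constant function. -/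
lemma exists_norm_resolvent_sub_le (d : ℕ) [NeZero d] {α μm μp T₁ : ℝ} (hα : 0 < α) (hα2 : α < 2)
    (h0 : 0 < μm) (hμ : μm ≤ μp) (hT₁ : 0 ≤ T₁) :
    ∃ C : ℝ, 0 ≤ C ∧ ∀ μ : E d → E d → ℝ, IsPeriodicCoefficient μm μp μ →
      ∀ t : ℝ, 0 < t → ∀ ξ ∈ dualCell d, ‖ξ‖ ^ α + t ≤ T₁ →
      ∀ R R₀ : L2Cell d →L[ℂ] L2Cell d, IsShiftedInverse (opGraph α μ ξ) t R →
      (∀ f n, fourierCoef (R₀ f) n =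
        (((meanCoef μ * c0 d α * ‖freq ξ n‖ ^ α + t)⁻¹ : ℝ) : ℂ) * fourierCoef f n) →
      ‖R - R₀‖ ≤ C * (1 + (‖ξ‖ + tail d α ‖ξ‖) / (‖ξ‖ ^ α + t)) ^ 2 := by
  obtain ⟨K, hK, hcoup⟩ := exists_norm_blochForm_constOne_le (d := d) hα hα2
  obtain ⟨M, hM, hdiag⟩ := exists_norm_blochForm_sub_le d hα hα2
  have hc0 : 0 < c0 d α := c0_pos hα hα2
  have hμp : 0 < μp := h0.trans_le hμ
  set m := min (c0 d α * μm) 1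
  have hm : 0 < m := lt_min (by positivity) one_pos
  have hm1 : m ≤ 1 := min_le_right _ _
  have hmc : m ≤ c0 d α * μm := min_le_left _ _
  set A := μp * (K + 2 + M)
  have hA : 0 ≤ A := by positivity
  obtain ⟨C, hC, hest⟩ := exists_coupled_estimate hm hA hT₁
  refine ⟨C + 1 / m, by positivity, fun μ h t ht ξ hξ hT R R₀ hR hR₀ => ?_⟩
  set s := ‖ξ‖
  have hs : 0 ≤ s := norm_nonneg _
  have hτ : 0 ≤ tail d α s := tail_nonneg hs
  set τ := tail d α s
  set β := s + τ
  have hβ : 0 ≤ β := by positivity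
  set T := s ^ α + t
  have hT0 : 0 < T := by positivity
  have hκ : m ≤ meanCoef μ * c0 d α := by
    refine hmc.trans ?_
    rw [mul_comm]
    gcongr
    exact h.le_meanCoef
  refine ContinuousLinearMap.opNorm_le_bound _ (by positivity) fun f => ?_
  obtain ⟨hu, hw⟩ := hR.exists_weak f
  rw [sub_apply]
  set u := R f
  set c := fourierCoef u 0
  set e := constOne d
  set v := meanZeroPart u
  have he : e ∈ perSobolev d (α / 2) := constOne_mem hα hα2
  have hv : v ∈ perSobolev d (α / 2) := meanZeroPart_mem hα hα2 hu
  have huv : c • e + v = u := smul_add_meanZeroPart u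
  set X := √(freqEnergy α ξ v)
  have hX : 0 ≤ X := Real.sqrt_nonneg _
  have hX2 : X ^ 2 = freqEnergy α ξ v := Real.sq_sqrt (freqEnergy_nonneg _ _ _)
  have hNX : ‖v‖ ≤ X := norm_meanZeroPart_le hα hα2 hξ hu
  have hev : ‖blochForm α μ ξ e v‖ ≤ A * β * X := by
    refine (hcoup μm μp μ h0 h ξ v hv).trans ?_
    have e1 : K * s * X + 2 * τ * ‖v‖ ≤ (K + 2 + M) * β * X := by
      have e2 : 2 * τ * ‖v‖ ≤ 2 * τ * X := by gcongr
      have e3 : 0 ≤ K * τ * X := by positivity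
      have e4 : 0 ≤ (2 * s + M * β) * X := by positivity
      have e5 : (K + 2 + M) * β * X = K * s * X + 2 * τ * X + K * τ * X + (2 * s + M * β) * X := by
        simp only [β]
        ring
      linarith
    calc μp * (K * s * X + 2 * τ * ‖v‖) ≤ μp * ((K + 2 + M) * β * X) := by gcongr
      _ = _ := by simp only [A]; ring
  have hve : ‖blochForm α μ ξ v e‖ ≤ A * β * X := by
    rw [← h.blochForm_conj h0 hα hα2 ξ he hv, RCLike.norm_conj]
    exact hev
  have hee : ‖blochForm α μ ξ e e - ((meanCoef μ * c0 d α * s ^ α : ℝ) : ℂ)‖ ≤ A * β ^ 2 := by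
    refine (hdiag μm μp μ h0 h ξ).trans ?_
    have e1 : M * (s ^ 2 + s * τ) ≤ (K + 2 + M) * β ^ 2 := by
      have e2 : 0 ≤ (K + 2) * β ^ 2 := by positivity
      have e3 : 0 ≤ M * (τ * β) := by positivity
      have e4 : (K + 2 + M) * β ^ 2 = (K + 2) * β ^ 2 + M * (τ * β) + M * (s ^ 2 + s * τ) := by
        simp only [β]
        ring
      linarith
    calc μp * (M * (s ^ 2 + s * τ)) ≤ μp * ((K + 2 + M) * β ^ 2) := by gcongr
      _ = _ := by simp only [A]; ring
  -- testing with `u`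
  have test_u : m * (T * ‖c‖ ^ 2 + X ^ 2) ≤ ‖f‖ * (‖c‖ + ‖v‖) := by
    have h1 := congrArg Complex.re (hw u hu)
    rw [Complex.add_re, re_ofReal_mul_inner_self] at h1
    have h3 : (inner ℂ u f).re ≤ ‖u‖ * ‖f‖ :=
      (Complex.re_le_norm _).trans (norm_inner_le_norm _ _)
    have h4 := h.le_re_blochForm h0 hα hα2 ξ hu
    rw [freqEnergy_eq_add hα hα2 ξ hu, ← hX2] at h4
    have h5 : ‖u‖ ≤ ‖c‖ + ‖v‖ := by
      rw [← huv]
      refine (norm_add_le _ _).trans ?_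
      rw [norm_smul, norm_constOne, mul_one]
    have h6 : ‖c‖ ^ 2 ≤ ‖u‖ ^ 2 := by
      gcongr
      exact norm_fourierCoef_le _ _
    have h7 : m * (s ^ α * ‖c‖ ^ 2 + X ^ 2) ≤ c0 d α * μm * (s ^ α * ‖c‖ ^ 2 + X ^ 2) := by gcongr
    have h8 : m * (t * ‖c‖ ^ 2) ≤ 1 * (t * ‖u‖ ^ 2) := by gcongr
    have h9 : ‖u‖ * ‖f‖ ≤ (‖c‖ + ‖v‖) * ‖f‖ := by gcongr
    simp only [T]
    linarith
  -- testing with `v`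
  have test_v : m * X ^ 2 ≤ ‖f‖ * ‖v‖ + A * β * ‖c‖ * X := by
    have h1 := hw v hv
    rw [← huv, h.blochForm_smul_add h0 hα hα2 ξ c he hv hv, inner_add_right, inner_smul_right,
      inner_meanZeroPart_constOne, mul_zero, zero_add] at h1
    have h1 := congrArg Complex.re h1
    rw [Complex.add_re, Complex.add_re, re_ofReal_mul_inner_self] at h1
    have h3 : (inner ℂ v f).re ≤ ‖v‖ * ‖f‖ :=
      (Complex.re_le_norm _).trans (norm_inner_le_norm _ _)
    have h4 := h.le_re_blochForm h0 hα hα2 ξ hv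
    rw [← hX2] at h4
    have h5 : -(c * blochForm α μ ξ e v).re ≤ ‖c‖ * (A * β * X) := by
      refine (neg_le_abs _).trans ((Complex.abs_re_le_norm _).trans ?_)
      rw [norm_mul]
      gcongr
    have h6 : m * X ^ 2 ≤ c0 d α * μm * X ^ 2 := by gcongr
    have h7 : 0 ≤ t * ‖v‖ ^ 2 := by positivity
    linarith
  -- testing with constants
  set r := meanCoef μ * c0 d α * s ^ α + t
  have hr : m * T ≤ r := by
    have e1 : m * s ^ α ≤ meanCoef μ * c0 d α * s ^ α := by gcongr
    have e2 : m * t ≤ 1 * t := by gcongr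
    simp only [T, r]
    linarith
  have hr0 : 0 < r := lt_of_lt_of_le (by positivity) hr
  set c₀ := fourierCoef (R₀ f) 0
  have hc₀ : (r : ℂ) * c₀ = fourierCoef f 0 := by
    simp only [c₀]
    rw [hR₀, freq_zero, ← mul_assoc, ← Complex.ofReal_mul, mul_inv_cancel₀ hr0.ne',
      Complex.ofReal_one, one_mul]
  have test_e : m * T * ‖c - c₀‖ ≤ A * β ^ 2 * ‖c‖ + A * β * X := by
    have h1 := hw e he
    rw [inner_constOne, inner_constOne, ← hc₀] at h1
    have h2 : blochForm α μ ξ u e = c * blochForm α μ ξ e e + blochForm α μ ξ v e := by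
      rw [← h.blochForm_smul_add h0 hα hα2 ξ c he hv he, huv]
    rw [h2] at h1
    have h3 : (r : ℂ) * (c - c₀) = -(c * (blochForm α μ ξ e e -
        ((meanCoef μ * c0 d α * s ^ α : ℝ) : ℂ)) + blochForm α μ ξ v e) := by
      have e1 : (r : ℂ) = ((meanCoef μ * c0 d α * s ^ α : ℝ) : ℂ) + t := by
        simp only [r]
        push_cast
        ring
      rw [mul_sub, ← h1, e1]
      ring
    calc m * T * ‖c - c₀‖ ≤ r * ‖c - c₀‖ := by gcongr
      _ = ‖(r : ℂ) * (c - c₀)‖ := by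
          rw [norm_mul, Complex.norm_real, Real.norm_of_nonneg hr0.le]
      _ ≤ ‖c‖ * (A * β ^ 2) + A * β * X := by
          rw [h3, norm_neg]
          refine (norm_add_le _ _).trans ?_
          rw [norm_mul]
          gcongr
      _ = _ := by ring
  have hmain := hest T β ‖c‖ X ‖v‖ ‖c - c₀‖ ‖f‖ hT0 hT hβ (norm_nonneg _) hX hNX (norm_nonneg _)
    test_u test_v test_e
  have hmz := norm_meanZeroPart_effective_le hα hm hκ ht hξ hR₀ f
  have hdec : u - R₀ f = (c - c₀) • e + v - meanZeroPart (R₀ f) := by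
    have h1 : c₀ • e + meanZeroPart (R₀ f) = R₀ f := smul_add_meanZeroPart (R₀ f)
    calc u - R₀ f = c • e + v - (c₀ • e + meanZeroPart (R₀ f)) := by rw [huv, h1]
      _ = _ := by
        rw [sub_smul]
        abel
  have hone : 1 ≤ (1 + β / T) ^ 2 := by
    have : 0 ≤ β / T := by positivity
    nlinarith
  calc ‖u - R₀ f‖ ≤ ‖c - c₀‖ + ‖v‖ + ‖meanZeroPart (R₀ f)‖ := by
        rw [hdec]
        refine (norm_sub_le _ _).trans ?_
        gcongr
        refine (norm_add_le _ _).trans ?_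
        rw [norm_smul, norm_constOne, mul_one]
    _ ≤ C * ‖f‖ * (1 + β / T) ^ 2 + 1 / m * ‖f‖ * 1 := by linarith
    _ ≤ C * ‖f‖ * (1 + β / T) ^ 2 + 1 / m * ‖f‖ * (1 + β / T) ^ 2 := by gcongr
    _ = _ := by ring

/-- For `ε > 1` the trivial bound of the resolvents is below the rate, as `-α ≤ 2 - 2α`. -/
lemma inv_rpow_le_rate {α ε : ℝ} (hα : 0 < α) (hα2 : α < 2) (hε : 1 < ε) :
    (ε ^ α)⁻¹ ≤ rate α ε := by
  have h1 : (ε ^ α)⁻¹ ≤ 1 := inv_le_one_of_one_le₀ (Real.one_le_rpow hε.le hα.le)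
  rw [rate]
  split_ifs
  · exact h1
  · refine h1.trans (one_le_pow₀ ?_)
    simp
  · rw [← Real.rpow_neg (by linarith)]
    exact Real.rpow_le_rpow_of_exponent_le hε.le (by linarith)

lemma norm_le_of_mem_dualCell {d : ℕ} {ξ : E d} (hξ : ξ ∈ dualCell d) :
    ‖ξ‖ ≤ √(d * Real.pi ^ 2) := by
  rw [EuclideanSpace.norm_eq]
  refine Real.sqrt_le_sqrt ?_
  calc ∑ i, ‖ξ i‖ ^ 2 ≤ ∑ _i : Fin d, Real.pi ^ 2 := by
        gcongr with i
        exact abs_le.2 ⟨(hξ i).1, (hξ i).2.le⟩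
    _ = _ := by simp

end Levy

theorem theorem4p4 (d : ℕ) [NeZero d] (α μm μp : ℝ) (hα0 : 0 < α) (hα2 : α < 2) (hμm : 0 < μm) :
    ∃ C : ℝ, ∀ μ : Levy.E d → Levy.E d → ℝ, Levy.IsCoefficient μm μp μ →
      ∀ ε : ℝ, 0 < ε → ∀ ξ ∈ Levy.dualCell d,
        ∃ R R0 : Levy.L2Cell d →L[ℂ] Levy.L2Cell d,
          Levy.IsShiftedInverse (Levy.opGraph α μ ξ) (ε ^ α) R ∧
          Levy.IsShiftedInverse (Levy.effGraph α μ ξ) (ε ^ α) R0 ∧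
          ‖R - R0‖ ≤ C * Levy.rate α ε := by
  rcases lt_or_ge μp μm with hlt | hμ
  · -- there is no coefficient at all
    refine ⟨0, fun μ h => ?_⟩
    obtain ⟨p, hp⟩ := h.bounds.exists
    linarith [hp.1.trans hp.2]
  set S := √((d : ℝ) * Real.pi ^ 2)
  have hS : 0 ≤ S := Real.sqrt_nonneg _
  obtain ⟨C₁, hC₁, hres⟩ := Levy.exists_norm_resolvent_sub_le d hα0 hα2 hμm hμ
    (T₁ := S ^ α + 1) (by positivity)
  obtain ⟨C₂, hC₂, hrate⟩ := Levy.exists_coupling_le_rate d hα0 hα2 hS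
  refine ⟨C₁ * C₂ + 2, fun μ hcoef ε hε ξ hξ => ?_⟩
  obtain ⟨μ', h, hae⟩ := hcoef.exists_isPeriodicCoefficient
  rw [Levy.effGraph, ← Levy.opGraph_congr hae, ← Levy.meanCoef_congr hae]
  have ht : 0 < ε ^ α := Real.rpow_pos_of_pos hε α
  have hκ : 0 ≤ Levy.meanCoef μ' * Levy.c0 d α :=
    mul_nonneg (hμm.le.trans h.le_meanCoef) (Levy.c0_pos hα0 hα2).le
  obtain ⟨R, hR⟩ := h.exists_resolvent hμm hα0 hα2 ξ ht
  obtain ⟨R₀, hR₀, hcoefs, hnorm⟩ := Levy.exists_effective_resolvent (α := α) hκ ht ξ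
  refine ⟨R, R₀, hR, hR₀, ?_⟩
  have hs : ‖ξ‖ ≤ S := Levy.norm_le_of_mem_dualCell hξ
  rcases le_or_gt ε 1 with hε1 | hε1
  · have hT : ‖ξ‖ ^ α + ε ^ α ≤ S ^ α + 1 := by
      gcongr
      exact Real.rpow_le_one hε.le hε1 hα0.le
    have h1 := hrate ε hε hε1 ‖ξ‖ (norm_nonneg _) hs
    have h2 := hres μ' h (ε ^ α) ht ξ hξ hT R R₀ hR hcoefs
    have h3 : 0 ≤ Levy.rate α ε := by
      rw [Levy.rate]
      split_ifs <;> positivity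
    calc ‖R - R₀‖ ≤ C₁ * (C₂ * Levy.rate α ε) := h2.trans (by gcongr)
      _ ≤ (C₁ * C₂ + 2) * Levy.rate α ε := by linarith
  · have h1 := h.norm_resolvent_le hμm hα0 hα2 ht hR
    have h2 := Levy.inv_rpow_le_rate hα0 hα2 hε1
    have h3 : 0 ≤ (ε ^ α)⁻¹ := by positivity
    have h4 : 0 ≤ C₁ * C₂ * Levy.rate α ε := by
      have := h3.trans h2
      positivity
    linarith [norm_sub_le R R₀]
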